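/- Conventions. Let $(X,d)$ be a geodesic metric space. A geodesic is an isometric embedding $\gamma:I\to X$ of a closed interval $I\subset\mathbb R$ (segment, ray or line); a $C$-quasi-geodesic ($C\ge 1$) is a continuous map $\lambda:I\to X$ with $|s-t|/C-C\le d(\lambda(s),\lambda(t))\le C|s-t|+C$. A Morse gauge is a function $M:\mathbb R_{\ge1}\times\mathbb R_{\ge0}\to\mathbb R_{\ge0}$ that is non-decreasing and continuous in the second coordinate; $\gamma$ is $M$-Morse if for all $C\ge1$ every $C$-quasi-geodesic segment with endpoints on $\gamma$ lies in the closed $M(C,C)$-neighbourhood of $\gamma$. A geodesic $\gamma$ is $D$-contracting if for every $x\in X$ the closest-point projection to $\gamma$ of the open ball of radius $d(x,\gamma)$ around $x$ has diameter at most $D$. $X$ is Morse-dichotomous if for every Morse gauge $M$ there is $C\ge0$ such that all $M$-Morse geodesics of $X$ are $C$-contracting. A geodesic segment $\gamma$ is $r$-thin if for every geodesic quadrangle $(\gamma_1,\gamma_2,\gamma_3,\gamma_4)$ (sides may be degenerate) with $\gamma$ a subsegment of $\gamma_1$, the set $\gamma_2\cup\gamma_3\cup\gamma_4$ meets the closed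 $r$-ball around the midpoint of $\gamma$. A pair $(x,y)\in X\times X$ is anti-contracting if $d(x,y)\ge1$ and, for all $r\ge0$, no geodesic from $x$ to $y$ has an $r$-thin subsegment of length at least $10r+1$. The contraction space $\hat X$ is obtained from $X$ by attaching, for every anti-contracting pair $(x,y)$, an interval of length one with endpoints glued to $x$ and $y$; it carries the induced path metric $\hat d$. Every isometric action of a group on $X$ induces an isometric action on $\hat X$. A subgroup $H$ of a finitely generated group $G$ is stable if it is finitely generated, undistorted (the inclusion is a quasi-isometric embedding for word metrics), and there is a Morse gauge $M$ such that every geodesic in a Cayley graph of $G$ (for a finite generating set) between two points of $H$ is $M$-Morse. An action is geometric if it is isometric, cobounded and proper (for every point $x$ and every $R$, only finitely many $g$ satisfy $d(x,gx)\le R$). A hyperbolic space is a length space satisfying Gromov's four-point condition for some $\delta$. Theorem. Let a finitely generated group $G$ act geometrically on a Morse-dichotomous geodesic metric space $X$. Then $\hat X$ is a universal recognizing space for $G$: $\hat X$ is a hyperbolic space on which $G$ acts by isometries, and for every stable subgroup $H\le G$ and every $p\in\hat X$ the orbit map $H\to\hat X$, $h\mapsto hp$, is a quasi-isometric embedding (for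 the word metric of any finite generating set of $H$). Moreover, for every stable subgroup $H\le G$ and every $p\in\hat X$, $G$ acts acylindrically along the orbit $Hp$: for every $R>0$ there are $n\in\mathbb N$ and $D>0$ such that for all $x,y\in Hp$ with $\hat d(x,y)>D$, $$|\{g\in G : \hat d(x,gx)<R,\ \hat d(y,gy)<R\}|<n.$$ -/

import Mathlib

open Set

namespace Contraction

/-! ## Geodesics, thin segments, contraction, Morseness -/

section MetricNotions

variable {X : Type*} [PseudoMetricSpace X]

/-- `γ` is a geodesic defined on the (closed, possibly infinite) interval `I`. Only the values of
`γ` on `I` are relevant. -/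
structure IsGeodesic (γ : ℝ → X) (I : Set ℝ) : Prop where
  nonempty : I.Nonempty
  ordConnected : I.OrdConnected
  isClosed : IsClosed I
  dist_eq : ∀ s ∈ I, ∀ t ∈ I, dist (γ s) (γ t) = |s - t|

/-- `σ` is the image of a geodesic segment from `x` to `y` (possibly degenerate). -/
def IsSegment (σ : Set X) (x y : X) : Prop :=
  ∃ (γ : ℝ → X) (L : ℝ), 0 ≤ L ∧ IsGeodesic γ (Icc 0 L) ∧ γ 0 = x ∧ γ L = y ∧ σ = γ '' Icc 0 L

variable (X) in
/-- Any two points are joined by a geodesic segment. -/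
def IsGeodesicSpace : Prop := ∀ x y : X, ∃ σ : Set X, IsSegment σ x y

/-- The geodesic segment `γ|[a,b]` is `r`-thin: for every geodesic quadrangle whose first side
contains `γ|[a,b]`, the union of the three other sides meets the closed `r`-ball around the midpoint
of `γ|[a,b]`. The first side is `η|[c,d]`, parametrized such that it agrees with `γ` on `[a,b]`. -/
def IsThin (r : ℝ) (γ : ℝ → X) (a b : ℝ) : Prop :=
  ∀ (η : ℝ → X) (c d : ℝ), c ≤ a → b ≤ d → IsGeodesic η (Icc c d) → EqOn η γ (Icc a b) →
    ∀ (p q : X) (σ₂ σ₃ σ₄ : Set X),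
      IsSegment σ₂ (η d) p → IsSegment σ₃ p q → IsSegment σ₄ q (η c) →
        ∃ z ∈ σ₂ ∪ σ₃ ∪ σ₄, dist (γ ((a + b) / 2)) z ≤ r

variable (X) in
/-- The set of anti-contracting pairs, for the contraction gauge `K(r) = 10 r + 1`: pairs `(x, y)`
with `d(x, y) ≥ 1` such that no geodesic from `x` to `y` has, for any `r ≥ 0`, an `r`-thin
subsegment of length at least `10 r + 1`. -/
def antiContracting : Set (X × X) :=
  {e | 1 ≤ dist e.1 e.2 ∧
    ∀ (γ : ℝ → X) (L : ℝ), 0 ≤ L → IsGeodesic γ (Icc 0 L) → γ 0 = e.1 → γ L = e.2 →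
      ∀ r : ℝ, 0 ≤ r → ∀ a b : ℝ, 0 ≤ a → a ≤ b → b ≤ L → 10 * r + 1 ≤ b - a → ¬ IsThin r γ a b}

/-- The closest point projection of `x` to `Y`. -/
def closestPoints (Y : Set X) (x : X) : Set X :=
  {p | p ∈ Y ∧ ∀ y ∈ Y, dist x p ≤ dist x y}

/-- `Y` (the image of a geodesic) is `D`-contracting: for every `x`, the projection to `Y` of the open
ball around `x` of radius `d(x, Y)` has diameter at most `D`. -/
def IsContracting (D : ℝ) (Y : Set X) : Prop :=
  ∀ x : X, ∀ y ∈ Metric.ball x (Metric.infDist x Y), ∀ z ∈ Metric.ball x (Metric.infDist x Y),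
    ∀ p ∈ closestPoints Y y, ∀ q ∈ closestPoints Y z, dist p q ≤ D

/-- `lam` is a (continuous) `C`-quasi-geodesic on `I`. -/
def IsQuasiGeodesic (C : ℝ) (lam : ℝ → X) (I : Set ℝ) : Prop :=
  ContinuousOn lam I ∧ ∀ s ∈ I, ∀ t ∈ I,
    |t - s| / C - C ≤ dist (lam s) (lam t) ∧ dist (lam s) (lam t) ≤ C * |t - s| + C

/-- Morse gauges, as functions `[1, ∞) × [0, ∞) → [0, ∞)`. Values outside this domain are
irrelevant. -/
structure IsMorseGauge (M : ℝ → ℝ → ℝ) : Prop where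
  nonneg : ∀ K, 1 ≤ K → ∀ C, 0 ≤ C → 0 ≤ M K C
  mono : ∀ K, 1 ≤ K → MonotoneOn (M K) (Ici 0)
  cont : ∀ K, 1 ≤ K → ContinuousOn (M K) (Ici 0)

/-- `Y` (the image of a geodesic) is `M`-Morse: every `C`-quasi-geodesic segment with endpoints on
`Y` stays in the closed `M(C, C)`-neighbourhood of `Y`. -/
def IsMorse (M : ℝ → ℝ → ℝ) (Y : Set X) : Prop :=
  ∀ C : ℝ, 1 ≤ C → ∀ (lam : ℝ → X) (a b : ℝ), a ≤ b → IsQuasiGeodesic C lam (Icc a b) →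
    lam a ∈ Y → lam b ∈ Y → ∀ t ∈ Icc a b, Metric.infDist (lam t) Y ≤ M C C

variable (X) in
/-- Morse-dichotomous spaces. -/
def IsMorseDichotomous : Prop :=
  IsGeodesicSpace X ∧ ∀ M : ℝ → ℝ → ℝ, IsMorseGauge M → ∃ C : ℝ, 0 ≤ C ∧
    ∀ (γ : ℝ → X) (I : Set ℝ), IsGeodesic γ I → IsMorse M (γ '' I) → IsContracting C (γ '' I)

variable (X) in
/-- Any two points are joined by rectifiable paths of length arbitrarily close to their distance. -/
def IsLengthSpace : Prop :=
  ∀ x y : X, ∀ ε : ℝ, 0 < ε → ∃ (γ : ℝ → X) (L : ℝ), 0 ≤ L ∧ L ≤ dist x y + ε ∧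
    LipschitzOnWith 1 γ (Icc 0 L) ∧ γ 0 = x ∧ γ L = y

variable (X) in
/-- Hyperbolic (length) spaces, by Gromov's four-point condition. -/
def IsHyperbolicSpace : Prop :=
  IsLengthSpace X ∧ ∃ δ : ℝ, 0 ≤ δ ∧ ∀ x y z w : X,
    dist x z + dist y w ≤ max (dist x y + dist z w) (dist x w + dist y z) + 2 * δ

/-- Quasi-isometric embeddings. -/
def IsQIEmbedding {Y : Type*} [PseudoMetricSpace Y] (f : X → Y) : Prop :=
  ∃ C : ℝ, 1 ≤ C ∧ ∀ x y : X,
    dist x y / C - C ≤ dist (f x) (f y) ∧ dist (f x) (f y) ≤ C * dist x y + C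

end MetricNotions

/-! ## Attaching unit intervals to a metric space -/

section Attach

/-- The gluing relation: the interval attached for `e = (x, y)` starts at `x` and ends at `y`. -/
inductive GlueRel (X : Type*) (A : Set (X × X)) :
    X ⊕ (A × Icc (0 : ℝ) 1) → X ⊕ (A × Icc (0 : ℝ) 1) → Prop
  | left (e : A) : GlueRel X A (Sum.inr (e, ⟨0, by simp⟩)) (Sum.inl e.1.1)
  | right (e : A) : GlueRel X A (Sum.inr (e, ⟨1, by simp⟩)) (Sum.inl e.1.2)

/-- The space obtained from `X` by attaching, for every pair `(x, y) ∈ A`, an interval of length one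
with its endpoints glued to `x` and `y`. -/
def Attach (X : Type*) (A : Set (X × X)) : Type _ := Quot (GlueRel X A)

namespace Attach

variable {X : Type*} {A : Set (X × X)}

/-- The inclusion of `X`. -/
def incl (A : Set (X × X)) (x : X) : Attach X A := Quot.mk _ (Sum.inl x)

/-- The point with parameter `t` on the interval attached for `e`. -/
def pt (e : A) (t : Icc (0 : ℝ) 1) : Attach X A := Quot.mk _ (Sum.inr (e, t))

theorem pt_zero (e : A) (h : (0 : ℝ) ∈ Icc (0 : ℝ) 1) : pt e ⟨0, h⟩ = incl A e.1.1 :=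
  Quot.sound (GlueRel.left e)

theorem pt_one (e : A) (h : (1 : ℝ) ∈ Icc (0 : ℝ) 1) : pt e ⟨1, h⟩ = incl A e.1.2 :=
  Quot.sound (GlueRel.right e)

theorem cases_pt (p : Attach X A) : (∃ x, p = incl A x) ∨ ∃ e t, p = pt e t := by
  induction p using Quot.ind with
  | mk p =>
    rcases p with x | ⟨e, t⟩
    · exact Or.inl ⟨x, rfl⟩
    · exact Or.inr ⟨e, t, rfl⟩

/-- `IsChain p q ℓ`: there is a path from `p` to `q` of length `ℓ` which is a finite concatenation of
moves within `X` (of length given by the metric of `X`) and moves within attached intervals. -/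
inductive IsChain [MetricSpace X] (p : Attach X A) : Attach X A → ℝ → Prop
  | nil : IsChain p p 0
  | base (x y : X) (l : ℝ) : IsChain p (incl A x) l → IsChain p (incl A y) (l + dist x y)
  | edge (e : A) (s t : Icc (0 : ℝ) 1) (l : ℝ) :
      IsChain p (pt e s) l → IsChain p (pt e t) (l + |(s : ℝ) - t|)

variable [MetricSpace X]

theorem IsChain.trans {p q r : Attach X A} {l m : ℝ} (h : IsChain p q l) (h' : IsChain q r m) :
    IsChain p r (l + m) := by
  induction h' with
  | nil => simpa using h
  | base x y k _ ih => rw [← add_assoc]; exact .base x y _ ih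
  | edge e s t k _ ih => rw [← add_assoc]; exact .edge e s t _ ih

theorem isChain_incl (x y : X) : IsChain (incl A x) (incl A y) (dist x y) := by
  simpa using IsChain.base x y 0 (.nil (p := incl A x))

theorem isChain_pt (e : A) (s t : Icc (0 : ℝ) 1) :
    IsChain (pt e s) (pt e t) |(s : ℝ) - t| := by
  simpa using IsChain.edge e s t 0 (.nil (p := pt e s))

theorem IsChain.symm {p q : Attach X A} {l : ℝ} (h : IsChain p q l) : IsChain q p l := by
  induction h with
  | nil => exact .nil
  | base x y k _ ih =>
    have := (isChain_incl (A := A) y x).trans ih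
    rwa [dist_comm, add_comm] at this
  | edge e s t k _ ih =>
    have := (isChain_pt e t s).trans ih
    rwa [abs_sub_comm, add_comm] at this

theorem IsChain.nonneg {p q : Attach X A} {l : ℝ} (h : IsChain p q l) : 0 ≤ l := by
  induction h with
  | nil => exact le_rfl
  | base x y k _ ih => positivity
  | edge e s t k _ ih => positivity

theorem exists_isChain (p q : Attach X A) : ∃ l, IsChain p q l := by
  have key : ∀ p : Attach X A, ∃ x l, IsChain p (incl A x) l := by
    intro p
    rcases cases_pt p with ⟨x, rfl⟩ | ⟨e, t, rfl⟩
    · exact ⟨x, 0, .nil⟩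
    · have h0 : (0 : ℝ) ∈ Icc (0 : ℝ) 1 := left_mem_Icc.2 zero_le_one
      have := isChain_pt e t ⟨0, h0⟩
      rw [pt_zero] at this
      exact ⟨_, _, this⟩
  obtain ⟨x, l, h⟩ := key p
  obtain ⟨y, m, h'⟩ := key q
  exact ⟨_, (h.trans (isChain_incl x y)).trans h'.symm⟩

/-- The path metric: the infimum of the lengths of chains. -/
noncomputable instance : Dist (Attach X A) := ⟨fun p q => sInf {l | IsChain p q l}⟩

theorem dist_def (p q : Attach X A) : dist p q = sInf {l | IsChain p q l} := rfl

theorem IsChain.dist_le {p q : Attach X A} {l : ℝ} (h : IsChain p q l) : dist p q ≤ l :=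
  csInf_le ⟨0, fun _ hm => IsChain.nonneg hm⟩ h

theorem le_dist {p q : Attach X A} {c : ℝ} (h : ∀ l, IsChain p q l → c ≤ l) : c ≤ dist p q :=
  le_csInf (exists_isChain p q) h

/-- A function that is 1-Lipschitz on `X` and on each interval is 1-Lipschitz. -/
theorem sub_le_dist (F : Attach X A → ℝ)
    (hb : ∀ x y, F (incl A y) - F (incl A x) ≤ dist x y)
    (he : ∀ e (s t : Icc (0 : ℝ) 1), F (pt e t) - F (pt e s) ≤ |(s : ℝ) - t|)
    (p q : Attach X A) : F q - F p ≤ dist p q := by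
  refine le_dist fun l h => ?_
  induction h with
  | nil => simp
  | base x y k _ ih => linarith [hb x y]
  | edge e s t k _ ih => linarith [he e s t]

theorem sep_incl (x : X) (q : Attach X A) (h : dist (incl A x) q = 0) :
    incl A x = q := by
  let f : X → ℝ := fun y => min (dist x y) 1
  have hf0 : ∀ y, 0 ≤ f y := fun y => le_min dist_nonneg zero_le_one
  have hf1 : ∀ y, f y ≤ 1 := fun y => min_le_right _ _
  let F : Attach X A → ℝ := Quot.lift
    (Sum.elim f (fun z => min ((z.2 : ℝ) + f z.1.1.1) (1 - z.2 + f z.1.1.2))) (by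
      rintro _ _ (e | e)
      · have := hf0 e.1.2; have := hf1 e.1.1
        simp only [Sum.elim_inr, Sum.elim_inl]
        rw [min_eq_left] <;> linarith
      · have := hf0 e.1.1; have := hf1 e.1.2
        simp only [Sum.elim_inr, Sum.elim_inl]
        rw [min_eq_right] <;> linarith)
  have hFi : ∀ y, F (incl A y) = f y := fun y => rfl
  have hFp : ∀ e t, F (pt e t) = min ((t : ℝ) + f e.1.1) (1 - t + f e.1.2) := fun e t => rfl
  have key := sub_le_dist F
    (by
      intro y z
      rw [hFi, hFi]
      have h1 := dist_triangle x y z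
      have h2 : (0 : ℝ) ≤ dist y z := dist_nonneg
      have : f z ≤ f y + dist y z := by
        simp only [f]
        rcases min_cases (dist x y) 1 with h | h <;> rcases min_cases (dist x z) 1 with h' | h' <;>
          linarith
      linarith)
    (by
      intro e s t
      rw [hFp, hFp]
      have h1 := le_abs_self ((s : ℝ) - t)
      have h2 := neg_abs_le ((s : ℝ) - t)
      rcases min_cases ((s : ℝ) + f e.1.1) (1 - s + f e.1.2) with h | h <;>
        rcases min_cases ((t : ℝ) + f e.1.1) (1 - t + f e.1.2) with h' | h' <;> linarith)
    (incl A x) q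
  have hx : F (incl A x) = 0 := by simp [hFi, f]
  rw [hx, h] at key
  have hzero : ∀ y, f y ≤ 0 → x = y := by
    intro y hy
    simp only [f] at hy
    rcases min_cases (dist x y) 1 with h' | h'
    · exact dist_le_zero.1 (by linarith)
    · linarith
  rcases cases_pt q with ⟨y, rfl⟩ | ⟨e, t, rfl⟩
  · rw [hFi] at key
    rw [hzero y (by linarith)]
  · rw [hFp] at key
    have h0 := t.2.1
    have h1 := t.2.2
    have g1 := hf0 e.1.1
    have g2 := hf0 e.1.2
    rcases min_cases ((t : ℝ) + f e.1.1) (1 - t + f e.1.2) with h' | h'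
    · have ht : t = ⟨0, by simp⟩ := Subtype.ext (by simp only; linarith)
      rw [ht, pt_zero, hzero e.1.1 (by linarith)]
    · have ht : t = ⟨1, by simp⟩ := Subtype.ext (by simp only; linarith)
      rw [ht, pt_one, hzero e.1.2 (by linarith)]

open Classical in
theorem sep_pt (e : A) (t : Icc (0 : ℝ) 1) (h0 : (0 : ℝ) < t) (h1 : (t : ℝ) < 1)
    (q : Attach X A) (h : dist (pt e t) q = 0) : pt e t = q := by
  let c : ℝ := min t (1 - t)
  have hc : 0 < c := lt_min h0 (by linarith)
  let F : Attach X A → ℝ := Quot.lift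
    (Sum.elim (fun _ => c) (fun z => if z.1 = e then min |(z.2 : ℝ) - t| c else c)) (by
      rintro _ _ (e' | e')
      · simp only [Sum.elim_inr, Sum.elim_inl]
        split_ifs
        · rw [min_eq_right]
          rw [zero_sub, abs_neg, abs_of_pos h0]
          exact min_le_left _ _
        · rfl
      · simp only [Sum.elim_inr, Sum.elim_inl]
        split_ifs
        · rw [min_eq_right]
          rw [abs_of_pos (by linarith)]
          exact min_le_right _ _
        · rfl)
  have hFi : ∀ y, F (incl A y) = c := fun y => rfl
  have hFp : ∀ e' s, F (pt e' s) = if e' = e then min |(s : ℝ) - t| c else c := fun e s => rfl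
  have key := sub_le_dist F
    (by intro y z; rw [hFi, hFi]; simp)
    (by
      intro e' s u
      rw [hFp, hFp]
      split_ifs
      · have h3 := abs_sub_le (u : ℝ) s t
        rw [abs_sub_comm (u : ℝ) s] at h3
        have h4 := abs_nonneg ((s : ℝ) - u)
        rcases min_cases |(s : ℝ) - t| c with h | h <;>
          rcases min_cases |(u : ℝ) - t| c with h' | h' <;> linarith
      · simp)
    (pt e t) q
  have hx : F (pt e t) = 0 := by simp [hFp, hc.le]
  rw [hx, h] at key
  rcases cases_pt q with ⟨y, rfl⟩ | ⟨e', s, rfl⟩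
  · rw [hFi] at key; linarith
  · rw [hFp] at key
    split_ifs at key with hee
    · subst hee
      rcases min_cases |(s : ℝ) - t| c with h' | h'
      · have : |(s : ℝ) - t| = 0 := le_antisymm (by linarith) (abs_nonneg _)
        rw [Subtype.ext (sub_eq_zero.1 (abs_eq_zero.1 this))]
      · linarith
    · linarith

noncomputable instance : MetricSpace (Attach X A) where
  dist_self p := le_antisymm (IsChain.nil (p := p)).dist_le (le_dist fun _ h => h.nonneg)
  dist_comm p q := le_antisymm (le_dist fun _ h => h.symm.dist_le)
    (le_dist fun _ h => h.symm.dist_le)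
  dist_triangle p q r := by
    have h1 : ∀ l, IsChain p q l → dist p r - l ≤ dist q r := fun l h =>
      le_dist fun m h' => by linarith [(h.trans h').dist_le]
    have h2 : dist p r - dist q r ≤ dist p q := le_dist fun l h => by linarith [h1 l h]
    linarith
  eq_of_dist_eq_zero := by
    intro p q h
    rcases cases_pt p with ⟨x, rfl⟩ | ⟨e, t, rfl⟩
    · exact sep_incl x q h
    · rcases eq_or_lt_of_le t.2.1 with h0 | h0
      · have ht : t = ⟨0, by simp⟩ := Subtype.ext h0.symm
        rw [ht, pt_zero] at h ⊢
        exact sep_incl _ q h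
      · rcases eq_or_lt_of_le t.2.2 with h1 | h1
        · have ht : t = ⟨1, by simp⟩ := Subtype.ext h1
          rw [ht, pt_one] at h ⊢
          exact sep_incl _ q h
        · exact sep_pt e t h0 h1 q h

end Attach

end Attach

/-! ## The contraction space -/

/-- The contraction space of `X`, for the contraction gauge `K(r) = 10 r + 1`. -/
def ContractionSpace (X : Type*) [MetricSpace X] : Type _ := Attach X (antiContracting X)

noncomputable instance (X : Type*) [MetricSpace X] : MetricSpace (ContractionSpace X) :=
  inferInstanceAs (MetricSpace (Attach X (antiContracting X)))

section Action

variable {G : Type*} [Group G] {X : Type*} [MetricSpace X] [MulAction G X] [IsIsometricSMul G X]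

theorem IsGeodesic.smul {γ : ℝ → X} {I : Set ℝ} (h : IsGeodesic γ I) (g : G) :
    IsGeodesic (fun t => g • γ t) I :=
  ⟨h.nonempty, h.ordConnected, h.isClosed, fun s hs t ht => by rw [dist_smul, h.dist_eq s hs t ht]⟩

theorem IsSegment.smul {σ : Set X} {x y : X} (h : IsSegment σ x y) (g : G) :
    IsSegment ((fun z => g • z) '' σ) (g • x) (g • y) := by
  obtain ⟨γ, L, hL, hγ, rfl, rfl, rfl⟩ := h
  exact ⟨fun t => g • γ t, L, hL, hγ.smul g, rfl, rfl, by rw [image_image]⟩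

theorem IsThin.smul {r : ℝ} {γ : ℝ → X} {a b : ℝ} (h : IsThin r γ a b) (g : G) :
    IsThin r (fun t => g • γ t) a b := by
  intro η c d hc hd hη heq p q σ₂ σ₃ σ₄ h2 h3 h4
  obtain ⟨z, hz, hd⟩ := h (fun t => g⁻¹ • η t) c d hc hd (hη.smul g⁻¹)
    (fun t ht => by simp [heq ht]) (g⁻¹ • p) (g⁻¹ • q) _ _ _
    (h2.smul g⁻¹) (h3.smul g⁻¹) (h4.smul g⁻¹)
  rw [← image_union, ← image_union] at hz
  obtain ⟨w, hw, rfl⟩ := hz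
  refine ⟨w, hw, ?_⟩
  rwa [← dist_smul g, smul_inv_smul] at hd

theorem smul_mem_antiContracting {e : X × X} (he : e ∈ antiContracting X) (g : G) :
    g • e ∈ antiContracting X := by
  refine ⟨by simpa [dist_smul] using he.1, ?_⟩
  intro γ L hL hγ h0 h1 r hr a b ha hab hb hlen hthin
  exact he.2 (fun t => g⁻¹ • γ t) L hL (hγ.smul g⁻¹) (by simp [h0]) (by simp [h1]) r hr a b ha hab hb
    hlen (hthin.smul g⁻¹)

/-- The induced action: `g` maps `x ∈ X` to `g x`, and the interval attached for `(x, y)` to the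
interval attached for `(g x, g y)`, preserving the parameter. -/
def smulAux (g : G) : ContractionSpace X → ContractionSpace X :=
  Quot.map (Sum.map (fun x => g • x) (fun z => (⟨g • z.1.1, smul_mem_antiContracting z.1.2 g⟩, z.2)))
    (by
      rintro _ _ (e | e)
      · exact GlueRel.left ⟨g • e.1, smul_mem_antiContracting e.2 g⟩
      · exact GlueRel.right ⟨g • e.1, smul_mem_antiContracting e.2 g⟩)

instance : MulAction G (ContractionSpace X) where
  smul := smulAux
  one_smul p := by
    change smulAux 1 p = p
    induction p using Quot.ind with
    | mk p => rcases p with x | ⟨e, t⟩ <;> simp [smulAux, Quot.map] <;> rfl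
  mul_smul g h p := by
    change smulAux (g * h) p = smulAux g (smulAux h p)
    induction p using Quot.ind with
    | mk p => rcases p with x | ⟨e, t⟩ <;> simp [smulAux, Quot.map, mul_smul] <;> rfl

theorem isChain_smul (g : G) {p q : Attach X (antiContracting X)} {l : ℝ}
    (h : Attach.IsChain p q l) : Attach.IsChain (smulAux g p) (smulAux g q) l := by
  induction h with
  | nil => exact .nil
  | base x y k _ ih =>
    rw [← dist_smul g x y]
    exact Attach.IsChain.base (g • x) (g • y) k ih
  | edge e s t k _ ih =>
    exact Attach.IsChain.edge ⟨g • e.1, smul_mem_antiContracting e.2 g⟩ s t k ih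

instance : IsIsometricSMul G (ContractionSpace X) where
  isometry_smul g := by
    have h : ∀ (g : G) (p q : ContractionSpace X), dist (g • p) (g • q) ≤ dist p q :=
      fun g p q => Attach.le_dist fun l hl => (isChain_smul g hl).dist_le
    refine Isometry.of_dist_eq fun p q => le_antisymm (h g p q) ?_
    simpa using h g⁻¹ (g • p) (g • q)

end Action

/-! ## Word metrics, Cayley graphs, stable subgroups -/

/-- Finite generating sets. -/
structure FinGenSet (G : Type*) [Group G] where
  carrier : Set G
  finite : carrier.Finite
  closure_eq : Subgroup.closure carrier = ⊤

section Word

variable {G : Type*} [Group G]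

/-- The least length of a word in `S ∪ S⁻¹` representing `g`. -/
noncomputable def wordLength (S : Set G) (g : G) : ℕ :=
  sInf {n | ∃ l : List G, (∀ s ∈ l, s ∈ S ∨ s⁻¹ ∈ S) ∧ l.prod = g ∧ l.length = n}

theorem wordLength_le {S : Set G} (l : List G) (hl : ∀ s ∈ l, s ∈ S ∨ s⁻¹ ∈ S) :
    wordLength S l.prod ≤ l.length :=
  Nat.sInf_le ⟨l, hl, rfl, rfl⟩

theorem exists_word (S : FinGenSet G) (g : G) : ∃ l : List G,
    (∀ s ∈ l, s ∈ S.carrier ∨ s⁻¹ ∈ S.carrier) ∧ l.prod = g ∧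
      l.length = wordLength S.carrier g := by
  have hg : g ∈ (Subgroup.closure S.carrier).toSubmonoid := by rw [S.closure_eq]; trivial
  rw [Subgroup.closure_toSubmonoid] at hg
  obtain ⟨l, hl, hp⟩ := Submonoid.exists_list_of_mem_closure hg
  have hne : {n | ∃ l : List G, (∀ s ∈ l, s ∈ S.carrier ∨ s⁻¹ ∈ S.carrier) ∧ l.prod = g ∧
      l.length = n}.Nonempty := ⟨l.length, l, fun s hs => by simpa using hl s hs, hp, rfl⟩
  exact Nat.sInf_mem hne

/-- A copy of `G`, endowed with the word metric of `S`. -/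
@[ext]
structure WordSpace (S : FinGenSet G) where
  val : G

/-- The word metric `d(g, h) = |g⁻¹ h|`. -/
noncomputable instance (S : FinGenSet G) : MetricSpace (WordSpace S) where
  dist g h := wordLength S.carrier (g.val⁻¹ * h.val)
  dist_self g := by
    have := wordLength_le (S := S.carrier) ([] : List G) (by simp)
    simpa using this
  dist_comm g h := by
    have key : ∀ a : G, wordLength S.carrier a⁻¹ ≤ wordLength S.carrier a := by
      intro a
      obtain ⟨l, hl, hp, hn⟩ := exists_word S a
      have := wordLength_le (S := S.carrier) (l.map (·⁻¹)).reverse (by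
        intro s hs
        simp only [List.mem_reverse, List.mem_map] at hs
        obtain ⟨u, hu, rfl⟩ := hs
        rw [inv_inv]
        exact (hl u hu).symm)
      rwa [← List.prod_inv_reverse, hp, List.length_reverse, List.length_map, hn] at this
    have h1 : ∀ a : G, wordLength S.carrier a⁻¹ = wordLength S.carrier a := fun a =>
      le_antisymm (key a) (by simpa using key a⁻¹)
    rw [← h1 (g.val⁻¹ * h.val), mul_inv_rev, inv_inv]
  dist_triangle a b c := by
    obtain ⟨l, hl, hp, hn⟩ := exists_word S (a.val⁻¹ * b.val)
    obtain ⟨m, hm, hq, hk⟩ := exists_word S (b.val⁻¹ * c.val)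
    have := wordLength_le (S := S.carrier) (l ++ m) (by
      intro s hs
      rcases List.mem_append.1 hs with h | h
      · exact hl s h
      · exact hm s h)
    rw [List.prod_append, List.length_append, hp, hq, hn, hk, mul_assoc, mul_inv_cancel_left]
      at this
    exact_mod_cast this
  eq_of_dist_eq_zero := by
    intro g h hgh
    obtain ⟨l, -, hp, hn⟩ := exists_word S (g.val⁻¹ * h.val)
    have h0 : wordLength S.carrier (g.val⁻¹ * h.val) = 0 := by exact_mod_cast hgh
    rw [h0, List.length_eq_zero_iff] at hn
    subst hn
    exact WordSpace.ext (inv_mul_eq_one.1 hp.symm)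

/-- The Cayley graph of `G` as a metric graph: the vertex set `G`, with a unit interval attached
between `g` and `g s` for all `g ∈ G` and `s ∈ S`. The word metric on vertices, which enters the metric
of `Attach`, is the edge-path distance. -/
def CayleyGraph (S : FinGenSet G) : Type _ :=
  Attach (WordSpace S) {e : WordSpace S × WordSpace S | e.1.val⁻¹ * e.2.val ∈ S.carrier}

noncomputable instance (S : FinGenSet G) : MetricSpace (CayleyGraph S) :=
  inferInstanceAs (MetricSpace (Attach (WordSpace S) _))

/-- The vertex of the Cayley graph given by `g`. -/
def CayleyGraph.vertex (S : FinGenSet G) (g : G) : CayleyGraph S :=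
  Attach.incl _ (WordSpace.mk g)

/-- Stable subgroups of a finitely generated group: finitely generated, undistorted, and all
geodesics of the Cayley graph of `G` between points of `H` are uniformly Morse. -/
def IsStable (H : Subgroup G) : Prop :=
  ∃ (S : FinGenSet G) (T : FinGenSet H),
    IsQIEmbedding (fun h : WordSpace T => (WordSpace.mk (h.val : G) : WordSpace S)) ∧
    ∃ M : ℝ → ℝ → ℝ, IsMorseGauge M ∧
      ∀ h ∈ H, ∀ k ∈ H, ∀ (γ : ℝ → CayleyGraph S) (L : ℝ), 0 ≤ L → IsGeodesic γ (Icc 0 L) →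
        γ 0 = CayleyGraph.vertex S h → γ L = CayleyGraph.vertex S k → IsMorse M (γ '' Icc 0 L)

end Word

/-! ## Group actions -/

section Actions

variable (G : Type*) [Group G] (Y : Type*) [MetricSpace Y] [MulAction G Y]

/-- Geometric actions: by isometries, (metrically) proper, and cobounded. -/
structure IsGeometricAction : Prop where
  isometric : IsIsometricSMul G Y
  proper : ∀ (y : Y) (R : ℝ), {g : G | dist y (g • y) ≤ R}.Finite
  cobounded : ∃ (y : Y) (R : ℝ), ∀ z : Y, ∃ g : G, dist z (g • y) ≤ R

/-- The orbit maps of `H` into `Y` are quasi-isometric embeddings, for the word metrics on `H`. -/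
def IsRecognizingSpaceFor (H : Subgroup G) : Prop :=
  ∀ (T : FinGenSet H) (p : Y), IsQIEmbedding (fun h : WordSpace T => (h.val : G) • p)

/-- `Y` is a hyperbolic space on which `G` acts by isometries, and it is a recognizing space for
all stable subgroups of `G`. -/
def IsUniversalRecognizingSpace : Prop :=
  IsHyperbolicSpace Y ∧ IsIsometricSMul G Y ∧
    ∀ H : Subgroup G, IsStable H → IsRecognizingSpaceFor G Y H

variable {Y} in
/-- `G` acts acylindrically along the subset `A` of `Y`. -/
def ActsAcylindricallyAlong (A : Set Y) : Prop :=
  ∀ R : ℝ, 0 < R → ∃ (n : ℕ) (D : ℝ), 0 < D ∧ ∀ x ∈ A, ∀ y ∈ A, D < dist x y →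
    {g : G | dist x (g • x) < R ∧ dist y (g • y) < R}.encard < n

end Actions

end Contraction

open Contraction

namespace Contraction

/-! ### Geodesics and segments: gluing, splicing, subsegments. -/

section Geodesics

variable {X : Type*} [PseudoMetricSpace X]

/-! Hyperbolicity uses only that `X` is geodesic. Around a point of a geodesic, take a symmetric
window just long enough that its endpoints fail to be anti-contracting. Slightly shorter windows are
short or have anti-contracting endpoints, so the whole window has bounded size in the contraction
space. Failure to be anti-contracting means that some geodesic with the same endpoints has a long
thin subsegment, and thinness forces the other sides of any triangle containing the window to pass
nearby. A minimization argument (`exists_close_pair`) turns this into a uniform bound: geodesic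
triangles of `X` are 3-thin for `cdist` (`cdist_thin_triangle`). Geodesics of `X` are then a system
of thin paths in the contraction space. Repeated halving and an exponential divergence estimate show
that they stay close to almost length-minimizing paths (`cdist_add_le`), and the four-point
condition follows.

For a stable subgroup, the Milnor–Schwarz lemma transports Morseness from the Cayley graph to
geodesics of `X` between orbit points, and Morse-dichotomy makes these uniformly contracting
(`exists_contractsAlong`). A geodesic with long projection to a contracting geodesic must pass close
to it (`exists_dist_le`). Hence a long segment following a `D`-contracting geodesic is thin: some
other side of every quadrangle projects across its middle. An anti-contracting pair therefore has
projections at distance `O(D)`, so closest-point projection is coarsely Lipschitz even for `cdist`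
(`abs_sub_le_cdist`). Contracting geodesics thus embed quasi-isometrically in the contraction space,
which bounds orbit maps from below.

The same projection estimate yields acylindricity. If `g` moves two distant orbit points little in
the contraction space, the translate of the geodesic between them passes near a point at bounded
distance from the start of that geodesic. So `g` moves the starting point a bounded amount in `X`,
and properness leaves finitely many `g`. -/

theorem lipschitz_glue {f : ℝ → X} {N a b c : ℝ} (hab : a ≤ b) (hbc : b ≤ c)
    (h1 : ∀ s ∈ Icc a b, ∀ t ∈ Icc a b, dist (f s) (f t) ≤ N * |s - t|)
    (h2 : ∀ s ∈ Icc b c, ∀ t ∈ Icc b c, dist (f s) (f t) ≤ N * |s - t|) :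
    ∀ s ∈ Icc a c, ∀ t ∈ Icc a c, dist (f s) (f t) ≤ N * |s - t| := by
  have key : ∀ s ∈ Icc a c, ∀ t ∈ Icc a c, s ≤ t → dist (f s) (f t) ≤ N * |s - t| := by
    intro s hs t ht hst
    rcases le_total t b with htb | htb
    · exact h1 s ⟨hs.1, hst.trans htb⟩ t ⟨ht.1, htb⟩
    rcases le_total b s with hsb | hsb
    · exact h2 s ⟨hsb, hs.2⟩ t ⟨htb, ht.2⟩
    have e1 := h1 s ⟨hs.1, hsb⟩ b ⟨hab, le_rfl⟩
    have e2 := h2 b ⟨le_rfl, hbc⟩ t ⟨htb, ht.2⟩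
    rw [abs_of_nonpos (by linarith)] at e1 e2 ⊢
    have := dist_triangle (f s) (f b) (f t)
    linarith
  intro s hs t ht
  rcases le_total s t with h | h
  · exact key s hs t ht h
  · rw [dist_comm, abs_sub_comm]; exact key t ht s hs h

theorem lipschitz_one_glue {f : ℝ → X} {a b c : ℝ} (hab : a ≤ b) (hbc : b ≤ c)
    (h1 : ∀ s ∈ Icc a b, ∀ t ∈ Icc a b, dist (f s) (f t) ≤ |s - t|)
    (h2 : ∀ s ∈ Icc b c, ∀ t ∈ Icc b c, dist (f s) (f t) ≤ |s - t|) :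
    ∀ s ∈ Icc a c, ∀ t ∈ Icc a c, dist (f s) (f t) ≤ |s - t| := by
  have := lipschitz_glue (N := 1) hab hbc (by simpa only [one_mul] using h1)
    (by simpa only [one_mul] using h2)
  simpa only [one_mul] using this

/-- Any shortening between intermediate times would, by the triangle inequality, bring the two
endpoints too close. -/
theorem isGeodesic_of_lipschitz {f : ℝ → X} {c d : ℝ} (hcd : c ≤ d)
    (h : ∀ s ∈ Icc c d, ∀ t ∈ Icc c d, dist (f s) (f t) ≤ |s - t|)
    (hd : d - c ≤ dist (f c) (f d)) : IsGeodesic f (Icc c d) := by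
  refine ⟨nonempty_Icc.2 hcd, ordConnected_Icc, isClosed_Icc, ?_⟩
  have key : ∀ s ∈ Icc c d, ∀ t ∈ Icc c d, s ≤ t → dist (f s) (f t) = |s - t| := by
    intro s hs t ht hst
    refine le_antisymm (h s hs t ht) ?_
    have e1 := h c ⟨le_rfl, hcd⟩ s hs
    have e2 := h t ht d ⟨hcd, le_rfl⟩
    rw [abs_of_nonpos (by linarith [hs.1])] at e1
    rw [abs_of_nonpos (by linarith [ht.2])] at e2
    rw [abs_of_nonpos (by linarith)]
    have := dist_triangle4 (f c) (f s) (f t) (f d)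
    linarith
  intro s hs t ht
  rcases le_total s t with h | h
  · exact key s hs t ht h
  · rw [dist_comm, abs_sub_comm]; exact key t ht s hs h

namespace IsGeodesic

variable {γ : ℝ → X} {a b c d : ℝ}

theorem lipschitz {I : Set ℝ} (h : IsGeodesic γ I) :
    ∀ s ∈ I, ∀ t ∈ I, dist (γ s) (γ t) ≤ |s - t| := fun s hs t ht => (h.dist_eq s hs t ht).le

theorem continuousOn {I : Set ℝ} (h : IsGeodesic γ I) : ContinuousOn γ I := by
  have : LipschitzOnWith 1 γ I := LipschitzOnWith.of_dist_le_mul fun s hs t ht => by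
    rw [h.dist_eq s hs t ht, Real.dist_eq]; simp
  exact this.continuousOn

theorem sub (h : IsGeodesic γ (Icc c d)) (hca : c ≤ a) (hab : a ≤ b) (hbd : b ≤ d) :
    IsGeodesic γ (Icc a b) :=
  ⟨nonempty_Icc.2 hab, ordConnected_Icc, isClosed_Icc, fun s hs t ht =>
    h.dist_eq s ⟨hca.trans hs.1, hs.2.trans hbd⟩ t ⟨hca.trans ht.1, ht.2.trans hbd⟩⟩

theorem shift (h : IsGeodesic γ (Icc c d)) (u : ℝ) :
    IsGeodesic (fun t => γ (t + u)) (Icc (c - u) (d - u)) := by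
  have hcd := nonempty_Icc.1 h.nonempty
  refine ⟨nonempty_Icc.2 (by linarith), ordConnected_Icc, isClosed_Icc, fun s hs t ht => ?_⟩
  rw [h.dist_eq _ ⟨by linarith [hs.1], by linarith [hs.2]⟩ _
    ⟨by linarith [ht.1], by linarith [ht.2]⟩]
  congr 1; ring

theorem reverse (h : IsGeodesic γ (Icc c d)) : IsGeodesic (fun t => γ (-t)) (Icc (-d) (-c)) := by
  have hcd := nonempty_Icc.1 h.nonempty
  refine ⟨nonempty_Icc.2 (by linarith), ordConnected_Icc, isClosed_Icc, fun s hs t ht => ?_⟩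
  rw [h.dist_eq _ ⟨by linarith [hs.2], by linarith [hs.1]⟩ _
    ⟨by linarith [ht.2], by linarith [ht.1]⟩, abs_sub_comm]
  congr 1; ring

/-- Replacing a subsegment of a geodesic by another geodesic with the same endpoints. -/
theorem replace (h : IsGeodesic γ (Icc c d)) {η : ℝ → X} (hη : IsGeodesic η (Icc a b))
    (hca : c ≤ a) (hbd : b ≤ d) (ha : η a = γ a) (hb : η b = γ b) :
    IsGeodesic ((Icc a b).piecewise η γ) (Icc c d) := by
  classical
  have hab := nonempty_Icc.1 hη.nonempty
  have e1 : ∀ t ∈ Icc c a, (Icc a b).piecewise η γ t = γ t := by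
    intro t ht
    by_cases h' : t ∈ Icc a b
    · rw [piecewise_eq_of_mem _ _ _ h', le_antisymm ht.2 h'.1, ha]
    · rw [piecewise_eq_of_notMem _ _ _ h']
  have e2 : ∀ t ∈ Icc b d, (Icc a b).piecewise η γ t = γ t := by
    intro t ht
    by_cases h' : t ∈ Icc a b
    · rw [piecewise_eq_of_mem _ _ _ h', le_antisymm h'.2 ht.1, hb]
    · rw [piecewise_eq_of_notMem _ _ _ h']
  have e3 : ∀ t ∈ Icc a b, (Icc a b).piecewise η γ t = η t := fun t ht =>
    piecewise_eq_of_mem _ _ _ ht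
  have hcd : c ≤ d := hca.trans (hab.trans hbd)
  refine isGeodesic_of_lipschitz hcd ?_ ?_
  · refine lipschitz_one_glue hca (hab.trans hbd) ?_ (lipschitz_one_glue hab hbd ?_ ?_)
    · intro s hs t ht
      rw [e1 s hs, e1 t ht]
      exact h.lipschitz s ⟨hs.1, by linarith [hs.2]⟩ t ⟨ht.1, by linarith [ht.2]⟩
    · intro s hs t ht
      rw [e3 s hs, e3 t ht]
      exact hη.lipschitz s hs t ht
    · intro s hs t ht
      rw [e2 s hs, e2 t ht]
      exact h.lipschitz s ⟨by linarith [hs.1], hs.2⟩ t ⟨by linarith [ht.1], ht.2⟩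
  · rw [e1 c ⟨le_rfl, hca⟩, e2 d ⟨hbd, le_rfl⟩, h.dist_eq c ⟨le_rfl, hcd⟩ d ⟨hcd, le_rfl⟩,
      abs_sub_comm]
    exact le_abs_self _

theorem isSegment (h : IsGeodesic γ (Icc a b)) (hab : a ≤ b) :
    IsSegment (γ '' Icc a b) (γ a) (γ b) := by
  refine ⟨fun t => γ (t + a), b - a, by linarith, by simpa using h.shift a, by simp, by simp, ?_⟩
  ext x
  constructor
  · rintro ⟨t, ht, rfl⟩
    exact ⟨t - a, ⟨by linarith [ht.1], by linarith [ht.2]⟩, by simp⟩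
  · rintro ⟨t, ht, rfl⟩
    exact ⟨t + a, ⟨by linarith [ht.1], by linarith [ht.2]⟩, rfl⟩

end IsGeodesic

namespace IsSegment

variable {σ : Set X} {x y z : X}

theorem exists_geodesic (h : IsSegment σ x y) : ∃ γ : ℝ → X, IsGeodesic γ (Icc 0 (dist x y)) ∧
    γ 0 = x ∧ γ (dist x y) = y ∧ σ = γ '' Icc 0 (dist x y) := by
  obtain ⟨γ, L, hL, hγ, rfl, rfl, rfl⟩ := h
  have : dist (γ 0) (γ L) = L := by
    rw [hγ.dist_eq 0 ⟨le_rfl, hL⟩ L ⟨hL, le_rfl⟩, zero_sub, abs_neg, abs_of_nonneg hL]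
  rw [this]
  exact ⟨γ, hγ, rfl, rfl, rfl⟩

theorem refl (x : X) : IsSegment {x} x x := by
  refine ⟨fun _ => x, 0, le_rfl, ⟨by simp, by simpa using ordConnected_singleton, isClosed_Icc, ?_⟩,
    rfl, rfl, by simp⟩
  intro s hs t ht
  rw [Icc_self] at hs ht
  simp [mem_singleton_iff.1 hs, mem_singleton_iff.1 ht]

theorem symm (h : IsSegment σ x y) : IsSegment σ y x := by
  obtain ⟨γ, L, hL, hγ, rfl, rfl, rfl⟩ := h
  have := hγ.reverse.isSegment (by linarith)
  simp only [neg_neg, neg_zero] at this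
  convert this using 1
  ext x
  constructor
  · rintro ⟨t, ht, rfl⟩
    exact ⟨-t, ⟨by linarith [ht.2], by linarith [ht.1]⟩, by simp⟩
  · rintro ⟨t, ht, rfl⟩
    exact ⟨-t, ⟨by linarith [ht.2], by linarith [ht.1]⟩, rfl⟩

theorem left_mem (h : IsSegment σ x y) : x ∈ σ := by
  obtain ⟨γ, L, hL, hγ, rfl, rfl, rfl⟩ := h
  exact ⟨0, ⟨le_rfl, hL⟩, rfl⟩

theorem right_mem (h : IsSegment σ x y) : y ∈ σ := h.symm.left_mem

theorem isCompact (h : IsSegment σ x y) : IsCompact σ := by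
  obtain ⟨γ, L, hL, hγ, rfl, rfl, rfl⟩ := h
  exact isCompact_Icc.image_of_continuousOn hγ.continuousOn

theorem isPreconnected (h : IsSegment σ x y) : IsPreconnected σ := by
  obtain ⟨γ, L, hL, hγ, rfl, rfl, rfl⟩ := h
  exact isPreconnected_Icc.image _ hγ.continuousOn

theorem dist_add (h : IsSegment σ x y) (hz : z ∈ σ) : dist x z + dist z y = dist x y := by
  obtain ⟨γ, L, hL, hγ, rfl, rfl, rfl⟩ := h
  obtain ⟨t, ht, rfl⟩ := hz
  rw [hγ.dist_eq 0 ⟨le_rfl, hL⟩ t ht, hγ.dist_eq t ht L ⟨hL, le_rfl⟩,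
    hγ.dist_eq 0 ⟨le_rfl, hL⟩ L ⟨hL, le_rfl⟩, abs_of_nonpos (by linarith [ht.1]),
    abs_of_nonpos (by linarith [ht.2]), abs_of_nonpos (by linarith)]
  ring

theorem exists_left (h : IsSegment σ x y) (hz : z ∈ σ) : ∃ τ ⊆ σ, IsSegment τ x z := by
  obtain ⟨γ, L, hL, hγ, rfl, rfl, rfl⟩ := h
  obtain ⟨t, ht, rfl⟩ := hz
  exact ⟨_, image_mono (Icc_subset_Icc_right ht.2),
    (hγ.sub le_rfl ht.1 ht.2).isSegment ht.1⟩

theorem exists_right (h : IsSegment σ x y) (hz : z ∈ σ) : ∃ τ ⊆ σ, IsSegment τ z y := by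
  obtain ⟨τ, h1, h2⟩ := h.symm.exists_left hz
  exact ⟨τ, h1, h2.symm⟩

end IsSegment

end Geodesics

/-! ### Lipschitz paths subject to a pointwise condition. -/

section Paths

variable {X : Type*} [PseudoMetricSpace X]

/-- `p` and `q` are joined by a 1-Lipschitz path `[0, l] → X` all of whose points satisfy `P`. -/
def PathIn (P : X → Prop) (p q : X) (l : ℝ) : Prop :=
  0 ≤ l ∧ ∃ γ : ℝ → X, (∀ s ∈ Icc 0 l, ∀ t ∈ Icc 0 l, dist (γ s) (γ t) ≤ |s - t|) ∧
    γ 0 = p ∧ γ l = q ∧ ∀ t ∈ Icc 0 l, P (γ t)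

namespace PathIn

variable {P Q : X → Prop} {p q r : X} {l m : ℝ}

theorem refl (hp : P p) : PathIn P p p 0 :=
  ⟨le_rfl, fun _ => p, fun s _ t _ => by simp, rfl, rfl, fun _ _ => hp⟩

theorem mono (h : PathIn P p q l) (hPQ : ∀ x, dist p x ≤ l → P x → Q x) : PathIn Q p q l := by
  obtain ⟨hl, γ, h1, h2, h3, h4⟩ := h
  refine ⟨hl, γ, h1, h2, h3, fun t ht => hPQ _ ?_ (h4 t ht)⟩
  rw [← h2]
  refine (h1 0 ⟨le_rfl, hl⟩ t ht).trans ?_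
  rw [zero_sub, abs_neg, abs_of_nonneg ht.1]
  exact ht.2

theorem of_lipschitz {γ : ℝ → X} {a b : ℝ} (hab : a ≤ b)
    (h : ∀ s ∈ Icc a b, ∀ t ∈ Icc a b, dist (γ s) (γ t) ≤ |s - t|)
    (hP : ∀ t ∈ Icc a b, P (γ t)) : PathIn P (γ a) (γ b) (b - a) := by
  refine ⟨by linarith, fun t => γ (t + a), fun s hs t ht => ?_, by simp, by simp, fun t ht =>
    hP _ ⟨by linarith [ht.1], by linarith [ht.2]⟩⟩
  have := h (s + a) ⟨by linarith [hs.1], by linarith [hs.2]⟩ (t + a)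
    ⟨by linarith [ht.1], by linarith [ht.2]⟩
  rwa [add_sub_add_right_eq_sub] at this

theorem symm (h : PathIn P p q l) : PathIn P q p l := by
  obtain ⟨hl, γ, h1, rfl, rfl, h4⟩ := h
  refine ⟨hl, fun t => γ (l - t), fun s hs t ht => ?_, by simp, by simp, fun t ht =>
    h4 _ ⟨by linarith [ht.2], by linarith [ht.1]⟩⟩
  have := h1 (l - s) ⟨by linarith [hs.2], by linarith [hs.1]⟩ (l - t)
    ⟨by linarith [ht.2], by linarith [ht.1]⟩
  rwa [sub_sub_sub_cancel_left, abs_sub_comm] at this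

theorem trans (h : PathIn P p q l) (h' : PathIn P q r m) : PathIn P p r (l + m) := by
  classical
  obtain ⟨hl, γ, h1, h2, h3, h4⟩ := h
  obtain ⟨hm, δ, h1', h2', h3', h4'⟩ := h'
  let f : ℝ → X := fun t => if t ≤ l then γ t else δ (t - l)
  have f1 : ∀ t ∈ Icc 0 l, f t = γ t := fun t ht => if_pos ht.2
  have f2 : ∀ t ∈ Icc l (l + m), f t = δ (t - l) := by
    intro t ht
    rcases eq_or_lt_of_le ht.1 with h | h
    · subst h; rw [f1 l ⟨hl, le_rfl⟩, sub_self, h3, h2']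
    · exact if_neg (not_le.2 h)
  refine ⟨by linarith, f, ?_, by rw [f1 0 ⟨le_rfl, hl⟩, h2], ?_, ?_⟩
  · refine lipschitz_one_glue hl (by linarith) ?_ ?_
    · intro s hs t ht
      rw [f1 s hs, f1 t ht]
      exact h1 s hs t ht
    · intro s hs t ht
      rw [f2 s hs, f2 t ht]
      have := h1' (s - l) ⟨by linarith [hs.1], by linarith [hs.2]⟩ (t - l)
        ⟨by linarith [ht.1], by linarith [ht.2]⟩
      rwa [sub_sub_sub_cancel_right] at this
  · rw [f2 _ ⟨by linarith, le_rfl⟩, add_sub_cancel_left, h3']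
  · intro t ht
    rcases le_total t l with h | h
    · rw [f1 t ⟨ht.1, h⟩]; exact h4 t ⟨ht.1, h⟩
    · rw [f2 t ⟨h, ht.2⟩]; exact h4' _ ⟨by linarith, by linarith [ht.2]⟩

theorem extend (h : PathIn P p q l) (hlm : l ≤ m) : PathIn P p q m := by
  obtain ⟨hl, γ, h1, h2, h3, h4⟩ := h
  have hq : P q := h3 ▸ h4 l ⟨hl, le_rfl⟩
  have : PathIn P q q (m - l) :=
    ⟨by linarith, fun _ => q, fun s _ t _ => by simp, rfl, rfl, fun _ _ => hq⟩
  simpa using trans ⟨hl, γ, h1, h2, h3, h4⟩ this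

theorem split (h : PathIn P p q (l + m)) (hl : 0 ≤ l) (hm : 0 ≤ m) :
    ∃ r, PathIn P p r l ∧ PathIn P r q m := by
  obtain ⟨_, γ, h1, rfl, rfl, h4⟩ := h
  refine ⟨γ l, ?_, ?_⟩
  · simpa using of_lipschitz hl
      (fun s hs t ht => h1 s ⟨hs.1, by linarith [hs.2]⟩ t ⟨ht.1, by linarith [ht.2]⟩)
      (fun t ht => h4 t ⟨ht.1, by linarith [ht.2]⟩)
  · simpa using of_lipschitz (by linarith : l ≤ l + m)
      (fun s hs t ht => h1 s ⟨by linarith [hs.1], hs.2⟩ t ⟨by linarith [ht.1], ht.2⟩)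
      (fun t ht => h4 t ⟨by linarith [ht.1], ht.2⟩)

theorem dist_le (h : PathIn P p q l) : dist p q ≤ l := by
  obtain ⟨hl, γ, h1, rfl, rfl, h4⟩ := h
  simpa [abs_of_nonneg hl] using h1 0 ⟨le_rfl, hl⟩ l ⟨hl, le_rfl⟩

theorem left (h : PathIn P p q l) : P p := by
  obtain ⟨hl, γ, h1, rfl, rfl, h4⟩ := h
  exact h4 0 ⟨le_rfl, hl⟩

end PathIn

end Paths

/-! ### The path metric after attaching intervals. -/

namespace Attach

variable {X : Type*} {A : Set (X × X)} [MetricSpace X]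

theorem dist_incl_le (x y : X) : dist (incl A x) (incl A y) ≤ dist x y :=
  (isChain_incl x y).dist_le

theorem dist_pt_le (e : A) (s t : Icc (0 : ℝ) 1) : dist (pt e s) (pt e t) ≤ |(s : ℝ) - t| :=
  (isChain_pt e s t).dist_le

theorem dist_incl_of_mem {x y : X} (h : (x, y) ∈ A) : dist (incl A x) (incl A y) ≤ 1 := by
  have := dist_pt_le (⟨(x, y), h⟩ : A) ⟨0, by simp⟩ ⟨1, by simp⟩
  rw [pt_zero, pt_one] at this
  simpa using this

theorem exists_dist_incl_le (p : Attach X A) : ∃ x, dist p (incl A x) ≤ 1 / 2 := by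
  rcases cases_pt p with ⟨x, rfl⟩ | ⟨e, t, rfl⟩
  · exact ⟨x, by simp⟩
  · rcases le_total (t : ℝ) (1 / 2) with h | h
    · refine ⟨e.1.1, ?_⟩
      have := dist_pt_le e t ⟨0, by simp⟩
      rw [pt_zero] at this
      refine this.trans ?_
      simpa [abs_of_nonneg t.2.1] using h
    · refine ⟨e.1.2, ?_⟩
      have := dist_pt_le e t ⟨1, by simp⟩
      rw [pt_one] at this
      refine this.trans ?_
      rw [abs_of_nonpos (by simpa using t.2.2)]
      simp only [neg_sub]
      linarith

/-- A 1-Lipschitz function on `X` that varies by at most one along each attached interval is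
1-Lipschitz for the path metric. -/
theorem sub_le_dist_incl (f : X → ℝ) (hf : ∀ x y, f y - f x ≤ dist x y)
    (hA : ∀ e ∈ A, |f e.1 - f e.2| ≤ 1) (x y : X) : f y - f x ≤ dist (incl A x) (incl A y) := by
  have h1 : ∀ e ∈ A, f e.1 ≤ f e.2 + 1 := fun e he => by linarith [(abs_le.1 (hA e he)).2]
  have h2 : ∀ e ∈ A, f e.2 ≤ f e.1 + 1 := fun e he => by linarith [(abs_le.1 (hA e he)).1]
  -- On an interval, take the minimum of the two slope-one functions growing from its ends. It
  -- agrees with `f` at the ends exactly because `f` varies by at most one across.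
  let F : Attach X A → ℝ := Quot.lift
    (Sum.elim f (fun z => min ((z.2 : ℝ) + f z.1.1.1) (1 - z.2 + f z.1.1.2))) (by
      rintro _ _ (e | e)
      · simp only [Sum.elim_inr, Sum.elim_inl]
        rw [min_eq_left] <;> linarith [h1 _ e.2]
      · simp only [Sum.elim_inr, Sum.elim_inl]
        rw [min_eq_right] <;> linarith [h2 _ e.2])
  have hFi : ∀ y, F (incl A y) = f y := fun y => rfl
  have hFp : ∀ e t, F (pt e t) = min ((t : ℝ) + f e.1.1) (1 - t + f e.1.2) := fun e t => rfl
  have key := sub_le_dist F (fun y z => by rw [hFi, hFi]; exact hf y z)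
    (by
      intro e s t
      rw [hFp, hFp]
      have h1 := le_abs_self ((s : ℝ) - t)
      have h2 := neg_abs_le ((s : ℝ) - t)
      rcases min_cases ((s : ℝ) + f e.1.1) (1 - s + f e.1.2) with h | h <;>
        rcases min_cases ((t : ℝ) + f e.1.1) (1 - t + f e.1.2) with h' | h' <;> linarith)
    (incl A x) (incl A y)
  rwa [hFi, hFi] at key

/-- `y` can be reached from `x` by crossing `k` attached intervals and moving a total distance of at
most `l` inside `X`. -/
inductive Reach (A : Set (X × X)) (x : X) : ℕ → ℝ → X → Prop
  | base (l : ℝ) (y : X) : dist x y ≤ l → Reach A x 0 l y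
  | step (k : ℕ) (l m : ℝ) (u v y : X) : Reach A x k l u → (u, v) ∈ A ∨ (v, u) ∈ A →
      l + dist v y ≤ m → Reach A x (k + 1) m y

namespace Reach

theorem nonneg {x y : X} {k : ℕ} {l : ℝ} (h : Reach A x k l y) : 0 ≤ l := by
  induction h with
  | base l y h => exact dist_nonneg.trans h
  | step k l m u v y _ _ h ih => linarith [dist_nonneg (x := v) (y := y)]

theorem move {x y : X} {k : ℕ} {l : ℝ} (h : Reach A x k l y) (z : X) :
    Reach A x k (l + dist y z) z := by
  cases h with
  | base l y h => exact .base _ _ (by linarith [dist_triangle x y z])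
  | step k l m u v y h1 h2 h3 =>
    exact .step _ _ _ _ _ _ h1 h2 (by linarith [dist_triangle v y z])

theorem jump {x u v : X} {k : ℕ} {l : ℝ} (h : Reach A x k l u) (hA : (u, v) ∈ A ∨ (v, u) ∈ A) :
    Reach A x (k + 1) l v :=
  .step _ _ _ _ _ _ h hA (by simp)

theorem dist_le {x y : X} {k : ℕ} {l : ℝ} (h : Reach A x k l y) :
    dist (incl A x) (incl A y) ≤ k + l := by
  induction h with
  | base l y h => simpa using (dist_incl_le x y).trans h
  | step k l m u v y _ hA h ih =>
    have h1 : dist (incl A u) (incl A v) ≤ 1 := by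
      rcases hA with h | h
      · exact dist_incl_of_mem h
      · rw [dist_comm]; exact dist_incl_of_mem h
    have h2 := dist_incl_le (A := A) v y
    have := dist_triangle4 (incl A x) (incl A u) (incl A v) (incl A y)
    push_cast
    linarith

end Reach

/-- The infimum of `k + l` over all ways of reaching a point is 1-Lipschitz on `X` and changes by at
most one across an interval, so `sub_le_dist_incl` bounds it by the path metric. This replaces the
metric by finite sequences of jumps, on which one can induct. -/
theorem exists_reach {x y : X} {c : ℝ} (h : dist (incl A x) (incl A y) < c) :
    ∃ (k : ℕ) (l : ℝ), Reach A x k l y ∧ k + l < c := by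
  let S : X → Set ℝ := fun z => {c | ∃ (k : ℕ) (l : ℝ), Reach A x k l z ∧ k + l = c}
  have hbdd : ∀ z, BddBelow (S z) := fun z => ⟨0, by
    rintro _ ⟨k, l, h, rfl⟩
    have := h.nonneg
    positivity⟩
  have hne : ∀ z, (S z).Nonempty := fun z => ⟨_, 0, dist x z, .base _ _ le_rfl, rfl⟩
  let f : X → ℝ := fun z => sInf (S z)
  have hstep : ∀ (z w : X) (d : ℝ), (∀ k l, Reach A x k l z →
      ∃ (k' : ℕ) (l' : ℝ), Reach A x k' l' w ∧ k' + l' ≤ k + l + d) → f w ≤ f z + d := by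
    intro z w d hd
    rw [← sub_le_iff_le_add]
    refine le_csInf (hne z) ?_
    rintro _ ⟨k, l, h, rfl⟩
    obtain ⟨k', l', h', hle⟩ := hd k l h
    have : f w ≤ k' + l' := csInf_le (hbdd w) ⟨k', l', h', rfl⟩
    linarith
  have key := sub_le_dist_incl (A := A) f
    (fun z w => by
      have := hstep z w (dist z w) fun k l h => ⟨k, _, h.move w, by linarith⟩
      linarith)
    (fun e he => by
      have h1 := hstep e.1 e.2 1 fun k l h => ⟨k + 1, l, h.jump (Or.inl he), by push_cast; linarith⟩
      have h2 := hstep e.2 e.1 1 fun k l h => ⟨k + 1, l, h.jump (Or.inr he), by push_cast; linarith⟩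
      rw [abs_le]
      constructor <;> linarith) x y
  have h0 : f x ≤ 0 := csInf_le (hbdd x) ⟨0, 0, .base _ _ (by simp), by simp⟩
  obtain ⟨_, ⟨k, l, h1, rfl⟩, h2⟩ := exists_lt_of_csInf_lt (hne y) (show f y < c by linarith)
  exact ⟨k, l, h1, h2⟩

theorem pathIn_pt (e : A) (s t : Icc (0 : ℝ) 1) :
    PathIn (fun _ => True) (pt e s) (pt e t) |(s : ℝ) - t| := by
  have key : ∀ s t : Icc (0 : ℝ) 1, (s : ℝ) ≤ t →
      PathIn (fun _ => True) (pt e s) (pt e t) |(s : ℝ) - t| := by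
    intro s t hst
    have := PathIn.of_lipschitz (P := fun _ => True) (γ := fun u => pt e (projIcc 0 1 zero_le_one u))
      hst (fun u hu v hv => by
        have hu' : u ∈ Icc (0 : ℝ) 1 := ⟨s.2.1.trans hu.1, hu.2.trans t.2.2⟩
        have hv' : v ∈ Icc (0 : ℝ) 1 := ⟨s.2.1.trans hv.1, hv.2.trans t.2.2⟩
        have := dist_pt_le e (projIcc 0 1 zero_le_one u) (projIcc 0 1 zero_le_one v)
        rwa [projIcc_of_mem _ hu', projIcc_of_mem _ hv'] at this ⊢) (fun _ _ => trivial)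
    rw [abs_of_nonpos (by linarith), neg_sub]
    simpa using this
  rcases le_total (s : ℝ) t with h | h
  · exact key s t h
  · rw [abs_sub_comm]; exact (key t s h).symm

theorem pathIn_incl (hX : IsGeodesicSpace X) (x y : X) :
    PathIn (fun _ => True) (incl A x) (incl A y) (dist x y) := by
  obtain ⟨σ, hσ⟩ := hX x y
  obtain ⟨γ, h1, h2, h3, -⟩ := hσ.exists_geodesic
  exact ⟨dist_nonneg, fun t => incl A (γ t), fun s hs t ht =>
    (dist_incl_le _ _).trans (h1.lipschitz s hs t ht), by simp [h2], by simp [h3], fun _ _ => trivial⟩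

theorem IsChain.pathIn (hX : IsGeodesicSpace X) {p q : Attach X A} {l : ℝ} (h : IsChain p q l) :
    PathIn (fun _ => True) p q l := by
  induction h with
  | nil => exact .refl trivial
  | base x y l _ ih => exact ih.trans (pathIn_incl hX x y)
  | edge e s t l _ ih => exact ih.trans (pathIn_pt e s t)

theorem exists_pathIn (hX : IsGeodesicSpace X) (p q : Attach X A) {ε : ℝ} (hε : 0 < ε) :
    PathIn (fun _ => True) p q (dist p q + ε) := by
  have : sInf {l | IsChain p q l} < dist p q + ε := by rw [← dist_def]; linarith
  obtain ⟨l, hl, hlt⟩ := exists_lt_of_csInf_lt (exists_isChain p q) this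
  exact (IsChain.pathIn hX hl).extend hlt.le

theorem isLengthSpace (hX : IsGeodesicSpace X) : IsLengthSpace (Attach X A) := by
  intro p q ε hε
  obtain ⟨h0, γ, h1, h2, h3, -⟩ := exists_pathIn hX p q hε
  exact ⟨γ, _, h0, le_rfl, LipschitzOnWith.of_dist_le_mul fun s hs t ht => by
    simpa [Real.dist_eq] using h1 s hs t ht, h2, h3⟩

end Attach

end Contraction

/-! ### Thin subsegments and anti-contracting pairs. -/

namespace Contraction

open Classical in
theorem piecewise_Icc_of_le_left {X : Type*} {ζ γ : ℝ → X} {s t u : ℝ} (hu : u ≤ s) (h : ζ s = γ s) :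
    (Icc s t).piecewise ζ γ u = γ u := by
  by_cases hc : u ∈ Icc s t
  · rw [piecewise_eq_of_mem _ _ _ hc, le_antisymm hu hc.1, h]
  · rw [piecewise_eq_of_notMem _ _ _ hc]

open Classical in
theorem piecewise_Icc_of_right_le {X : Type*} {ζ γ : ℝ → X} {s t u : ℝ} (hu : t ≤ u) (h : ζ t = γ t) :
    (Icc s t).piecewise ζ γ u = γ u := by
  by_cases hc : u ∈ Icc s t
  · rw [piecewise_eq_of_mem _ _ _ hc, ← le_antisymm hu hc.2, h]
  · rw [piecewise_eq_of_notMem _ _ _ hc]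

section Thin

variable {X : Type*} [PseudoMetricSpace X]

theorem IsThin.shift {r : ℝ} {γ : ℝ → X} {a b : ℝ} (h : IsThin r γ a b) (u : ℝ) :
    IsThin r (fun t => γ (t + u)) (a - u) (b - u) := by
  intro η c d hc hd hη heq p q σ₂ σ₃ σ₄ h2 h3 h4
  have e1 : IsGeodesic (fun t => η (t - u)) (Icc (c + u) (d + u)) := by
    simpa only [sub_neg_eq_add, ← sub_eq_add_neg] using hη.shift (-u)
  obtain ⟨z, hz, hd⟩ := h (fun t => η (t - u)) (c + u) (d + u) (by linarith) (by linarith) e1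
    (fun t ht => by
      have := heq (show t - u ∈ Icc (a - u) (b - u) from ⟨by linarith [ht.1], by linarith [ht.2]⟩)
      simpa using this) p q σ₂ σ₃ σ₄ (by simpa using h2) h3 (by simpa using h4)
  refine ⟨z, hz, ?_⟩
  have : (a - u + (b - u)) / 2 + u = (a + b) / 2 := by ring
  simpa only [this] using hd

theorem IsThin.congr {r : ℝ} {γ γ' : ℝ → X} {a b : ℝ} (h : IsThin r γ a b) (_ : a ≤ b)
    (heq : EqOn γ γ' (Icc a b)) : IsThin r γ' a b := by
  intro η c d hc hd hη heq' p q σ₂ σ₃ σ₄ h2 h3 h4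
  have := h η c d hc hd hη (heq'.trans heq.symm) p q σ₂ σ₃ σ₄ h2 h3 h4
  rwa [heq ⟨by linarith, by linarith⟩] at this

theorem not_isThin_of_mem {x y : X} (h : (x, y) ∈ antiContracting X) {γ : ℝ → X} {c d : ℝ}
    (hγ : IsGeodesic γ (Icc c d)) (hc : γ c = x) (hd : γ d = y) {r a b : ℝ} (hr : 0 ≤ r)
    (hca : c ≤ a) (_hab : a ≤ b) (hbd : b ≤ d) (hl : 10 * r + 1 ≤ b - a) : ¬ IsThin r γ a b := by
  intro ht
  refine h.2 (fun t => γ (t + c)) (d - c) (by linarith) (by simpa using hγ.shift c) (by simpa)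
    (by simpa) r hr (a - c) (b - c) (by linarith) (by linarith) (by linarith) (by linarith)
    (ht.shift c)

/-- Only some geodesic `ζ` between the points is known to have a thin part, not a given one. This is
why `ζ` later has to be spliced into longer geodesics. -/
theorem exists_isThin_of_notMem {x y : X} (h : (x, y) ∉ antiContracting X) {s t : ℝ}
    (hd : dist x y = t - s) (h1 : 1 ≤ t - s) :
    ∃ ζ : ℝ → X, IsGeodesic ζ (Icc s t) ∧ ζ s = x ∧ ζ t = y ∧ ∃ r a b : ℝ, 0 ≤ r ∧ s ≤ a ∧ a ≤ b ∧
      b ≤ t ∧ 10 * r + 1 ≤ b - a ∧ IsThin r ζ a b := by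
  have h' : ¬ (1 ≤ dist x y ∧ _) := h
  push Not at h'
  obtain ⟨γ, L, hL, hγ, h0, hL', r, hr, a, b, ha, hab, hb, hlen, ht⟩ := h' (by linarith)
  dsimp only at h0 hL'
  have hLd : L = t - s := by
    rw [← hd, ← h0, ← hL', hγ.dist_eq 0 ⟨le_rfl, hL⟩ L ⟨hL, le_rfl⟩, zero_sub, abs_neg,
      abs_of_nonneg hL]
  subst hLd
  have e1 := hγ.shift (-s)
  have e2 := ht.shift (-s)
  simp only [sub_neg_eq_add, ← sub_eq_add_neg, zero_add, sub_add_cancel] at e1 e2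
  exact ⟨_, e1, by simpa, by simpa, r, _, _, hr, by linarith, by linarith, by linarith,
    by linarith, e2⟩

/-- A thin part of any geodesic between the inner points would, after splicing, be a thin part of a
geodesic between the outer ones. -/
theorem mem_antiContracting_of_subsegment {γ : ℝ → X} {c d s t : ℝ}
    (hγ : IsGeodesic γ (Icc c d)) (h : (γ c, γ d) ∈ antiContracting X) (hcs : c ≤ s)
    (hst : 1 ≤ t - s) (htd : t ≤ d) : (γ s, γ t) ∈ antiContracting X := by
  classical
  by_contra hn
  have hd : dist (γ s) (γ t) = t - s := by
    rw [hγ.dist_eq s ⟨hcs, by linarith⟩ t ⟨by linarith, htd⟩, abs_of_nonpos (by linarith)]; ring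
  obtain ⟨ζ, h1, h2, h3, r, a, b, hr, ha, hab, hb, hlen, ht⟩ := exists_isThin_of_notMem hn hd hst
  have hsub : ∀ u ∈ Icc s t, (Icc s t).piecewise ζ γ u = ζ u := fun u hu =>
    piecewise_eq_of_mem _ _ _ hu
  exact not_isThin_of_mem h (hγ.replace h1 hcs htd h2 h3) (piecewise_Icc_of_le_left hcs h2)
    (piecewise_Icc_of_right_le htd h3) hr (hcs.trans ha) hab (hb.trans htd) hlen
    (ht.congr hab fun u hu => (hsub u ⟨ha.trans hu.1, hu.2.trans hb⟩).symm)

end Thin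

/-! ### Thin triangles for the metric of the contraction space. -/

section CDist

variable {X : Type*} [MetricSpace X]

/-- The metric of the contraction space, restricted to `X`. -/
noncomputable def cdist (x y : X) : ℝ :=
  dist (Attach.incl (antiContracting X) x) (Attach.incl (antiContracting X) y)

theorem cdist_self (x : X) : cdist x x = 0 := dist_self _

theorem cdist_comm (x y : X) : cdist x y = cdist y x := dist_comm _ _

theorem cdist_nonneg (x y : X) : 0 ≤ cdist x y := dist_nonneg

theorem cdist_triangle (x y z : X) : cdist x z ≤ cdist x y + cdist y z := dist_triangle _ _ _

theorem cdist_le_dist (x y : X) : cdist x y ≤ dist x y := Attach.dist_incl_le x y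

theorem cdist_le_one {x y : X} (h : (x, y) ∈ antiContracting X) : cdist x y ≤ 1 :=
  Attach.dist_incl_of_mem h

theorem cdist_le_one_of_subsegment {γ : ℝ → X} {c d s t : ℝ} (hγ : IsGeodesic γ (Icc c d))
    (h : (γ c, γ d) ∈ antiContracting X) (hs : s ∈ Icc c d) (ht : t ∈ Icc c d) :
    cdist (γ s) (γ t) ≤ 1 := by
  rcases le_total |s - t| 1 with h1 | h1
  · exact (cdist_le_dist _ _).trans ((hγ.lipschitz s hs t ht).trans h1)
  · rcases le_total s t with hst | hst
    · rw [abs_of_nonpos (by linarith)] at h1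
      exact cdist_le_one (mem_antiContracting_of_subsegment hγ h hs.1 (by linarith) ht.2)
    · rw [abs_of_nonneg (by linarith)] at h1
      rw [cdist_comm]
      exact cdist_le_one (mem_antiContracting_of_subsegment hγ h ht.1 (by linarith) hs.2)

theorem exists_window {γ : ℝ → X} {c d z : ℝ} (hγ : IsGeodesic γ (Icc c d)) (hz : z ∈ Icc c d) :
    cdist (γ z) (γ c) ≤ 1 ∨ cdist (γ z) (γ d) ≤ 1 ∨ ∃ h : ℝ, 1 / 2 ≤ h ∧ c ≤ z - h ∧ z + h ≤ d ∧
      (γ (z - h), γ (z + h)) ∉ antiContracting X ∧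
        ∀ u ∈ Icc (z - h) (z + h), cdist (γ z) (γ u) ≤ 2 := by
  have key : ∀ h : ℝ, c ≤ z - h → z + h ≤ d →
      (1 / 2 ≤ h → (γ (z - h), γ (z + h)) ∈ antiContracting X) →
      ∀ u ∈ Icc (z - h) (z + h), cdist (γ z) (γ u) ≤ 1 := by
    intro h hc hd hh u hu
    have h0 : z - h ≤ z + h := hu.1.trans hu.2
    have hzu : |z - u| ≤ h := by rw [abs_le]; constructor <;> linarith [hu.1, hu.2]
    rcases le_total (1 / 2) h with hl | hl
    · exact cdist_le_one_of_subsegment (hγ.sub hc h0 hd) (hh hl) ⟨by linarith, by linarith⟩ hu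
    · refine (cdist_le_dist _ _).trans ((hγ.lipschitz z hz u ?_).trans (by linarith))
      exact ⟨hc.trans hu.1, hu.2.trans hd⟩
  -- If no half-width is in `S`, the largest symmetric window reaches an endpoint and its ends are
  -- anti-contracting, or it is short; either way `z` is close to that endpoint.
  let S : Set ℝ := {h | 1 / 2 ≤ h ∧ c ≤ z - h ∧ z + h ≤ d ∧
    (γ (z - h), γ (z + h)) ∉ antiContracting X}
  rcases S.eq_empty_or_nonempty with hS | hS
  · have hS' : ∀ h, c ≤ z - h → z + h ≤ d → 1 / 2 ≤ h →
        (γ (z - h), γ (z + h)) ∈ antiContracting X := by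
      intro h h1 h2 h3
      by_contra hn
      exact (hS ▸ (⟨h3, h1, h2, hn⟩ : h ∈ S) : h ∈ (∅ : Set ℝ))
    have := hz.1
    have := hz.2
    rcases le_total (z - c) (d - z) with hm | hm
    · exact Or.inl (key (z - c) (by linarith) (by linarith)
        (hS' _ (by linarith) (by linarith)) c ⟨by linarith, by linarith⟩)
    · exact Or.inr (Or.inl (key (d - z) (by linarith) (by linarith)
        (hS' _ (by linarith) (by linarith)) d ⟨by linarith, by linarith⟩))
  · right; right
    have hb : BddBelow S := ⟨1 / 2, fun h hh => hh.1⟩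
    -- A half-width within `1/2` of the infimum need not be minimal, but `h - 1/2` lies outside `S`.
    -- The smaller window thus has `cdist`-radius at most one, and reaching the ends of the larger
    -- one adds at most `1/2`.
    obtain ⟨h, hh, hlt⟩ := exists_lt_of_csInf_lt hS (show sInf S < sInf S + 1 / 2 by linarith)
    refine ⟨h, hh.1, hh.2.1, hh.2.2.1, hh.2.2.2, fun u hu => ?_⟩
    obtain ⟨h1, h2, h3, -⟩ := hh
    have hnot : h - 1 / 2 ∉ S := fun hmem => by linarith [csInf_le hb hmem]
    have key' := key (h - 1 / 2) (by linarith) (by linarith) (fun hl => by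
      by_contra hn
      exact hnot ⟨hl, by linarith, by linarith, hn⟩)
    obtain ⟨u', hu', hd⟩ : ∃ u' ∈ Icc (z - (h - 1 / 2)) (z + (h - 1 / 2)), |u' - u| ≤ 1 / 2 := by
      rcases le_total u (z - (h - 1 / 2)) with h' | h'
      · exact ⟨_, ⟨le_rfl, by linarith⟩, by rw [abs_le]; constructor <;> linarith [hu.1]⟩
      rcases le_total (z + (h - 1 / 2)) u with h'' | h''
      · exact ⟨_, ⟨by linarith, le_rfl⟩, by rw [abs_le]; constructor <;> linarith [hu.2]⟩
      · exact ⟨u, ⟨h', h''⟩, by simp⟩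
    have e1 := key' u' hu'
    have e2 := (cdist_le_dist _ _).trans (hγ.lipschitz u' ⟨by linarith [hu'.1], by linarith [hu'.2]⟩
      u ⟨by linarith [hu.1], by linarith [hu.2]⟩)
    linarith [cdist_triangle (γ z) (γ u') (γ u)]

/-- Among the pairs of points on one side and on the union of the other two sides of a geodesic
triangle, a pair minimizing a perturbed distance is close in the contraction space. -/
theorem exists_close_pair {x y p : X} {σ₁ σ₂ σ₃ : Set X} (h₁ : IsSegment σ₁ x y)
    (h₂ : IsSegment σ₂ y p) (h₃ : IsSegment σ₃ p x) {u₀ v₀ : X} (hu₀ : u₀ ∈ σ₁)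
    (hv₀ : v₀ ∈ σ₂ ∪ σ₃) : ∃ u ∈ σ₁, ∃ v ∈ σ₂ ∪ σ₃, cdist u v ≤ 1 ∧
      dist u v + dist u u₀ / 2 ≤ dist u₀ v₀ := by
  -- The penalty `dist u u₀ / 2` keeps `u` near `u₀`. Its slope is below one, so it cannot cancel
  -- the gain from moving `u` along a short cut.
  obtain ⟨⟨u, v⟩, ⟨hu, hv⟩, hmin⟩ := (h₁.isCompact.prod (h₂.isCompact.union h₃.isCompact)).exists_isMinOn
    ⟨(u₀, v₀), hu₀, hv₀⟩
    (f := fun w : X × X => dist w.1 w.2 + dist w.1 u₀ / 2) (by fun_prop)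
  have hmin' : ∀ u' ∈ σ₁, ∀ v' ∈ σ₂ ∪ σ₃,
      dist u v + dist u u₀ / 2 ≤ dist u' v' + dist u' u₀ / 2 :=
    fun u' hu' v' hv' => hmin (show (u', v') ∈ σ₁ ×ˢ (σ₂ ∪ σ₃) from ⟨hu', hv'⟩)
  refine ⟨u, hu, v, hv, ?_, by simpa using hmin' u₀ hu₀ v₀ hv₀⟩
  by_contra hc
  have hd : 1 ≤ dist u v := by
    by_contra h
    linarith [cdist_le_dist u v]
  have hn : (u, v) ∉ antiContracting X := fun h => hc (cdist_le_one h)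
  obtain ⟨ζ, hζ, hζ0, hζL, s, a, b, hs, ha, hab, hb, hlen, ht⟩ :=
    exists_isThin_of_notMem hn (s := 0) (t := dist u v) (by ring) (by simpa)
  set w := ζ ((a + b) / 2) with hw
  have huw : dist u w = (a + b) / 2 := by
    rw [hw, ← hζ0, hζ.dist_eq 0 ⟨le_rfl, dist_nonneg⟩ _ ⟨by linarith, by linarith⟩, zero_sub,
      abs_neg, abs_of_nonneg (by linarith)]
  have hwv : dist w v = dist u v - (a + b) / 2 := by
    rw [hw]
    conv_lhs => rw [← hζL]
    rw [hζ.dist_eq _ ⟨by linarith, by linarith⟩ _ ⟨dist_nonneg, le_rfl⟩,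
      abs_of_nonpos (by linarith)]
    ring
  -- `ζ` and the two subsegments leading to the common vertex `e` form a triangle, read as a
  -- quadrangle with one degenerate side.
  have hquad : ∀ (e : X) (τ₂ τ₁ : Set X), τ₂ ⊆ σ₂ ∪ σ₃ → τ₁ ⊆ σ₁ → IsSegment τ₂ v e →
      IsSegment τ₁ e u → False := by
    intro e τ₂ τ₁ hs2 hs1 g2 g1
    obtain ⟨z, hz, hwz⟩ := ht ζ 0 (dist u v) ha hb hζ (fun _ _ => rfl) e u τ₂ τ₁ {u}
      (by rwa [hζL]) g1 (by rw [hζ0]; exact .refl u)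
    have hz' : z ∈ σ₁ ∨ z ∈ σ₂ ∪ σ₃ := by
      rcases hz with (h | h) | h
      · exact Or.inr (hs2 h)
      · exact Or.inl (hs1 h)
      · rw [mem_singleton_iff.1 h]; exact Or.inl hu
    -- If the nearby point `z` is on `σ₁`, replacing `u` by `z` saves about `(a + b) / 2` in
    -- distance and costs about half of that in penalty; otherwise replacing `v` by `z` shortens the
    -- pair. Both contradict minimality since `b - a ≥ 10 * s + 1`.
    rcases hz' with h | h
    · have e1 := hmin' z h v hv
      have e2 := dist_triangle_left z v w
      have e3 := dist_triangle_left z u w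
      have e4 := dist_triangle z u u₀
      rw [dist_comm w u] at e3
      linarith
    · have e1 := hmin' u hu z h
      have e2 := dist_triangle u w z
      linarith
  rcases hv with hv | hv
  · obtain ⟨τ₂, hs2, g2⟩ := h₂.symm.exists_right hv
    obtain ⟨τ₁, hs1, g1⟩ := h₁.symm.exists_left hu
    exact hquad y τ₂ τ₁ (hs2.trans subset_union_left) hs1 g2 g1
  · obtain ⟨τ₂, hs2, g2⟩ := h₃.exists_right hv
    obtain ⟨τ₁, hs1, g1⟩ := h₁.exists_left hu
    exact hquad x τ₂ τ₁ (hs2.trans subset_union_right) hs1 g2 g1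

/-- Geodesic triangles of `X` are uniformly thin in the contraction space. -/
theorem cdist_thin_triangle {x y p : X} {σ₁ σ₂ σ₃ : Set X} (h₁ : IsSegment σ₁ x y)
    (h₂ : IsSegment σ₂ y p) (h₃ : IsSegment σ₃ p x) {q : X} (hq : q ∈ σ₁) :
    ∃ v ∈ σ₂ ∪ σ₃, cdist q v ≤ 3 := by
  classical
  obtain ⟨γ, L, hL, hγ, rfl, rfl, rfl⟩ := id h₁
  obtain ⟨z, hz, rfl⟩ := hq
  rcases exists_window hγ hz with h | h | ⟨h, hh, hc, hd, hn, hwin⟩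
  · exact ⟨_, Or.inr h₃.right_mem, by linarith⟩
  · exact ⟨_, Or.inl h₂.left_mem, by linarith⟩
  set s := z - h with hs
  set t := z + h with ht
  have hst : s ≤ t := by linarith
  have hsm : s ∈ Icc 0 L := ⟨hc, by linarith⟩
  have htm : t ∈ Icc 0 L := ⟨by linarith, hd⟩
  have hdst : dist (γ s) (γ t) = t - s := by
    rw [hγ.dist_eq s hsm t htm, abs_of_nonpos (by linarith)]; ring
  obtain ⟨ζ, hζ, hζs, hζt, r, a, b, hr, ha, hab, hb, hlen, hthin⟩ :=
    exists_isThin_of_notMem hn hdst (by linarith)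
  have hsub := hγ.sub hc hst hd
  set m := ζ ((a + b) / 2) with hm
  -- Thinness is applied to the bigon formed by `ζ` and the window of `γ`.
  obtain ⟨u₀, hu₀, hmu₀⟩ : ∃ u ∈ γ '' Icc s t, dist m u ≤ r := by
    obtain ⟨u, hu, hmu⟩ := hthin ζ s t ha hb hζ (fun _ _ => rfl) (γ s) (γ s) (γ '' Icc s t)
      {γ s} {γ s} (by rw [hζt]; exact (hsub.isSegment hst).symm) (.refl _)
      (by rw [hζs]; exact .refl _)
    refine ⟨u, ?_, hmu⟩
    have hγs : γ s ∈ γ '' Icc s t := ⟨s, ⟨le_rfl, hst⟩, rfl⟩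
    rcases hu with (h | h) | h
    · exact h
    · rwa [mem_singleton_iff.1 h]
    · rwa [mem_singleton_iff.1 h]
  have hpi : ∀ u ∈ Icc s t, (Icc s t).piecewise ζ γ u = ζ u := fun u hu =>
    piecewise_eq_of_mem _ _ _ hu
  have hp0 := piecewise_Icc_of_le_left (t := t) hc hζs
  have hpL := piecewise_Icc_of_right_le (s := s) hd hζt
  -- Thinness is applied again, to the original triangle with `ζ` spliced into its first side.
  obtain ⟨v₀, hv₀, hmv₀⟩ : ∃ v ∈ σ₂ ∪ σ₃, dist m v ≤ r := by
    obtain ⟨v, hv, hmv⟩ := hthin _ 0 L (hc.trans ha) (hb.trans hd) (hγ.replace hζ hc hd hζs hζt)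
      (fun u hu => hpi u ⟨ha.trans hu.1, hu.2.trans hb⟩) p p σ₂ {p} σ₃ (by rwa [hpL]) (.refl p)
      (by rwa [hp0])
    refine ⟨v, ?_, hmv⟩
    rcases hv with (h | h) | h
    · exact Or.inl h
    · rw [mem_singleton_iff.1 h]; exact Or.inr h₃.left_mem
    · exact Or.inr h
  obtain ⟨u, hu, v, hv, hcl, hF⟩ := exists_close_pair h₁ h₂ h₃
    (image_mono (Icc_subset_Icc hc hd) hu₀) hv₀
  have hu0v0 : dist u₀ v₀ ≤ 2 * r := by linarith [dist_triangle_left u₀ v₀ m]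
  have huu₀ : dist u u₀ ≤ 4 * r := by linarith [dist_nonneg (x := u) (y := v)]
  obtain ⟨t₀, ht₀, rfl⟩ := hu₀
  obtain ⟨tu, htu, rfl⟩ := hu
  have hmid : (a + b) / 2 ∈ Icc s t := ⟨by linarith, by linarith⟩
  have e1 : dist (ζ s) m = (a + b) / 2 - s := by
    rw [hm, hζ.dist_eq s ⟨le_rfl, hst⟩ _ hmid, abs_of_nonpos (by linarith)]; ring
  have e2 : dist m (ζ t) = t - (a + b) / 2 := by
    rw [hm, hζ.dist_eq _ hmid t ⟨hst, le_rfl⟩, abs_of_nonpos (by linarith)]; ring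
  have e3 : dist (γ s) (γ t₀) = t₀ - s := by
    rw [hsub.dist_eq s ⟨le_rfl, hst⟩ _ ht₀, abs_of_nonpos (by linarith [ht₀.1])]; ring
  have e4 : dist (γ t₀) (γ t) = t - t₀ := by
    rw [hsub.dist_eq _ ht₀ t ⟨hst, le_rfl⟩, abs_of_nonpos (by linarith [ht₀.2])]; ring
  rw [hζs] at e1
  rw [hζt] at e2
  have e5 := dist_triangle_right (γ s) m (γ t₀)
  have e6 := dist_triangle m (γ t₀) (γ t)
  have e7 : |tu - t₀| ≤ 4 * r := by
    rw [← hγ.dist_eq tu htu t₀ ⟨hc.trans ht₀.1, ht₀.2.trans hd⟩]; exact huu₀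
  rw [abs_le] at e7
  refine ⟨v, hv, ?_⟩
  -- The gauge `10 * r + 1` matters here: `u` is within `4 * r` of `u₀`, which is within `r` of the
  -- midpoint `m`, and `m` is at least `5 * r + 1 / 2` from both ends. Hence `u` is still in the
  -- window, and the total is `2 + 1`.
  have e8 := hwin tu ⟨by linarith, by linarith⟩
  linarith [cdist_triangle (γ z) (γ tu) v]

end CDist

end Contraction

namespace Contraction

/-! ### Hyperbolicity of the contraction space. -/

section Hyperbolic

theorem Attach.continuous_incl {X : Type*} [MetricSpace X] (A : Set (X × X)) :
    Continuous (Attach.incl A) :=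
  (LipschitzWith.of_dist_le_mul (K := 1) fun x y => by
    simpa using Attach.dist_incl_le x y).continuous

variable {X : Type*} [MetricSpace X]

theorem cdist_le_one_of_mem_segment {x y u v : X} {σ : Set X} (h : (x, y) ∈ antiContracting X)
    (hσ : IsSegment σ x y) (hu : u ∈ σ) (hv : v ∈ σ) : cdist u v ≤ 1 := by
  obtain ⟨γ, L, hL, hγ, rfl, rfl, rfl⟩ := hσ
  obtain ⟨s, hs, rfl⟩ := hu
  obtain ⟨t, ht, rfl⟩ := hv
  exact cdist_le_one_of_subsegment hγ h hs ht

/-- Each jump adds two thin triangles, at cost 3 each, and the jump itself. This bounds the geodesic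
linearly in the number of jumps; it serves only as the base case of the logarithmic estimate. -/
theorem cdist_le_of_reach (hX : IsGeodesicSpace X) {x y : X} {k : ℕ} {l : ℝ}
    (h : Attach.Reach (antiContracting X) x k l y) :
    ∀ {σ : Set X} {q : X}, IsSegment σ x y → q ∈ σ → cdist x q ≤ 8 * k + l := by
  induction h with
  | base l y h =>
    intro σ q hσ hq
    have := hσ.dist_add hq
    have := cdist_le_dist x q
    have := dist_nonneg (x := q) (y := y)
    norm_num
    linarith
  | step k l m u v y h hA hm ih =>
    intro σ q hσ hq
    have hxu : cdist x u ≤ k + l := h.dist_le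
    have hd := dist_nonneg (x := v) (y := y)
    obtain ⟨σ₂, h₂⟩ := hX y u
    obtain ⟨σ₃, h₃⟩ := hX u x
    obtain ⟨w, hw, hqw⟩ := cdist_thin_triangle hσ h₂ h₃ hq
    have e1 := cdist_triangle x w q
    rw [cdist_comm w q] at e1
    push_cast
    rcases hw with hw | hw
    · obtain ⟨τ, hτ⟩ := hX u v
      obtain ⟨τ', hτ'⟩ := hX v y
      obtain ⟨w', hw', hww⟩ := cdist_thin_triangle h₂ hτ hτ' hw
      have e2 := cdist_triangle x w' w
      rw [cdist_comm w' w] at e2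
      have huv : ∀ z ∈ τ, cdist u z ≤ 1 := fun z hz => by
        rcases hA with h | h
        · exact cdist_le_one_of_mem_segment h hτ hτ.left_mem hz
        · exact cdist_le_one_of_mem_segment h hτ.symm hτ.left_mem hz
      have hk : (0 : ℝ) ≤ k := Nat.cast_nonneg k
      rcases hw' with hw' | hw'
      · have := huv w' hw'
        have := cdist_triangle x u w'
        linarith
      · have e3 := huv v hτ.right_mem
        have e4 := cdist_triangle x u v
        have e5 := cdist_triangle x v w'
        have e6 := hτ'.dist_add hw'
        have e7 := cdist_le_dist v w'
        have := dist_nonneg (x := w') (y := y)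
        linarith
    · have := ih h₃.symm hw
      linarith

/-- A geodesic of `X` stays logarithmically close to paths of the contraction space. -/
theorem exists_dist_le_of_pathIn (hX : IsGeodesicSpace X)
    {P : Attach X (antiContracting X) → Prop} (k : ℕ) :
    ∀ {p p' : Attach X (antiContracting X)} {l : ℝ} {x y q : X} {σ : Set X},
      PathIn P p p' l → l ≤ 2 ^ k → dist p (Attach.incl _ x) ≤ 1 / 2 →
      dist p' (Attach.incl _ y) ≤ 1 / 2 → IsSegment σ x y → q ∈ σ →
      ∃ w, P w ∧ dist (Attach.incl _ q) w ≤ 3 * k + 25 := by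
  induction k with
  | zero =>
    intro p p' l x y q σ hp hl hx hy hσ hq
    have h1 : cdist x y < 3 := by
      have := dist_triangle4 (Attach.incl (antiContracting X) x) p p' (Attach.incl _ y)
      rw [dist_comm (Attach.incl (antiContracting X) x) p] at this
      have := hp.dist_le
      simp only [pow_zero] at hl
      unfold cdist
      linarith
    -- From `k + l < 3` one gets `8 * k + l < 24`; returning from `x` to `p` costs `1/2`, hence the
    -- constant 25.
    obtain ⟨k, l, hr, hlt⟩ := Attach.exists_reach h1
    have h2 : cdist x q ≤ _ := cdist_le_of_reach hX hr hσ hq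
    have := hr.nonneg
    refine ⟨p, hp.left, ?_⟩
    have h3 := dist_triangle_left p (Attach.incl (antiContracting X) q) (Attach.incl _ x)
    rw [dist_comm p (Attach.incl _ q), dist_comm (Attach.incl _ x) p] at h3
    unfold cdist at h2
    norm_num
    linarith
  | succ k ih =>
    intro p p' l x y q σ hp hl hx hy hσ hq
    have h2 : (0 : ℝ) ≤ 2 ^ k := by positivity
    -- Halve the path and compare with the triangle through a point of `X` near its midpoint; each
    -- halving costs one triangle, that is 3.
    obtain ⟨r, hr1, hr2⟩ := (hp.extend (m := 2 ^ k + 2 ^ k) (by rw [pow_succ] at hl; linarith)).split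
      h2 h2
    obtain ⟨z, hz⟩ := Attach.exists_dist_incl_le r
    obtain ⟨σ₂, h₂⟩ := hX y z
    obtain ⟨σ₃, h₃⟩ := hX z x
    obtain ⟨v, hv, hqv⟩ := cdist_thin_triangle hσ h₂ h₃ hq
    unfold cdist at hqv
    have key : ∃ w, P w ∧ dist (Attach.incl _ v) w ≤ 3 * k + 25 := by
      rcases hv with hv | hv
      · exact ih hr2 le_rfl hz hy h₂.symm hv
      · exact ih hr1 le_rfl hx hz h₃.symm hv
    obtain ⟨w, hw, hvw⟩ := key
    refine ⟨w, hw, ?_⟩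
    have := dist_triangle (Attach.incl (antiContracting X) q) (Attach.incl _ v) w
    push_cast
    linarith

theorem le_of_forall_le_two_pow {R : ℝ}
    (h : ∀ k : ℕ, 8 * R + 7 ≤ 2 ^ k → R ≤ 3 * k + 25) : R ≤ 53 := by
  by_contra hR
  push Not at hR
  -- This is the largest `k` with `3 * k + 26 ≤ R`, so the conclusion of `h` fails, while `8 * R + 7
  -- < 24 * k + 239` makes its premise hold once `k ≥ 9`.
  set k := ⌊(R - 26) / 3⌋₊ with hk
  have h1 : (k : ℝ) ≤ (R - 26) / 3 := Nat.floor_le (by linarith)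
  have h2 : (R - 26) / 3 < k + 1 := Nat.lt_floor_add_one _
  have h9 : 9 ≤ k := Nat.le_floor (by norm_num; linarith)
  have hpow : ∀ n : ℕ, 9 ≤ n → 24 * n + 239 ≤ 2 ^ n := by
    intro n hn
    induction n, hn using Nat.le_induction with
    | base => norm_num
    | succ n hn ih => rw [pow_succ]; omega
  have h3 : (24 : ℝ) * k + 239 ≤ 2 ^ k := by exact_mod_cast hpow k h9
  linarith [h k (by linarith)]

/-- If `δ` stays within distance `R` of `T`, one can escape from a point of `δ` at distance `R`
from `T` in the direction of an endpoint of `δ` in `T` and then move to `T` without approaching. -/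
theorem exists_detour {Y : Type*} [PseudoMetricSpace Y]
    (hY : ∀ p q : Y, PathIn (fun _ => True) p q (dist p q + 1)) {δ : ℝ → Y} {e z : ℝ}
    (hδ : ContinuousOn δ (uIcc e z)) {T : Set Y} {R : ℝ} (hR : 0 ≤ R)
    (hT : ∀ t ∈ uIcc e z, ∃ w ∈ T, dist (δ t) w ≤ R) (hfar : ∀ w ∈ T, R ≤ dist (δ z) w)
    (he : δ e ∈ T) : ∃ t ∈ uIcc e z, ∃ w ∈ T, PathIn (fun v => R ≤ dist (δ z) v) (δ t) w (R + 1) ∧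
      dist (δ z) w ≤ 3 * R + 2 := by
  -- If the end is close, stop there. Otherwise leave at distance exactly `2 * R + 2`: a path of
  -- length `R + 1` from there to `T` cannot come within `R` of `δ z`.
  rcases le_total (dist (δ z) (δ e)) (2 * R + 2) with h | h
  · refine ⟨e, left_mem_uIcc, δ e, he, PathIn.extend (PathIn.refl ?_) (by linarith), by linarith⟩
    exact hfar _ he
  · have hc : ContinuousOn (fun t => dist (δ z) (δ t)) (uIcc e z) := by fun_prop
    obtain ⟨t, ht, hdt⟩ := intermediate_value_uIcc hc
      (show 2 * R + 2 ∈ uIcc (dist (δ z) (δ e)) (dist (δ z) (δ z)) by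
        rw [dist_self, uIcc_of_ge (by linarith)]; exact ⟨by linarith, h⟩)
    obtain ⟨w, hw, hdw⟩ := hT t ht
    dsimp only at hdt
    refine ⟨t, ht, w, hw, ((hY (δ t) w).extend (m := R + 1) (by linarith)).mono ?_, ?_⟩
    · intro v hv _
      linarith [dist_triangle_right (δ z) (δ t) v, dist_comm v (δ t)]
    · linarith [dist_triangle (δ z) (δ t) w]

/-- Geodesics of `X` are close to geodesics of the contraction space. -/
theorem cdist_add_le (hX : IsGeodesicSpace X) {x y q : X} {σ : Set X} (hσ : IsSegment σ x y)
    (hq : q ∈ σ) : cdist x q + cdist q y ≤ cdist x y + 107 := by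
  obtain ⟨hL, c, hc, hc0, hcL, -⟩ := Attach.exists_pathIn hX
    (Attach.incl (antiContracting X) x) (Attach.incl _ y) one_pos
  set L := dist (Attach.incl (antiContracting X) x) (Attach.incl _ y) + 1 with hLdef
  set T := c '' Icc 0 L with hT
  have hTne : T.Nonempty := ⟨_, 0, ⟨le_rfl, hL⟩, rfl⟩
  have hTc : IsCompact T := isCompact_Icc.image_of_continuousOn
    (LipschitzOnWith.of_dist_le_mul (K := 1) fun s hs t ht => by
      simpa [Real.dist_eq] using hc s hs t ht).continuousOn
  have hcont := Attach.continuous_incl (antiContracting X)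
  obtain ⟨γ, M, hM, hγ, hγ0, hγM, rfl⟩ := id hσ
  have hδ : ContinuousOn (fun t => Attach.incl (antiContracting X) (γ t)) (Icc 0 M) :=
    hcont.comp_continuousOn hγ.continuousOn
  -- The point of the geodesic farthest from the almost minimizing path `c`; the aim is to bound
  -- this distance `R`.
  obtain ⟨z, hz, hmax⟩ := isCompact_Icc.exists_isMaxOn (nonempty_Icc.2 hM)
    ((Metric.continuous_infDist_pt T).comp_continuousOn hδ)
  set R := Metric.infDist (Attach.incl (antiContracting X) (γ z)) T with hR
  have hR0 : 0 ≤ R := Metric.infDist_nonneg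
  have hnear : ∀ t ∈ Icc 0 M, ∃ w ∈ T, dist (Attach.incl (antiContracting X) (γ t)) w ≤ R := by
    intro t ht
    obtain ⟨w, hw, hd⟩ := hTc.exists_infDist_eq_dist hTne (Attach.incl (antiContracting X) (γ t))
    exact ⟨w, hw, hd ▸ hmax ht⟩
  have hfar : ∀ w ∈ T, R ≤ dist (Attach.incl (antiContracting X) (γ z)) w := fun w hw =>
    Metric.infDist_le_dist_of_mem hw
  have hY := fun p q : Attach X (antiContracting X) => Attach.exists_pathIn hX p q one_pos
  have hs1 : uIcc 0 z ⊆ Icc 0 M := by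
    rw [uIcc_of_le hz.1]; exact Icc_subset_Icc_right hz.2
  have hs2 : uIcc M z ⊆ Icc 0 M := by
    rw [uIcc_of_ge hz.2]; exact Icc_subset_Icc_left hz.1
  obtain ⟨t₁, ht₁, _, ⟨τ₁, hτ₁, rfl⟩, hp₁, hd₁⟩ := exists_detour hY (hδ.mono hs1) hR0
    (fun t ht => hnear t (hs1 ht)) hfar (by rw [hγ0, ← hc0]; exact ⟨0, ⟨le_rfl, hL⟩, rfl⟩)
  obtain ⟨t₂, ht₂, _, ⟨τ₂, hτ₂, rfl⟩, hp₂, hd₂⟩ := exists_detour hY (hδ.mono hs2) hR0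
    (fun t ht => hnear t (hs2 ht)) hfar (by rw [hγM, ← hcL]; exact ⟨L, ⟨hL, le_rfl⟩, rfl⟩)
  have ht₁' := hs1 ht₁
  have ht₂' := hs2 ht₂
  rw [uIcc_of_le hz.1] at ht₁
  rw [uIcc_of_ge hz.2] at ht₂
  have hmid : ∀ a ∈ Icc 0 L, ∀ b ∈ Icc 0 L, a ≤ b →
      PathIn (fun v => R ≤ dist (Attach.incl (antiContracting X) (γ z)) v) (c a) (c b) (b - a) ∧
        b - a ≤ dist (c a) (c b) + 1 := by
    intro a ha b hb hab
    refine ⟨PathIn.of_lipschitz hab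
      (fun s hs t ht => hc s ⟨ha.1.trans hs.1, hs.2.trans hb.2⟩ t ⟨ha.1.trans ht.1, ht.2.trans hb.2⟩)
      (fun t ht => hfar _ ⟨t, ⟨ha.1.trans ht.1, ht.2.trans hb.2⟩, rfl⟩), ?_⟩
    have e1 := hc 0 ⟨le_rfl, hL⟩ a ha
    have e2 := hc b hb L ⟨hL, le_rfl⟩
    rw [abs_of_nonpos (by linarith [ha.1])] at e1
    rw [abs_of_nonpos (by linarith [hb.2])] at e2
    have e3 := dist_triangle4 (c 0) (c a) (c b) (c L)
    rw [hc0, hcL] at e3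
    rw [hc0] at e1
    rw [hcL] at e2
    linarith
  -- Both landing points are within `3 * R + 2` of the farthest point, and `c` has excess length at
  -- most one between any two of its points.
  have hmid' : ∃ m, m ≤ 6 * R + 5 ∧
      PathIn (fun v => R ≤ dist (Attach.incl (antiContracting X) (γ z)) v) (c τ₁) (c τ₂) m := by
    have hdd := dist_triangle_left (c τ₁) (c τ₂) (Attach.incl (antiContracting X) (γ z))
    rcases le_total τ₁ τ₂ with h | h
    · obtain ⟨h1, h2⟩ := hmid _ hτ₁ _ hτ₂ h
      exact ⟨_, by linarith, h1⟩
    · obtain ⟨h1, h2⟩ := hmid _ hτ₂ _ hτ₁ h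
      rw [dist_comm] at h2
      exact ⟨_, by linarith, h1.symm⟩
  obtain ⟨m, hm, hpm⟩ := hmid'
  -- The detour has length at most `(R + 1) + (6 * R + 5) + (R + 1) = 8 * R + 7` and avoids the
  -- `R`-ball, whereas the geodesic is logarithmically close to it.
  have hR53 : R ≤ 53 := by
    refine le_of_forall_le_two_pow fun k hk => ?_
    obtain ⟨w, hw, hdw⟩ := exists_dist_le_of_pathIn hX k ((hp₁.trans hpm).trans hp₂.symm)
      (by linarith) (by simp) (by simp)
      ((hγ.sub ht₁'.1 (ht₁.2.trans ht₂.1) ht₂'.2).isSegment (ht₁.2.trans ht₂.1))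
      ⟨z, ⟨ht₁.2, ht₂.1⟩, rfl⟩
    exact hw.trans hdw
  obtain ⟨t, ht, rfl⟩ := hq
  obtain ⟨_, ⟨τ, hτ, rfl⟩, hd⟩ := hnear t ht
  have e1 := hc 0 ⟨le_rfl, hL⟩ τ hτ
  have e2 := hc τ hτ L ⟨hL, le_rfl⟩
  rw [abs_of_nonpos (by linarith [hτ.1]), hc0] at e1
  rw [abs_of_nonpos (by linarith [hτ.2]), hcL] at e2
  have e3 := dist_triangle_right (Attach.incl (antiContracting X) x)
    (Attach.incl (antiContracting X) (γ t)) (c τ)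
  have e4 := dist_triangle (Attach.incl (antiContracting X) (γ t)) (c τ) (Attach.incl _ y)
  unfold cdist
  linarith

/-- The distance to a geodesic of `X` is at most the Gromov product of its endpoints, up to a
bounded error. -/
theorem exists_mem_segment_cdist_le (hX : IsGeodesicSpace X) {x y : X} {σ : Set X}
    (hσ : IsSegment σ x y) (w : X) :
    ∃ q ∈ σ, 2 * cdist w q + cdist x y ≤ cdist w x + cdist w y + 226 := by
  obtain ⟨σ₂, h₂⟩ := hX y w
  obtain ⟨σ₃, h₃⟩ := hX w x
  have hcont := Attach.continuous_incl (antiContracting X)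
  have hclosed : ∀ τ : Set X, IsCompact τ → IsClosed {q | ∃ v ∈ τ, cdist q v ≤ 3} := by
    intro τ hτ
    have : {q | ∃ v ∈ τ, cdist q v ≤ 3} =
        Attach.incl (antiContracting X) ⁻¹' Metric.cthickening 3 (Attach.incl _ '' τ) := by
      rw [(hτ.image hcont).cthickening_eq_biUnion_closedBall (by norm_num)]
      ext q
      simp [cdist]
    rw [this]
    exact Metric.isClosed_cthickening.preimage hcont
  -- The 3-neighbourhoods of the other two sides are closed, cover the connected segment, and each
  -- contains one of its ends; so some point lies in both.
  obtain ⟨q, hq, ⟨v, hv, hqv⟩, ⟨v', hv', hqv'⟩⟩ :=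
    (isPreconnected_closed_iff.1 hσ.isPreconnected) _ _ (hclosed σ₂ h₂.isCompact)
      (hclosed σ₃ h₃.isCompact)
      (by
        intro q hq
        obtain ⟨v, hv | hv, h⟩ := cdist_thin_triangle hσ h₂ h₃ hq
        · exact Or.inl ⟨v, hv, h⟩
        · exact Or.inr ⟨v, hv, h⟩)
      ⟨y, hσ.right_mem, y, h₂.left_mem, by rw [cdist_self]; norm_num⟩
      ⟨x, hσ.left_mem, x, h₃.right_mem, by rw [cdist_self]; norm_num⟩
  refine ⟨q, hq, ?_⟩
  have e1 := cdist_add_le hX h₂.symm hv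
  have e2 := cdist_add_le hX h₃ hv'
  have e3 := cdist_triangle w v q
  have e4 := cdist_triangle w v' q
  have e5 := cdist_triangle q v y
  have e6 := cdist_triangle q v' x
  have e7 := cdist_triangle x q y
  rw [cdist_comm v q] at e3
  rw [cdist_comm v' q] at e4
  rw [cdist_comm q x] at e6
  linarith

/-- Choose `q` on `[x, z]` realizing the Gromov product seen from `w`, then a nearby point `v` on
`[x, y]` or `[y, z]`. Near-geodesicity of that side gives one of the two alternatives, with error
`226 + 107 + 6`. -/
theorem cdist_four_point (hX : IsGeodesicSpace X) (x y z w : X) :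
    cdist x z + cdist y w ≤ max (cdist x y + cdist z w) (cdist x w + cdist y z) + 339 := by
  obtain ⟨σ, hσ⟩ := hX x z
  obtain ⟨σ₂, h₂⟩ := hX z y
  obtain ⟨σ₃, h₃⟩ := hX y x
  obtain ⟨q, hq, hle⟩ := exists_mem_segment_cdist_le hX hσ w
  obtain ⟨v, hv, hqv⟩ := cdist_thin_triangle hσ h₂ h₃ hq
  have e1 := cdist_triangle w q v
  have e2 := cdist_triangle w v y
  rw [cdist_comm y w, cdist_comm z w, cdist_comm x w, cdist_comm y z, cdist_comm x y]
  rcases hv with hv | hv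
  · refine le_trans ?_ (add_le_add_left (le_max_right _ _) _)
    have e3 := cdist_add_le hX h₂ hv
    have e4 := cdist_triangle w v z
    rw [cdist_comm v z] at e4
    linarith
  · refine le_trans ?_ (add_le_add_left (le_max_left _ _) _)
    have e3 := cdist_add_le hX h₃ hv
    have e4 := cdist_triangle w v x
    rw [cdist_comm y v] at e3
    linarith

theorem isHyperbolicSpace_attach (hX : IsGeodesicSpace X) :
    IsHyperbolicSpace (Attach X (antiContracting X)) := by
  -- Moving four points into `X` costs 2 on each side of the inequality, and `339 + 4 = 343`.
  refine ⟨Attach.isLengthSpace hX, 343 / 2, by norm_num, fun x y z w => ?_⟩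
  obtain ⟨x', hx⟩ := Attach.exists_dist_incl_le x
  obtain ⟨y', hy⟩ := Attach.exists_dist_incl_le y
  obtain ⟨z', hz⟩ := Attach.exists_dist_incl_le z
  obtain ⟨w', hw⟩ := Attach.exists_dist_incl_le w
  have key : ∀ (a b : Attach X (antiContracting X)) (a' b' : X),
      dist a (Attach.incl (antiContracting X) a') ≤ 1 / 2 →
      dist b (Attach.incl (antiContracting X) b') ≤ 1 / 2 →
      dist a b ≤ cdist a' b' + 1 ∧ cdist a' b' ≤ dist a b + 1 := by
    intro a b a' b' ha hb
    have e1 := dist_triangle4 a (Attach.incl (antiContracting X) a') (Attach.incl _ b') b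
    have e2 := dist_triangle4 (Attach.incl (antiContracting X) a') a b (Attach.incl _ b')
    rw [dist_comm (Attach.incl _ b') b] at e1
    rw [dist_comm (Attach.incl _ a') a] at e2
    unfold cdist
    constructor <;> linarith
  have e := cdist_four_point hX x' y' z' w'
  have hxz := (key x z x' z' hx hz).1
  have hyw := (key y w y' w' hy hw).1
  have hm : max (cdist x' y' + cdist z' w') (cdist x' w' + cdist y' z') ≤
      max (dist x y + dist z w) (dist x w + dist y z) + 2 := by
    rw [← max_add_add_right]
    refine max_le_max ?_ ?_
    · linarith [(key x y x' y' hx hy).2, (key z w z' w' hz hw).2]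
    · linarith [(key x w x' w' hx hw).2, (key y z y' z' hy hz).2]
  linarith

theorem isHyperbolicSpace_contractionSpace (hX : IsGeodesicSpace X) :
    IsHyperbolicSpace (ContractionSpace X) :=
  isHyperbolicSpace_attach hX

end Hyperbolic

end Contraction

namespace Contraction

/-! ### Closest-point projection to a contracting geodesic. -/

section Projection

variable {X : Type*} [PseudoMetricSpace X]

/-- `γ u` is a closest point to `x` on `γ '' [α, β]`. -/
def ProjAt (γ : ℝ → X) (α β : ℝ) (x : X) (u : ℝ) : Prop :=
  u ∈ Icc α β ∧ ∀ v ∈ Icc α β, dist x (γ u) ≤ dist x (γ v)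

/-- `γ|[α,β]` is a geodesic with `D`-contracting image, phrased in terms of parameters. -/
structure ContractsAlong (D : ℝ) (γ : ℝ → X) (α β : ℝ) : Prop where
  geodesic : IsGeodesic γ (Icc α β)
  one_le : 1 ≤ D
  abs_sub_le : ∀ {x y : X} {w u : ℝ}, ProjAt γ α β x w → ProjAt γ α β y u →
    dist x y < dist x (γ w) → |u - w| ≤ D

variable {γ : ℝ → X} {α β D : ℝ}

theorem ProjAt.self {u : ℝ} (hu : u ∈ Icc α β) :
    ProjAt γ α β (γ u) u :=
  ⟨hu, fun v _ => by rw [dist_self]; exact dist_nonneg⟩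

theorem ProjAt.infDist_eq {x : X} {u : ℝ} (h : ProjAt γ α β x u) :
    Metric.infDist x (γ '' Icc α β) = dist x (γ u) := by
  refine le_antisymm (Metric.infDist_le_dist_of_mem ⟨u, h.1, rfl⟩) ?_
  refine (Metric.le_infDist (Nonempty.image _ ⟨u, h.1⟩)).2 ?_
  rintro _ ⟨v, hv, rfl⟩
  exact h.2 v hv

theorem ProjAt.reverse {x : X} {u : ℝ} (h : ProjAt γ α β x u) :
    ProjAt (fun t => γ (-t)) (-β) (-α) x (-u) :=
  ⟨⟨by linarith [h.1.2], by linarith [h.1.1]⟩, fun v hv => by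
    simpa using h.2 (-v) ⟨by linarith [hv.2], by linarith [hv.1]⟩⟩

theorem exists_projAt (hγ : IsGeodesic γ (Icc α β)) (x : X) : ∃ u, ProjAt γ α β x u := by
  have hc := hγ.continuousOn
  obtain ⟨u, hu, h⟩ := isCompact_Icc.exists_isMinOn hγ.nonempty
    (f := fun u => dist x (γ u)) (by fun_prop)
  exact ⟨u, hu, fun v hv => h hv⟩

theorem IsContracting.contractsAlong (h : IsContracting D (γ '' Icc α β)) (hD : 1 ≤ D)
    (hγ : IsGeodesic γ (Icc α β)) : ContractsAlong D γ α β := by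
  refine ⟨hγ, hD, fun {x y w u} hx hy hxy => ?_⟩
  have hcl : ∀ {z : X} {v : ℝ}, ProjAt γ α β z v → γ v ∈ closestPoints (γ '' Icc α β) z := by
    intro z v hz
    refine ⟨⟨v, hz.1, rfl⟩, ?_⟩
    rintro _ ⟨v', hv', rfl⟩
    exact hz.2 v' hv'
  rw [← hγ.dist_eq u hy.1 w hx.1]
  refine h x y ?_ x ?_ _ (hcl hy) _ (hcl hx)
  · rw [Metric.mem_ball, hx.infDist_eq, dist_comm]; exact hxy
  · rw [Metric.mem_ball, hx.infDist_eq, dist_self]; exact dist_nonneg.trans_lt hxy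

namespace ContractsAlong

theorem reverse (h : ContractsAlong D γ α β) :
    ContractsAlong D (fun t => γ (-t)) (-β) (-α) := by
  refine ⟨h.geodesic.reverse, h.one_le, fun {x y w u} hx hy hxy => ?_⟩
  have hx' := hx.reverse
  have hy' := hy.reverse
  simp only [neg_neg] at hx' hy'
  have := h.abs_sub_le hx' hy' hxy
  rwa [← neg_add', abs_neg, ← sub_eq_add_neg] at this

theorem abs_sub_le_dist (h : ContractsAlong D γ α β) {x y : X} {u v : ℝ}
    (hx : ProjAt γ α β x u) (hy : ProjAt γ α β y v) : |u - v| ≤ 4 * dist x y + D := by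
  have hD := h.one_le
  have h0 := dist_nonneg (x := x) (y := y)
  rcases lt_or_ge (dist x y) (dist x (γ u)) with hlt | hge
  · have := h.abs_sub_le hx hy hlt
    rw [abs_sub_comm]
    linarith
  · have e1 := hy.2 u hx.1
    have e2 := dist_triangle_left y (γ u) x
    have e3 := dist_triangle4 (γ u) x y (γ v)
    rw [← h.geodesic.dist_eq u hx.1 v hy.1]
    rw [dist_comm (γ u) x] at e3
    linarith

/-- Pieces of length `4 * D` fit into the contracting balls, whose radius is at least `8 * D`, so
each moves the projection by at most `D`: a quarter of the length travelled. -/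
theorem abs_sub_le_of_far_aux (h : ContractsAlong D γ α β) {σ : ℝ → X} (n : ℕ) :
    ∀ {s t u v : ℝ}, IsGeodesic σ (Icc s t) →
      (∀ τ ∈ Icc s t, ∀ w, ProjAt γ α β (σ τ) w → 8 * D ≤ dist (σ τ) (γ w)) →
      ProjAt γ α β (σ s) u → ProjAt γ α β (σ t) v → t - s ≤ (n + 1) * (4 * D) →
      |u - v| ≤ (n + 1) * D := by
  have hD := h.one_le
  induction n with
  | zero =>
    intro s t u v hσ hfar hu hv hst
    have hs : s ≤ t := nonempty_Icc.1 hσ.nonempty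
    have h1 : dist (σ s) (σ t) = t - s := by
      rw [hσ.dist_eq s ⟨le_rfl, hs⟩ t ⟨hs, le_rfl⟩, abs_of_nonpos (by linarith)]; ring
    have := hfar s ⟨le_rfl, hs⟩ u hu
    have := h.abs_sub_le hu hv (by norm_num at hst; linarith)
    rw [abs_sub_comm]
    simpa
  | succ n ih =>
    intro s t u v hσ hfar hu hv hst
    have hs : s ≤ t := nonempty_Icc.1 hσ.nonempty
    push_cast at hst ⊢
    rcases le_total (t - s) (4 * D) with hl | hl
    · have h1 : dist (σ s) (σ t) = t - s := by
        rw [hσ.dist_eq s ⟨le_rfl, hs⟩ t ⟨hs, le_rfl⟩, abs_of_nonpos (by linarith)]; ring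
      have := hfar s ⟨le_rfl, hs⟩ u hu
      have := h.abs_sub_le hu hv (by linarith)
      rw [abs_sub_comm]
      nlinarith [Nat.cast_nonneg (α := ℝ) n]
    · have h1 : dist (σ s) (σ (s + 4 * D)) = 4 * D := by
        rw [hσ.dist_eq s ⟨le_rfl, hs⟩ _ ⟨by linarith, by linarith⟩, abs_of_nonpos (by linarith)]
        ring
      obtain ⟨w, hw⟩ := exists_projAt h.geodesic (σ (s + 4 * D))
      have e1 := hfar s ⟨le_rfl, hs⟩ u hu
      have e2 := h.abs_sub_le hu hw (by linarith)
      have e3 := ih (hσ.sub (by linarith : s ≤ s + 4 * D) (by linarith) le_rfl)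
        (fun τ hτ => hfar τ ⟨by linarith [hτ.1], hτ.2⟩) hw hv (by linarith)
      have e4 := _root_.abs_sub_le u w v
      rw [abs_sub_comm w u] at e2
      linarith

/-- The projection of a geodesic that stays far from a contracting geodesic is bounded. -/
theorem abs_sub_le_of_far (h : ContractsAlong D γ α β) {σ : ℝ → X} {s t u v : ℝ}
    (hσ : IsGeodesic σ (Icc s t))
    (hfar : ∀ τ ∈ Icc s t, ∀ w, ProjAt γ α β (σ τ) w → 8 * D ≤ dist (σ τ) (γ w))
    (hu : ProjAt γ α β (σ s) u) (hv : ProjAt γ α β (σ t) v) : |u - v| ≤ 5 * D := by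
  have hD := h.one_le
  have hs : s ≤ t := nonempty_Icc.1 hσ.nonempty
  have hsm : s ∈ Icc s t := ⟨le_rfl, hs⟩
  have htm : t ∈ Icc s t := ⟨hs, le_rfl⟩
  have f1 := hfar s hsm u hu
  have f2 := hfar t htm v hv
  set R₁ := dist (σ s) (γ u)
  set R₂ := dist (σ t) (γ v)
  have hleft : ∀ m ∈ Icc s t, ∀ w, ProjAt γ α β (σ m) w → m - s < R₁ → |u - w| ≤ D := by
    intro m hm w hw hlt
    rw [abs_sub_comm]
    refine h.abs_sub_le hu hw ?_
    rw [hσ.dist_eq s hsm m hm, abs_of_nonpos (by linarith [hm.1])]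
    linarith
  have hright : ∀ m ∈ Icc s t, ∀ w, ProjAt γ α β (σ m) w → t - m < R₂ → |w - v| ≤ D := by
    intro m hm w hw hlt
    refine h.abs_sub_le hv hw ?_
    rw [hσ.dist_eq t htm m hm, abs_of_nonneg (by linarith [hm.2])]
    linarith
  -- If the balls around the two ends overlap along `σ`, they already bound the projection by `2 *
  -- D`.
  rcases le_total (t - s) (R₁ + R₂ - 2) with hl | hl
  · obtain ⟨m, hm, h1, h2⟩ : ∃ m ∈ Icc s t, m - s < R₁ ∧ t - m < R₂ := by
      rcases le_total t (s + R₁ - 1 / 2) with h' | h'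
      · exact ⟨t, htm, by linarith, by linarith⟩
      · exact ⟨s + R₁ - 1 / 2, ⟨by linarith, h'⟩, by linarith, by linarith⟩
    obtain ⟨w, hw⟩ := exists_projAt h.geodesic (σ m)
    linarith [hleft m hm w hw h1, hright m hm w hw h2, _root_.abs_sub_le u w v]
  · obtain ⟨w₁, hw₁⟩ := exists_projAt h.geodesic (σ (s + R₁ - 1))
    obtain ⟨w₂, hw₂⟩ := exists_projAt h.geodesic (σ (t - (R₂ - 1)))
    have e1 := hleft _ ⟨by linarith, by linarith⟩ _ hw₁ (by linarith)
    have e2 := hright _ ⟨by linarith, by linarith⟩ _ hw₂ (by linarith)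
    -- Since `σ` is geodesic, the middle length `ℓ` is at most `|u - v| + 2`, while its projection
    -- moves at most `ℓ / 4 + D`. Adding `D` for each end, the inequality can be solved for `|u -
    -- v|`.
    set ℓ := t - (R₂ - 1) - (s + R₁ - 1) with hℓ
    have e3 := h.abs_sub_le_of_far_aux ⌊ℓ / (4 * D)⌋₊
      (hσ.sub (by linarith : s ≤ s + R₁ - 1) (by linarith) (by linarith : t - (R₂ - 1) ≤ t))
      (fun τ hτ => hfar τ ⟨by linarith [hτ.1], by linarith [hτ.2]⟩) hw₁ hw₂ (by
        rw [← div_le_iff₀ (by linarith)]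
        exact (Nat.lt_floor_add_one _).le)
    have e4 : (⌊ℓ / (4 * D)⌋₊ : ℝ) ≤ ℓ / (4 * D) :=
      Nat.floor_le (div_nonneg (by linarith) (by linarith))
    rw [le_div_iff₀ (by linarith)] at e4
    have e5 : dist (σ s) (σ t) = t - s := by
      rw [hσ.dist_eq s hsm t htm, abs_of_nonpos (by linarith)]; ring
    have e6 := dist_triangle4 (σ s) (γ u) (γ v) (σ t)
    rw [h.geodesic.dist_eq u hu.1 v hv.1, dist_comm (γ v)] at e6
    have e7 := _root_.abs_sub_le u w₁ v
    have e8 := _root_.abs_sub_le w₁ w₂ v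
    linarith

/-- After its last visit to the `8 * D`-neighbourhood, `σ` hardly moves its projection, so that
visit happens near the projection of the end. -/
theorem exists_dist_le_of_near (h : ContractsAlong D γ α β) {σ : ℝ → X} {s t v z : ℝ}
    (hσ : IsGeodesic σ (Icc s t)) (hz : z ∈ Icc s t)
    (hnear : Metric.infDist (σ z) (γ '' Icc α β) ≤ 8 * D)
    (hv : ProjAt γ α β (σ t) v) : ∃ τ ∈ Icc s t, dist (σ τ) (γ v) ≤ 15 * D := by
  have hD := h.one_le
  have hc : ContinuousOn (fun τ => Metric.infDist (σ τ) (γ '' Icc α β)) (Icc s t) :=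
    (Metric.continuous_infDist_pt _).comp_continuousOn hσ.continuousOn
  have hcomp : IsCompact (Icc s t ∩ (fun τ => Metric.infDist (σ τ) (γ '' Icc α β)) ⁻¹'
      Iic (8 * D)) :=
    isCompact_Icc.of_isClosed_subset (hc.preimage_isClosed_of_isClosed isClosed_Icc isClosed_Iic)
      inter_subset_left
  obtain ⟨τ, ⟨hτ, hτn⟩, hmax⟩ := hcomp.exists_isGreatest ⟨z, hz, hnear⟩
  rcases eq_or_lt_of_le hτ.2 with hτt | hτt
  · subst hτt
    refine ⟨τ, hτ, ?_⟩
    rw [← hv.infDist_eq]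
    exact (mem_Iic.1 hτn).trans (by linarith)
  · obtain ⟨w, hw⟩ := exists_projAt h.geodesic (σ τ)
    have hwn : dist (σ τ) (γ w) ≤ 8 * D := by rw [← hw.infDist_eq]; exact hτn
    refine ⟨τ, hτ, ?_⟩
    -- Advance slightly beyond the last visit so that `abs_sub_le_of_far` applies. The step moves
    -- the projection by at most `2 * D`, giving `8 + 2 + 5 = 15`.
    set ε := min (1 / 4) (t - τ) with hε
    have hε0 : 0 < ε := lt_min (by norm_num) (by linarith)
    have hε1 : ε ≤ 1 / 4 := min_le_left _ _
    have hε2 : ε ≤ t - τ := min_le_right _ _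
    obtain ⟨w', hw'⟩ := exists_projAt h.geodesic (σ (τ + ε))
    have e1 := h.abs_sub_le_dist hw hw'
    rw [hσ.dist_eq τ hτ _ ⟨by linarith [hτ.1], by linarith⟩, abs_of_nonpos (a := τ - (τ + ε))
      (by linarith)] at e1
    have e2 := h.abs_sub_le_of_far (hσ.sub (by linarith [hτ.1]) (by linarith : τ + ε ≤ t) le_rfl)
      (fun τ' hτ' w'' hw'' => by
        by_contra hlt
        have := hmax ⟨⟨by linarith [hτ.1, hτ'.1], hτ'.2⟩, show Metric.infDist _ _ ≤ 8 * D by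
          rw [hw''.infDist_eq]; linarith⟩
        linarith [hτ'.1]) hw' hv
    have e3 := _root_.abs_sub_le w w' v
    have e4 := dist_triangle (σ τ) (γ w) (γ v)
    rw [h.geodesic.dist_eq w hw.1 v hv.1] at e4
    linarith

theorem exists_dist_le_of_le (h : ContractsAlong D γ α β) {σ : ℝ → X} {s t u v p : ℝ}
    (hσ : IsGeodesic σ (Icc s t)) (hu : ProjAt γ α β (σ s) u) (hv : ProjAt γ α β (σ t) v)
    (hup : u ≤ p) (hpv : p ≤ v) (huv : 5 * D < v - u) :
    ∃ τ ∈ Icc s t, dist (σ τ) (γ p) ≤ 17 * D := by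
  have hD := h.one_le
  have hs : s ≤ t := nonempty_Icc.1 hσ.nonempty
  have hsm : s ∈ Icc s t := ⟨le_rfl, hs⟩
  have htm : t ∈ Icc s t := ⟨hs, le_rfl⟩
  have hp : p ∈ Icc α β := ⟨hu.1.1.trans hup, hpv.trans hv.1.2⟩
  obtain ⟨τ₁, hτ₁, w₁, hw₁, hw₁p⟩ : ∃ τ ∈ Icc s t, ∃ w, ProjAt γ α β (σ τ) w ∧ |w - p| ≤ 2 * D := by
    -- Projections need not be continuous. A time almost at the supremum of `S` has projection at
    -- most `p`, and at most `1/4` later the projection is at least `p`; the jump between is at most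
    -- `2 * D`.
    let S : Set ℝ := {τ | τ ∈ Icc s t ∧ ∃ w ≤ p, ProjAt γ α β (σ τ) w}
    have hS : S.Nonempty := ⟨s, hsm, u, hup, hu⟩
    have hSb : BddAbove S := ⟨t, fun τ hτ => hτ.1.2⟩
    obtain ⟨τ₁, ⟨hτ₁, w₁, hw₁p, hw₁⟩, hlt⟩ :=
      exists_lt_of_lt_csSup hS (show sSup S - 1 / 8 < sSup S by linarith)
    refine ⟨τ₁, hτ₁, w₁, hw₁, ?_⟩
    obtain ⟨τ₂, hτ₂, h12, h21, w₂, hw₂, hpw₂⟩ : ∃ τ₂ ∈ Icc s t, τ₁ ≤ τ₂ ∧ τ₂ ≤ τ₁ + 1 / 4 ∧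
        ∃ w, ProjAt γ α β (σ τ₂) w ∧ p ≤ w := by
      rcases le_total t (τ₁ + 1 / 4) with ht | ht
      · exact ⟨t, htm, hτ₁.2, ht, v, hv, hpv⟩
      · obtain ⟨w, hw⟩ := exists_projAt h.geodesic (σ (τ₁ + 1 / 4))
        refine ⟨τ₁ + 1 / 4, ⟨by linarith [hτ₁.1], ht⟩, by linarith, le_rfl, w, hw, ?_⟩
        by_contra hn
        have := le_csSup hSb (⟨⟨by linarith [hτ₁.1], ht⟩, w, by linarith, hw⟩ : τ₁ + 1 / 4 ∈ S)
        linarith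
    have e1 := h.abs_sub_le_dist hw₁ hw₂
    rw [hσ.dist_eq _ hτ₁ _ hτ₂, abs_of_nonpos (a := τ₁ - τ₂) (by linarith),
      abs_of_nonpos (by linarith)] at e1
    rw [abs_of_nonpos (by linarith)]
    linarith
  have hw₁γ : dist (γ w₁) (γ p) ≤ 2 * D := by rwa [h.geodesic.dist_eq _ hw₁.1 _ hp]
  suffices hsuff : ∃ τ ∈ Icc s t, dist (σ τ) (γ w₁) ≤ 15 * D by
    obtain ⟨τ, hτ, hd⟩ := hsuff
    exact ⟨τ, hτ, by linarith [dist_triangle (σ τ) (γ w₁) (γ p)]⟩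
  obtain ⟨z, hz, hzn⟩ : ∃ z ∈ Icc s t, Metric.infDist (σ z) (γ '' Icc α β) ≤ 8 * D := by
    by_contra hn
    push Not at hn
    have := h.abs_sub_le_of_far hσ (fun τ hτ w hw => by
      rw [← hw.infDist_eq]; exact (hn τ hτ).le) hu hv
    rw [abs_of_nonpos (by linarith)] at this
    linarith
  -- Cut `σ` at `τ₁`. The half containing the near point `z` passes close to the projection of its
  -- end at `τ₁`.
  rcases le_total z τ₁ with hz1 | hz1
  · obtain ⟨τ, hτ, hd⟩ := h.exists_dist_le_of_near (hσ.sub le_rfl hτ₁.1 hτ₁.2) ⟨hz.1, hz1⟩ hzn hw₁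
    exact ⟨τ, ⟨hτ.1, hτ.2.trans hτ₁.2⟩, hd⟩
  · obtain ⟨τ, hτ, hd⟩ := h.exists_dist_le_of_near (hσ.sub hτ₁.1 hτ₁.2 le_rfl).reverse
      (z := -z) (v := w₁) ⟨by linarith [hz.2], by linarith⟩ (by simpa using hzn) (by simpa using hw₁)
    exact ⟨-τ, ⟨by linarith [hτ.2, hτ₁.1], by linarith [hτ.1]⟩, hd⟩

/-- A geodesic with a long projection to a contracting geodesic passes close to every point of that
projection. -/
theorem exists_dist_le (h : ContractsAlong D γ α β) {σ : ℝ → X} {s t u v p : ℝ}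
    (hσ : IsGeodesic σ (Icc s t)) (hu : ProjAt γ α β (σ s) u) (hv : ProjAt γ α β (σ t) v)
    (hp : p ∈ uIcc u v) (huv : 5 * D < |u - v|) :
    ∃ τ ∈ Icc s t, dist (σ τ) (γ p) ≤ 17 * D := by
  rcases le_total u v with h' | h'
  · rw [uIcc_of_le h'] at hp
    rw [abs_of_nonpos (by linarith)] at huv
    exact h.exists_dist_le_of_le hσ hu hv hp.1 hp.2 (by linarith)
  · rw [uIcc_of_ge h'] at hp
    rw [abs_of_nonneg (by linarith)] at huv
    obtain ⟨τ, hτ, hd⟩ := h.exists_dist_le_of_le hσ.reverse (u := v) (v := u)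
      (by simpa using hv) (by simpa using hu) hp.1 hp.2 huv
    exact ⟨-τ, ⟨by linarith [hτ.2], by linarith [hτ.1]⟩, hd⟩

theorem exists_mem_segment_dist_le (h : ContractsAlong D γ α β) {σ : Set X} {x y : X} {u v p : ℝ}
    (hσ : IsSegment σ x y) (hu : ProjAt γ α β x u) (hv : ProjAt γ α β y v)
    (hp : p ∈ uIcc u v) (huv : 5 * D < |u - v|) : ∃ z ∈ σ, dist z (γ p) ≤ 17 * D := by
  obtain ⟨c, L, hL, hc, rfl, rfl, rfl⟩ := hσ
  obtain ⟨τ, hτ, hd⟩ := h.exists_dist_le hc hu hv hp huv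
  exact ⟨_, ⟨τ, hτ, rfl⟩, hd⟩

theorem abs_sub_le_of_dist_le (h : ContractsAlong D γ α β) {x : X} {u v C : ℝ}
    (hv : v ∈ Icc α β) (hu : ProjAt γ α β x u) (hd : dist x (γ v) ≤ C) : |u - v| ≤ 2 * C := by
  have := hu.2 v hv
  have := dist_triangle_left (γ u) (γ v) x
  rw [h.geodesic.dist_eq u hu.1 v hv] at this
  linarith

/-- A geodesic passing near `γ u` and later near `γ v` does not project backwards thereafter. -/
theorem sub_le_of_projAt (h : ContractsAlong D γ α β) {η : ℝ → X} {a b d u v w : ℝ}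
    (hη : IsGeodesic η (Icc a d)) (hab : a ≤ b) (hbd : b ≤ d) (hu : u ∈ Icc α β)
    (hv : v ∈ Icc α β) (ha : dist (η a) (γ u) ≤ 17 * D) (hb : dist (η b) (γ v) ≤ 17 * D)
    (huv : 85 * D < v - u) (hw : ProjAt γ α β (η d) w) : v - 85 * D ≤ w := by
  have hD := h.one_le
  by_contra hlt
  push Not at hlt
  obtain ⟨v', hv'⟩ := exists_projAt h.geodesic (η b)
  have e1 := abs_le.1 (h.abs_sub_le_of_dist_le hv hv' hb)
  -- If `η` projected far back after time `b`, it would pass near `γ (max w u)` again, too close to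
  -- `η a` for a time later than `b`.
  obtain ⟨τ, hτ, hd⟩ := h.exists_dist_le (p := max w u) (hη.sub hab hbd le_rfl) hv' hw
    (by
      rw [uIcc_of_ge (by linarith)]
      exact ⟨le_max_left _ _, max_le (by linarith) (by linarith)⟩)
    (by rw [abs_of_nonneg (by linarith)]; linarith)
  have hm : max w u ∈ Icc α β := ⟨hu.1.trans (le_max_right _ _), max_le hw.1.2 hu.2⟩
  have e2 : dist (η a) (η τ) = τ - a := by
    rw [hη.dist_eq a ⟨le_rfl, hab.trans hbd⟩ τ ⟨hab.trans hτ.1, hτ.2⟩,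
      abs_of_nonpos (by linarith [hτ.1])]
    ring
  have e3 : dist (η a) (η b) = b - a := by
    rw [hη.dist_eq a ⟨le_rfl, hab.trans hbd⟩ b ⟨hab, hbd⟩, abs_of_nonpos (by linarith)]
    ring
  have e4 : dist (γ u) (γ (max w u)) = max w u - u := by
    rw [h.geodesic.dist_eq _ hu _ hm, abs_of_nonpos (by linarith [le_max_right w u])]
    ring
  have e5 : dist (γ u) (γ v) = v - u := by
    rw [h.geodesic.dist_eq _ hu _ hv, abs_of_nonpos (by linarith)]
    ring
  have e6 := dist_triangle4 (η a) (γ u) (γ (max w u)) (η τ)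
  rw [dist_comm (γ (max w u))] at e6
  have e7 := dist_triangle4 (γ u) (η a) (η b) (γ v)
  rw [dist_comm (γ u) (η a)] at e7
  have e8 : max w u < v - 4 * (17 * D) := max_lt (by linarith) (by linarith)
  linarith [hτ.1]

/-- Long geodesic segments close to a contracting geodesic are thin. -/
theorem isThin (h : ContractsAlong D γ α β) {σ : ℝ → X} {a b u v : ℝ}
    (hab : a ≤ b) (hu : u ∈ Icc α β) (hv : v ∈ Icc α β)
    (hσu : dist (σ a) (γ u) ≤ 17 * D) (hσv : dist (σ b) (γ v) ≤ 17 * D)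
    (huv : 1000 * D < v - u) : IsThin (91 * D) σ a b := by
  have hD := h.one_le
  intro η c d hc hd hη heq p q σ₂ σ₃ σ₄ h2 h3 h4
  have hηa : η a = σ a := heq ⟨le_rfl, hab⟩
  have hηb : η b = σ b := heq ⟨hab, le_rfl⟩
  rw [← hηa] at hσu
  rw [← hηb] at hσv
  obtain ⟨t₀, ht₀⟩ := exists_projAt h.geodesic (η d)
  obtain ⟨t₁, ht₁⟩ := exists_projAt h.geodesic p
  obtain ⟨t₂, ht₂⟩ := exists_projAt h.geodesic q
  obtain ⟨t₃, ht₃⟩ := exists_projAt h.geodesic (η c)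
  -- The ends of `η` project beyond the ends of the segment, up to `85 * D`; so the other three
  -- sides together must project across the middle.
  have hle₀ := h.sub_le_of_projAt (hη.sub hc (hab.trans hd) le_rfl) hab hd hu hv hσu hσv
    (by linarith) ht₀
  have hle₃ := h.reverse.sub_le_of_projAt (hη.sub le_rfl (hc.trans hab) hd).reverse
    (a := -b) (b := -a) (d := -c) (u := -v) (v := -u) (w := -t₃) (by linarith) (by linarith)
    ⟨by linarith [hv.2], by linarith [hv.1]⟩ ⟨by linarith [hu.2], by linarith [hu.1]⟩
    (by simpa using hσv) (by simpa using hσu) (by linarith) (by simpa using ht₃.reverse)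
  set m := (u + v) / 2 with hm
  -- Depending on where `t₁` and `t₂` lie, one side crosses a stretch longer than `5 * D` with an
  -- end in `[m, m + 6 * D]`. The width 6 leaves room for the middle side, where the crossing is
  -- exactly this interval.
  obtain ⟨z, hz, p', hp', hzp⟩ : ∃ z ∈ σ₂ ∪ σ₃ ∪ σ₄, ∃ p' ∈ Icc m (m + 6 * D),
      dist z (γ p') ≤ 17 * D := by
    rcases le_total t₁ (m + 6 * D) with h1 | h1
    · obtain ⟨z, hz, hd⟩ := h.exists_mem_segment_dist_le (p := m + 6 * D) h2 ht₀ ht₁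
        (by rw [uIcc_of_ge (by linarith)]; exact ⟨h1, by linarith⟩)
        (by rw [abs_of_nonneg (by linarith)]; linarith)
      exact ⟨z, Or.inl (Or.inl hz), _, ⟨by linarith, le_rfl⟩, hd⟩
    rcases le_total t₂ m with h2 | h2
    · obtain ⟨z, hz, hd⟩ := h.exists_mem_segment_dist_le (p := m) h3 ht₁ ht₂
        (by rw [uIcc_of_ge (by linarith)]; exact ⟨h2, by linarith⟩)
        (by rw [abs_of_nonneg (by linarith)]; linarith)
      exact ⟨z, Or.inl (Or.inr hz), _, ⟨le_rfl, by linarith⟩, hd⟩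
    · obtain ⟨z, hz, hd⟩ := h.exists_mem_segment_dist_le (p := m) h4 ht₂ ht₃
        (by rw [uIcc_of_ge (by linarith)]; exact ⟨by linarith, h2⟩)
        (by rw [abs_of_nonneg (by linarith)]; linarith)
      exact ⟨z, Or.inr hz, _, ⟨le_rfl, by linarith⟩, hd⟩
  refine ⟨z, hz, ?_⟩
  have hmI : m ∈ Icc α β := ⟨by linarith [hu.1], by linarith [hv.2]⟩
  have hpI : p' ∈ Icc α β := ⟨hmI.1.trans hp'.1, by linarith [hp'.2, hv.2]⟩
  obtain ⟨u', hu'⟩ := exists_projAt h.geodesic (η a)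
  obtain ⟨v', hv'⟩ := exists_projAt h.geodesic (η b)
  have e1 := abs_le.1 (h.abs_sub_le_of_dist_le hu hu' hσu)
  have e2 := abs_le.1 (h.abs_sub_le_of_dist_le hv hv' hσv)
  obtain ⟨τ, hτ, hτm⟩ := h.exists_dist_le (p := m) (hη.sub hc hab hd) hu' hv'
    (by rw [uIcc_of_le (by linarith)]; exact ⟨by linarith, by linarith⟩)
    (by rw [abs_of_nonpos (by linarith)]; linarith)
  have ha' : a ∈ Icc c d := ⟨hc, hab.trans hd⟩
  have hb' : b ∈ Icc c d := ⟨hc.trans hab, hd⟩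
  have hτ' : τ ∈ Icc c d := ⟨hc.trans hτ.1, hτ.2.trans hd⟩
  have f1 : dist (η a) (η τ) = τ - a := by
    rw [hη.dist_eq a ha' τ hτ', abs_of_nonpos (by linarith [hτ.1])]; ring
  have f2 : dist (η τ) (η b) = b - τ := by
    rw [hη.dist_eq τ hτ' b hb', abs_of_nonpos (by linarith [hτ.2])]; ring
  have f3 : dist (γ u) (γ m) = m - u := by
    rw [h.geodesic.dist_eq _ hu _ hmI, abs_of_nonpos (by linarith)]; ring
  have f4 : dist (γ m) (γ v) = v - m := by
    rw [h.geodesic.dist_eq _ hmI _ hv, abs_of_nonpos (by linarith)]; ring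
  have f5 : dist (γ p') (γ m) ≤ 6 * D := by
    rw [h.geodesic.dist_eq _ hpI _ hmI, abs_of_nonneg (by linarith [hp'.1])]; linarith [hp'.2]
  have g1 := dist_triangle4 (η a) (γ u) (γ m) (η τ)
  have g2 := dist_triangle4 (γ u) (η a) (η τ) (γ m)
  have g3 := dist_triangle4 (η τ) (γ m) (γ v) (η b)
  have g4 := dist_triangle4 (γ m) (η τ) (η b) (γ v)
  rw [dist_comm (γ m) (η τ)] at g1 g4
  rw [dist_comm (γ u) (η a)] at g2
  rw [dist_comm (γ v) (η b)] at g3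
  -- The distances from `η τ` to the two ends agree up to `O(D)` with the equal distances from `γ m`
  -- to `γ u` and `γ v`. The final constant is `51 + 17 + 6 + 17 = 91`.
  have f6 : dist (η ((a + b) / 2)) (η τ) ≤ 3 * (17 * D) := by
    rw [hη.dist_eq _ ⟨by linarith, by linarith⟩ τ hτ', abs_le]
    constructor <;> linarith
  rw [← heq ⟨by linarith, by linarith⟩]
  have g5 := dist_triangle4 (η ((a + b) / 2)) (η τ) (γ m) (γ p')
  have g6 := dist_triangle_right (η ((a + b) / 2)) z (γ p')
  rw [dist_comm (γ m)] at g5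
  linarith

/-- A larger projection would make a geodesic from `x` to `y` follow `γ` long enough to contain a
thin subsegment. -/
theorem sub_le_of_mem_antiContracting (hX : IsGeodesicSpace X) (h : ContractsAlong D γ α β)
    {x y : X} {u v : ℝ} (hxy : (x, y) ∈ antiContracting X) (hx : ProjAt γ α β x u)
    (hy : ProjAt γ α β y v) : v - u ≤ 1000 * D := by
  have hD := h.one_le
  by_contra hlt
  push Not at hlt
  obtain ⟨σ', hσ'⟩ := hX x y
  obtain ⟨σ, L, hL, hσ, rfl, rfl, -⟩ := hσ'
  obtain ⟨a, ha, hda⟩ := h.exists_dist_le hσ hx hy left_mem_uIcc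
    (by rw [abs_of_nonpos (by linarith)]; linarith)
  obtain ⟨b, hb, hdb⟩ := h.exists_dist_le hσ hx hy right_mem_uIcc
    (by rw [abs_of_nonpos (by linarith)]; linarith)
  -- The passing times differ by more than `1000 * D - 34 * D`, which exceeds `10 * (91 * D) + 1`
  -- because `D ≥ 1`. They may occur in either order; the reversed order uses the reversed `γ`.
  have e1 := dist_triangle4 (γ u) (σ a) (σ b) (γ v)
  rw [h.geodesic.dist_eq u hx.1 v hy.1, abs_of_nonpos (by linarith), dist_comm (γ u),
    hσ.dist_eq a ha b hb] at e1
  rcases le_total a b with hab | hab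
  · rw [abs_of_nonpos (by linarith)] at e1
    exact not_isThin_of_mem hxy hσ rfl rfl (by linarith) ha.1 hab hb.2 (by linarith)
      (h.isThin hab hx.1 hy.1 hda hdb hlt)
  · rw [abs_of_nonneg (by linarith)] at e1
    exact not_isThin_of_mem hxy hσ rfl rfl (by linarith) hb.1 hab ha.2 (by linarith)
      (h.reverse.isThin hab hy.reverse.1 hx.reverse.1 (by simpa using hdb) (by simpa using hda)
        (by linarith))

theorem abs_sub_le_of_mem_antiContracting (hX : IsGeodesicSpace X) (h : ContractsAlong D γ α β)
    {x y : X} {u v : ℝ} (hxy : (x, y) ∈ antiContracting X) (hx : ProjAt γ α β x u)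
    (hy : ProjAt γ α β y v) : |u - v| ≤ 1000 * D := by
  have e1 := h.sub_le_of_mem_antiContracting hX hxy hx hy
  have e2 := h.reverse.sub_le_of_mem_antiContracting hX hxy hx.reverse hy.reverse
  rw [abs_le]
  constructor <;> linarith

end ContractsAlong

end Projection

/-! ### Projections and the metric of the contraction space. -/

namespace ContractsAlong

variable {X : Type*} [MetricSpace X] {γ : ℝ → X} {α β D : ℝ}

theorem abs_sub_le_of_reach (hX : IsGeodesicSpace X) (h : ContractsAlong D γ α β)
    {x y : X} {u : ℝ} {k : ℕ} {l : ℝ} (hr : Attach.Reach (antiContracting X) x k l y)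
    (hx : ProjAt γ α β x u) :
    ∀ {v : ℝ}, ProjAt γ α β y v → |u - v| ≤ 4 * l + D * (k + 1) + 1000 * D * k := by
  have hD := h.one_le
  induction hr with
  | base l y hd =>
    intro v hy
    have := h.abs_sub_le_dist hx hy
    norm_num
    linarith
  | step k l m p q y _ hA hm ih =>
    intro v hy
    obtain ⟨v₁, hv₁⟩ := exists_projAt h.geodesic p
    obtain ⟨v₂, hv₂⟩ := exists_projAt h.geodesic q
    have e1 := ih hv₁
    have e2 : |v₁ - v₂| ≤ 1000 * D := by
      rcases hA with hA | hA
      · exact h.abs_sub_le_of_mem_antiContracting hX hA hv₁ hv₂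
      · rw [abs_sub_comm]
        exact h.abs_sub_le_of_mem_antiContracting hX hA hv₂ hv₁
    have e3 := h.abs_sub_le_dist hv₂ hy
    have e4 := _root_.abs_sub_le u v₁ v
    have e5 := _root_.abs_sub_le v₁ v₂ v
    push_cast
    linarith

/-- The projection to a contracting geodesic is coarsely Lipschitz for the metric of the contraction
space. -/
theorem abs_sub_le_cdist (hX : IsGeodesicSpace X) (h : ContractsAlong D γ α β) {x y : X} {u v : ℝ}
    (hx : ProjAt γ α β x u) (hy : ProjAt γ α β y v) : |u - v| ≤ 1002 * D * (cdist x y + 1) := by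
  have hD := h.one_le
  obtain ⟨k, l, hr, hlt⟩ := Attach.exists_reach (show cdist x y < cdist x y + 1 / 2 by linarith)
  have e1 := h.abs_sub_le_of_reach hX hr hx hy
  have hl := hr.nonneg
  have hk : (0 : ℝ) ≤ k := Nat.cast_nonneg k
  have h0 := cdist_nonneg x y
  have e2 : (k + l) * D ≤ (cdist x y + 1 / 2) * D := by gcongr
  have e3 : l * 1 ≤ l * D := by gcongr
  nlinarith

theorem abs_sub_le_cdist_self (hX : IsGeodesicSpace X) (h : ContractsAlong D γ α β) {s t : ℝ}
    (hs : s ∈ Icc α β) (ht : t ∈ Icc α β) : |s - t| ≤ 1002 * D * (cdist (γ s) (γ t) + 1) :=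
  h.abs_sub_le_cdist hX (.self hs) (.self ht)

end ContractsAlong

end Contraction

namespace Contraction

/-! ### Word lengths and orbit maps. -/

section Word

variable {G : Type*} [Group G]

/-- A subadditive function on a finitely generated group is bounded by a multiple of the word
length. -/
theorem exists_le_mul_wordLength (S : FinGenSet G) (f : G → ℝ) (h1 : f 1 ≤ 0)
    (hmul : ∀ g h, f (g * h) ≤ f g + f h) :
    ∃ Λ : ℝ, 1 ≤ Λ ∧ ∀ g, f g ≤ Λ * wordLength S.carrier g := by
  -- Generators and their inverses are bounded separately, since `f` need not be symmetric.
  obtain ⟨b, hb⟩ := (S.finite.image f).bddAbove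
  obtain ⟨b', hb'⟩ := (S.finite.image fun g => f g⁻¹).bddAbove
  set Λ := max 1 (max b b')
  refine ⟨Λ, le_max_left _ _, fun g => ?_⟩
  obtain ⟨l, hl, rfl, hn⟩ := exists_word S g
  rw [← hn]
  clear hn
  induction l with
  | nil => simpa using h1
  | cons s l ih =>
    have e1 := ih fun t ht => hl t (List.mem_cons_of_mem _ ht)
    have e2 : f s ≤ Λ := by
      rcases hl s List.mem_cons_self with h | h
      · exact (hb ⟨s, h, rfl⟩).trans ((le_max_left _ _).trans (le_max_right _ _))
      · have : f s⁻¹⁻¹ ≤ b' := hb' ⟨s⁻¹, h, rfl⟩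
        rw [inv_inv] at this
        exact this.trans ((le_max_right _ _).trans (le_max_right _ _))
    rw [List.prod_cons, List.length_cons]
    push_cast
    linarith [hmul s l.prod]

theorem exists_dist_smul_le (S : FinGenSet G) {Y : Type*} [PseudoMetricSpace Y] [MulAction G Y]
    [IsIsometricSMul G Y] (y : Y) : ∃ Λ : ℝ, 1 ≤ Λ ∧ ∀ g h : G,
      dist (g • y) (h • y) ≤ Λ * dist (WordSpace.mk g : WordSpace S) (WordSpace.mk h) := by
  obtain ⟨Λ, h1, h2⟩ := exists_le_mul_wordLength S (fun g => dist y (g • y)) (by simp)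
    (fun g h => by
      have := dist_triangle y (g • y) ((g * h) • y)
      rwa [mul_smul, dist_smul, ← mul_smul] at this)
  refine ⟨Λ, h1, fun g h => ?_⟩
  have := h2 (g⁻¹ * h)
  rwa [← dist_smul g, smul_smul, mul_inv_cancel_left] at this

theorem exists_dist_wordSpace_le (S T : FinGenSet G) : ∃ Λ : ℝ, 1 ≤ Λ ∧ ∀ g h : G,
    dist (WordSpace.mk g : WordSpace T) (WordSpace.mk h) ≤
      Λ * dist (WordSpace.mk g : WordSpace S) (WordSpace.mk h) := by
  obtain ⟨Λ, h1, h2⟩ := exists_le_mul_wordLength S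
    (fun g => dist (WordSpace.mk 1 : WordSpace T) (WordSpace.mk g)) (by rw [dist_self])
    (fun g h => by
      have e : dist (WordSpace.mk g : WordSpace T) (WordSpace.mk (g * h)) =
          dist (WordSpace.mk 1 : WordSpace T) (WordSpace.mk h) := by
        change ((wordLength T.carrier (g⁻¹ * (g * h)) : ℕ) : ℝ) = wordLength T.carrier (1⁻¹ * h)
        simp
      have := dist_triangle (WordSpace.mk 1 : WordSpace T) (WordSpace.mk g) (WordSpace.mk (g * h))
      rwa [e] at this)
  refine ⟨Λ, h1, fun g h => ?_⟩
  have := h2 (g⁻¹ * h)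
  have e : dist (WordSpace.mk 1 : WordSpace T) (WordSpace.mk (g⁻¹ * h)) =
      dist (WordSpace.mk g : WordSpace T) (WordSpace.mk h) := by
    change ((wordLength T.carrier (1⁻¹ * (g⁻¹ * h)) : ℕ) : ℝ) = wordLength T.carrier (g⁻¹ * h)
    simp
  rwa [e] at this

end Word

/-! ### Concatenating sequences of paths. -/

section PathSequence

variable {Y : Type*} [PseudoMetricSpace Y]

/-- Concatenation of a sequence of Lipschitz paths parametrized by unit intervals. -/
theorem exists_lipschitz_path {N : ℝ} (y : ℕ → Y)
    (hy : ∀ i, PathIn (fun _ => True) (y i) (y (i + 1)) N) :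
    ∃ f : ℝ → Y, (∀ i : ℕ, f i = y i) ∧
      ∀ s ∈ Ici (0 : ℝ), ∀ t ∈ Ici (0 : ℝ), dist (f s) (f t) ≤ N * |s - t| := by
  choose hN p hp hp0 hp1 _ using hy
  let f : ℝ → Y := fun t => p ⌊t⌋₊ (N * (t - ⌊t⌋₊))
  have hf : ∀ (i : ℕ), ∀ t ∈ Icc (i : ℝ) ((i + 1 : ℕ) : ℝ), f t = p i (N * (t - i)) := by
    intro i t ht
    rcases eq_or_lt_of_le ht.2 with h | h
    · subst h
      simp only [f, Nat.floor_natCast, sub_self, mul_zero, hp0]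
      push_cast
      rw [add_sub_cancel_left, mul_one, hp1]
    · have : ⌊t⌋₊ = i := by
        rw [Nat.floor_eq_iff (i.cast_nonneg.trans ht.1)]
        exact ⟨ht.1, by exact_mod_cast h⟩
      simp only [f, this]
  have hlip : ∀ n : ℕ, ∀ s ∈ Icc (0 : ℝ) n, ∀ t ∈ Icc (0 : ℝ) n, dist (f s) (f t) ≤ N * |s - t| := by
    intro n
    induction n with
    | zero =>
      intro s hs t ht
      simp only [Nat.cast_zero, Icc_self, mem_singleton_iff] at hs ht
      simp [hs, ht]
    | succ n ih =>
      refine lipschitz_glue n.cast_nonneg (by push_cast; linarith) ih ?_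
      intro s hs t ht
      rw [hf n s hs, hf n t ht]
      have hmem : ∀ u ∈ Icc (n : ℝ) ((n + 1 : ℕ) : ℝ), N * (u - n) ∈ Icc 0 N := by
        intro u hu
        have h1 := hu.1
        have h2 := hu.2
        push_cast at h2
        constructor
        · exact mul_nonneg (hN 0) (by linarith)
        · exact mul_le_of_le_one_right (hN 0) (by linarith)
      refine (hp n _ (hmem s hs) _ (hmem t ht)).trans ?_
      rw [← mul_sub, abs_mul, abs_of_nonneg (hN 0), sub_sub_sub_cancel_right]
  refine ⟨f, fun i => by simp [f, hp0], fun s hs t ht => ?_⟩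
  obtain ⟨n, hn⟩ := exists_nat_ge (max s t)
  exact hlip n s ⟨hs, (le_max_left _ _).trans hn⟩ t ⟨ht, (le_max_right _ _).trans hn⟩

end PathSequence

/-! ### Geodesics in Cayley graphs. -/

namespace CayleyGraph

variable {G : Type*} [Group G] (S : FinGenSet G)

theorem dist_le_one_of_mem {g h : G} (hs : g⁻¹ * h ∈ S.carrier ∨ (g⁻¹ * h)⁻¹ ∈ S.carrier) :
    dist (WordSpace.mk g : WordSpace S) (WordSpace.mk h) ≤ 1 := by
  have := wordLength_le (S := S.carrier) [g⁻¹ * h] (by simpa using hs)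
  rw [List.prod_singleton, List.length_singleton] at this
  have h' : (wordLength S.carrier (g⁻¹ * h) : ℝ) ≤ 1 := by exact_mod_cast this
  exact h'

/-- Edges create no shortcuts: word distance from a fixed vertex changes by at most one along each
of them. -/
theorem dist_vertex (g h : G) : dist (vertex S g) (vertex S h) =
    dist (WordSpace.mk g : WordSpace S) (WordSpace.mk h) := by
  refine le_antisymm (Attach.dist_incl_le _ _) ?_
  have := Attach.sub_le_dist_incl
    (A := {e : WordSpace S × WordSpace S | e.1.val⁻¹ * e.2.val ∈ S.carrier})
    (fun z => dist (WordSpace.mk g : WordSpace S) z)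
    (fun x y => by linarith [dist_triangle (WordSpace.mk g : WordSpace S) x y])
    (fun e he => by
      have h1 : dist e.1 e.2 ≤ 1 := dist_le_one_of_mem S (Or.inl he)
      have h2 := dist_triangle (WordSpace.mk g : WordSpace S) e.1 e.2
      have h3 := dist_triangle_right (WordSpace.mk g : WordSpace S) e.1 e.2
      rw [abs_le]
      constructor <;> linarith)
    (WordSpace.mk g) (WordSpace.mk h)
  rw [dist_self, sub_zero] at this
  exact this

theorem pathIn_edge {g h : G} (hs : g⁻¹ * h ∈ S.carrier ∨ (g⁻¹ * h)⁻¹ ∈ S.carrier) :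
    PathIn (fun _ => True) (vertex S g) (vertex S h) 1 := by
  have key : ∀ g h : G, g⁻¹ * h ∈ S.carrier →
      PathIn (fun _ => True) (vertex S g) (vertex S h) 1 := by
    intro g h hs
    have := Attach.pathIn_pt (⟨(WordSpace.mk g, WordSpace.mk h), hs⟩ :
      {e : WordSpace S × WordSpace S | e.1.val⁻¹ * e.2.val ∈ S.carrier})
      ⟨0, by simp⟩ ⟨1, by simp⟩
    rw [Attach.pt_zero, Attach.pt_one] at this
    simp only [zero_sub, abs_neg, abs_one] at this
    exact this
  rcases hs with hs | hs
  · exact key g h hs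
  · exact (key h g (by simpa using hs)).symm

/-- Vertices of the Cayley graph are joined by a geodesic passing through vertices at integer
times. -/
theorem exists_geodesic (g h : G) : ∃ (n : ℕ) (w : ℕ → G) (c : ℝ → CayleyGraph S),
    w 0 = g ∧ w n = h ∧ (∀ i : ℕ, c i = vertex S (w i)) ∧ IsGeodesic c (Icc 0 n) ∧
      (n : ℝ) = dist (WordSpace.mk g : WordSpace S) (WordSpace.mk h) := by
  obtain ⟨l, hl, hp, hn⟩ := exists_word S (g⁻¹ * h)
  set w : ℕ → G := fun i => g * (l.take i).prod with hw
  have hw0 : w 0 = g := by simp [hw]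
  have hwn : w l.length = h := by simp [hw, hp]
  have hstep : ∀ i, PathIn (fun _ => True) (vertex S (w i)) (vertex S (w (i + 1))) 1 := by
    intro i
    rcases lt_or_ge i l.length with hi | hi
    · refine pathIn_edge S ?_
      have : (w i)⁻¹ * w (i + 1) = l[i] := by
        simp [hw, List.prod_take_succ l i hi, mul_assoc]
      rw [this]
      exact hl _ (List.getElem_mem hi)
    · have : w (i + 1) = w i := by
        simp [hw, List.take_of_length_le hi, List.take_of_length_le (hi.trans i.le_succ)]
      rw [this]
      exact (PathIn.refl trivial).extend zero_le_one
  obtain ⟨c, hc, hlip⟩ := exists_lipschitz_path (fun i => vertex S (w i)) hstep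
  have hlen : (l.length : ℝ) = dist (WordSpace.mk g : WordSpace S) (WordSpace.mk h) := by
    rw [hn]; rfl
  refine ⟨l.length, w, c, hw0, hwn, hc, ?_, hlen⟩
  refine isGeodesic_of_lipschitz (Nat.cast_nonneg _) (fun s hs t ht => ?_) ?_
  · simpa using hlip s hs.1 t ht.1
  · have h0 : c 0 = vertex S g := by rw [← hw0, ← hc 0]; simp
    rw [hc, h0, hwn, dist_vertex, hlen, sub_zero]

theorem pathIn_vertex (g h : G) : PathIn (fun _ => True) (vertex S g) (vertex S h)
    (dist (WordSpace.mk g : WordSpace S) (WordSpace.mk h)) := by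
  obtain ⟨n, w, c, h0, hn, hc, hg, hd⟩ := exists_geodesic S g h
  have := PathIn.of_lipschitz (P := fun _ => True) n.cast_nonneg hg.lipschitz fun _ _ => trivial
  have h0' := hc 0
  rw [Nat.cast_zero] at h0'
  rwa [hc, h0', h0, hn, sub_zero, hd] at this

end CayleyGraph

/-! ### The Milnor–Schwarz lemma. -/

section MilnorSchwarz

variable {G : Type*} [Group G] {X : Type*} [MetricSpace X] [MulAction G X] [IsIsometricSMul G X]

/-- `x₀` is a base point whose orbit map is a quasi-isometry from the word metric of `S` to `X`, with
constants `Λ` and `R`. -/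
structure OrbitQI (S : FinGenSet G) (x₀ : X) (Λ R : ℝ) : Prop where
  one_le : 1 ≤ Λ
  nonneg : 0 ≤ R
  upper : ∀ g h : G, dist (g • x₀) (h • x₀) ≤
    Λ * dist (WordSpace.mk g : WordSpace S) (WordSpace.mk h)
  lower : ∀ g h : G, dist (WordSpace.mk g : WordSpace S) (WordSpace.mk h) ≤
    Λ * (dist (g • x₀) (h • x₀) + 1)
  dense : ∀ z : X, ∃ g : G, dist z (g • x₀) ≤ R

theorem exists_wordLength_bound (hG : IsGeometricAction G X) (S : FinGenSet G) (x₀ : X) (R : ℝ) :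
    ∃ N : ℝ, 0 ≤ N ∧ ∀ g h : G, dist (g • x₀) (h • x₀) ≤ R →
      dist (WordSpace.mk g : WordSpace S) (WordSpace.mk h) ≤ N := by
  obtain ⟨N, hN⟩ := ((hG.proper x₀ R).image fun g => (wordLength S.carrier g : ℝ)).bddAbove
  refine ⟨max N 0, le_max_right _ _, fun g h hd => ?_⟩
  refine le_trans (hN ⟨g⁻¹ * h, ?_, rfl⟩) (le_max_left _ _)
  rw [← dist_smul g⁻¹, inv_smul_smul, smul_smul] at hd
  exact hd

/-- The Milnor–Schwarz lemma. -/
theorem exists_orbitQI (hG : IsGeometricAction G X) (hX : IsGeodesicSpace X) (S : FinGenSet G)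
    (x₀ : X) : ∃ Λ R : ℝ, OrbitQI S x₀ Λ R := by
  obtain ⟨y, R₀, hR₀⟩ := hG.cobounded
  set R := R₀ + dist y x₀ with hRdef
  have hdense : ∀ z : X, ∃ g : G, dist z (g • x₀) ≤ R := by
    intro z
    obtain ⟨g, hg⟩ := hR₀ z
    refine ⟨g, ?_⟩
    have := dist_triangle z (g • y) (g • x₀)
    rw [dist_smul] at this
    linarith
  have hR : 0 ≤ R := by
    obtain ⟨g, hg⟩ := hdense x₀
    exact dist_nonneg.trans hg
  obtain ⟨Λ, hΛ, hup⟩ := exists_dist_smul_le S x₀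
  obtain ⟨N, hN, hbound⟩ := exists_wordLength_bound hG S x₀ (2 * R + 1)
  have hlow : ∀ g h : G, dist (WordSpace.mk g : WordSpace S) (WordSpace.mk h) ≤
      (2 * N) * (dist (g • x₀) (h • x₀) + 1) := by
    intro g h
    obtain ⟨σ, hσ⟩ := hX (g • x₀) (h • x₀)
    obtain ⟨γ, hγ, h0, h1, -⟩ := hσ.exists_geodesic
    set d := dist (g • x₀) (h • x₀) with hd
    have hd0 : 0 ≤ d := dist_nonneg
    -- The extra one keeps `n` positive, so prescribing `g` at index 0 and `h` from index `n` on is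
    -- consistent.
    set n := ⌈d⌉₊ + 1 with hn
    choose e he using fun i : ℕ => hdense (γ (min i d))
    let w : ℕ → G := fun i => if i = 0 then g else if n ≤ i then h else e i
    have hw : ∀ i : ℕ, dist (γ (min i d)) (w i • x₀) ≤ R := by
      intro i
      simp only [w]
      split_ifs with h2 h3
      · simp [h2, hd0, h0, hR]
      · have : d ≤ i := (Nat.le_ceil d).trans (by exact_mod_cast (Nat.le_succ _).trans h3)
        simp [this, h1, hR]
      · exact he i
    have hw0 : w 0 = g := by simp [w]
    have hwn : w n = h := by simp [w, hn]
    have hmem : ∀ i : ℕ, min (i : ℝ) d ∈ Icc 0 d := fun i =>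
      ⟨le_min i.cast_nonneg hd0, min_le_right _ _⟩
    have hs : ∀ i, dist (WordSpace.mk (w i) : WordSpace S) (WordSpace.mk (w (i + 1))) ≤ N := by
      intro i
      refine hbound _ _ ?_
      have e1 := hγ.lipschitz _ (hmem i) _ (hmem (i + 1))
      have e2 : |min (i : ℝ) d - min ((i + 1 : ℕ) : ℝ) d| ≤ 1 := by
        refine (abs_min_sub_min_le_max _ _ _ _).trans ?_
        simp
      have e3 := dist_triangle4 (w i • x₀) (γ (min i d)) (γ (min ((i + 1 : ℕ) : ℝ) d))
        (w (i + 1) • x₀)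
      rw [dist_comm (w i • x₀) (γ _)] at e3
      linarith [hw i, hw (i + 1)]
    have := dist_le_range_sum_of_dist_le (f := fun i => (WordSpace.mk (w i) : WordSpace S)) n
      (d := fun _ => N) fun _ => hs _
    simp only [hw0, hwn, Finset.sum_const, Finset.card_range, nsmul_eq_mul] at this
    refine this.trans ?_
    have hnd : (n : ℝ) ≤ 2 * (d + 1) := by
      rw [hn]
      push_cast
      linarith [Nat.ceil_lt_add_one hd0]
    nlinarith
  refine ⟨max Λ (2 * N), R, hΛ.trans (le_max_left _ _), hR, fun g h => (hup g h).trans ?_,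
    fun g h => (hlow g h).trans ?_, hdense⟩
  · exact mul_le_mul_of_nonneg_right (le_max_left _ _) dist_nonneg
  · exact mul_le_mul_of_nonneg_right (le_max_right _ _) (by positivity)

end MilnorSchwarz

/-! ### Tracing quasi-geodesics of the space in the Cayley graph. -/

section Tracing

variable {G : Type*} [Group G] {X : Type*} [MetricSpace X] [MulAction G X]

/-- A quasi-geodesic of `X` is traced by a continuous quasi-geodesic of the Cayley graph. -/
theorem OrbitQI.exists_quasiGeodesic {S : FinGenSet G} {x₀ : X} {Λ R : ℝ}
    (hQ : OrbitQI S x₀ Λ R) {C R' : ℝ} (hC : 1 ≤ C) (hR' : R ≤ R') :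
    ∃ C' : ℝ, 1 ≤ C' ∧ ∀ (lam : ℝ → X) (a b : ℝ), a ≤ b →
      (∀ s ∈ Icc a b, ∀ t ∈ Icc a b,
        |t - s| / C - C ≤ dist (lam s) (lam t) ∧ dist (lam s) (lam t) ≤ C * |t - s| + C) →
      ∀ g h : G, dist (lam a) (g • x₀) ≤ R' → dist (lam b) (h • x₀) ≤ R' →
        ∃ (q : ℝ → CayleyGraph S) (L : ℝ), 0 ≤ L ∧ IsQuasiGeodesic C' q (Icc 0 L) ∧
          q 0 = CayleyGraph.vertex S g ∧ q L = CayleyGraph.vertex S h ∧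
          ∀ t ∈ Icc a b, ∃ s ∈ Icc 0 L, ∃ k : G, q s = CayleyGraph.vertex S k ∧
            dist (lam t) (k • x₀) ≤ C' := by
  have hΛ := hQ.one_le
  have hR0 := hQ.nonneg.trans hR'
  set N := Λ * (2 * C + 2 * R' + 1) with hN
  have hN1 : 2 * C + 2 * R' + 1 ≤ N := le_mul_of_one_le_left (by linarith) hΛ
  -- Additive error of the lower bound: `2 * N` for rounding to integer times, `2 * R'` for orbit
  -- points and `C` for `lam`; the final 3 and one more absorb the time lost by sampling.
  set K := C * (Λ * (2 * N) + 2 * R' + C) + 3 with hK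
  have hCΛ : 1 ≤ C * Λ := one_le_mul_of_one_le_of_one_le hC hΛ
  have hK0 : 0 ≤ K := by
    have : 0 ≤ Λ * (2 * N) := mul_nonneg (by linarith) (by linarith)
    have : 0 ≤ C * (Λ * (2 * N) + 2 * R' + C) := mul_nonneg (by linarith) (by linarith)
    linarith
  set C' := C * Λ + K + N with hC'
  refine ⟨C', by linarith, fun lam a b hab hlam g h hg hh => ?_⟩
  set n := ⌈b - a⌉₊ + 1 with hn
  have hnb : b - a ≤ n := (Nat.le_ceil _).trans (by simp [hn])
  have hnb' : (n : ℝ) ≤ b - a + 2 := by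
    rw [hn]; push_cast; linarith [Nat.ceil_lt_add_one (sub_nonneg.2 hab)]
  let τ : ℕ → ℝ := fun i => min (a + i) b
  have hτ : ∀ i, τ i ∈ Icc a b := fun i => ⟨le_min (by simp) hab, min_le_right _ _⟩
  have hτ1 : ∀ i, |τ (i + 1) - τ i| ≤ 1 := by
    intro i
    refine (abs_min_sub_min_le_max _ _ _ _).trans ?_
    simp
  choose e he using fun i : ℕ => hQ.dense (lam (τ i))
  let w : ℕ → G := fun i => if i = 0 then g else if n ≤ i then h else e i
  have hw : ∀ i, dist (lam (τ i)) (w i • x₀) ≤ R' := by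
    intro i
    simp only [w]
    split_ifs with h2 h3
    · simpa [τ, h2, hab] using hg
    · have : b ≤ a + i := by
        have : (n : ℝ) ≤ i := by exact_mod_cast h3
        linarith
      simpa [τ, this] using hh
    · exact (he i).trans hR'
  have hw0 : w 0 = g := by simp [w]
  have hwn : w n = h := by simp [w, hn]
  have hstep : ∀ i, PathIn (fun _ => True) (CayleyGraph.vertex S (w i))
      (CayleyGraph.vertex S (w (i + 1))) N := by
    intro i
    refine (CayleyGraph.pathIn_vertex S _ _).extend ((hQ.lower _ _).trans ?_)
    refine mul_le_mul_of_nonneg_left ?_ (by linarith)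
    have e1 := (hlam _ (hτ i) _ (hτ (i + 1))).2
    have e2 : C * |τ (i + 1) - τ i| ≤ C := mul_le_of_le_one_right (by linarith) (hτ1 i)
    have e3 := dist_triangle4 (w i • x₀) (lam (τ i)) (lam (τ (i + 1))) (w (i + 1) • x₀)
    rw [dist_comm (w i • x₀) (lam _)] at e3
    linarith [hw i, hw (i + 1)]
  obtain ⟨q, hq, hlip⟩ := exists_lipschitz_path _ hstep
  refine ⟨q, n, n.cast_nonneg, ⟨?_, ?_⟩, ?_, by rw [hq, hwn], ?_⟩
  · have : LipschitzOnWith N.toNNReal q (Icc 0 n) := LipschitzOnWith.of_dist_le_mul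
      fun s hs t ht => by
        rw [Real.coe_toNNReal _ (by linarith), Real.dist_eq]
        exact hlip s hs.1 t ht.1
    exact this.continuousOn
  · intro s hs t ht
    have hup := hlip s hs.1 t ht.1
    rw [abs_sub_comm] at hup
    have h0 := abs_nonneg (t - s)
    constructor
    · have hfl : ∀ u ∈ Icc (0 : ℝ) n, |u - ⌊u⌋₊| ≤ 1 ∧ -2 ≤ τ ⌊u⌋₊ - (a + ⌊u⌋₊) ∧
          τ ⌊u⌋₊ - (a + ⌊u⌋₊) ≤ 0 := by
        intro u hu
        have h1 := Nat.floor_le hu.1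
        have h2 := Nat.lt_floor_add_one u
        refine ⟨by rw [abs_le]; constructor <;> linarith, ?_, ?_⟩
        · have : a + ⌊u⌋₊ - 2 ≤ τ ⌊u⌋₊ := le_min (by linarith) (by linarith [hu.2])
          linarith
        · linarith [min_le_left (a + (⌊u⌋₊ : ℝ)) b]
      obtain ⟨s1, s2, s3⟩ := hfl s hs
      obtain ⟨t1, t2, t3⟩ := hfl t ht
      set i := ⌊s⌋₊
      set j := ⌊t⌋₊
      have hts : |t - s| ≤ |τ j - τ i| + 4 := by
        rw [abs_le] at s1 t1
        have h1 := le_abs_self (τ j - τ i)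
        have h2 := neg_abs_le (τ j - τ i)
        rw [abs_le]
        constructor <;> linarith
      have e1 := (hlam _ (hτ i) _ (hτ j)).1
      rw [sub_le_iff_le_add, div_le_iff₀ (by linarith)] at e1
      have e2 := dist_triangle4 (lam (τ i)) (w i • x₀) (w j • x₀) (lam (τ j))
      rw [dist_comm (w j • x₀) (lam _)] at e2
      have e3 := hQ.upper (w i) (w j)
      rw [← CayleyGraph.dist_vertex, ← hq, ← hq] at e3
      have e4 := dist_triangle4 (q i) (q s) (q t) (q j)
      have e5 := hlip i (mem_Ici.2 i.cast_nonneg) s hs.1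
      have e6 := hlip t ht.1 j (mem_Ici.2 j.cast_nonneg)
      rw [abs_sub_comm] at e5
      have e7 : N * |s - i| ≤ N := mul_le_of_le_one_right (by linarith) s1
      have e8 : N * |t - j| ≤ N := mul_le_of_le_one_right (by linarith) t1
      have e9 : Λ * dist (q i) (q j) ≤ Λ * (dist (q s) (q t) + 2 * N) :=
        mul_le_mul_of_nonneg_left (by linarith) (by linarith)
      have e10 : (dist (lam (τ i)) (lam (τ j)) + C) * C ≤
          (Λ * (dist (q s) (q t) + 2 * N) + 2 * R' + C) * C :=
        mul_le_mul_of_nonneg_right (by linarith [hw i, hw j]) (by linarith)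
      have e11 : |t - s| ≤ C * Λ * dist (q s) (q t) + (K + 1) := by
        have : (Λ * (dist (q s) (q t) + 2 * N) + 2 * R' + C) * C =
          C * Λ * dist (q s) (q t) + C * (Λ * (2 * N) + 2 * R' + C) := by ring
        linarith
      have hd0 := dist_nonneg (x := q s) (y := q t)
      have e12 : C * Λ * dist (q s) (q t) ≤ C' * dist (q s) (q t) :=
        mul_le_mul_of_nonneg_right (by linarith) hd0
      have e13 : C' * 1 ≤ C' * C' := mul_le_mul_of_nonneg_left (by linarith) (by linarith)
      rw [sub_le_iff_le_add, div_le_iff₀ (by linarith)]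
      linarith
    · have : N * |t - s| ≤ C' * |t - s| := mul_le_mul_of_nonneg_right (by linarith) h0
      linarith
  · have := hq 0
    rwa [Nat.cast_zero, hw0] at this
  · intro t ht
    have hta : 0 ≤ t - a := by linarith [ht.1]
    have h1 := Nat.floor_le hta
    have h2 := Nat.lt_floor_add_one (t - a)
    set i := ⌊t - a⌋₊
    refine ⟨i, ⟨i.cast_nonneg, by linarith [ht.2]⟩, w i, hq i, ?_⟩
    have hi : τ i = a + i := min_eq_left (by linarith [ht.2])
    have e1 := (hlam t ht _ (hτ i)).2
    have e2 : C * |τ i - t| ≤ C := mul_le_of_le_one_right (by linarith) (by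
      rw [hi, abs_le]; constructor <;> linarith)
    linarith [hw i, dist_triangle (lam t) (lam (τ i)) (w i • x₀)]

end Tracing

end Contraction

namespace Contraction

/-! ### Morse geodesics from stable subgroups. -/

section Stable

variable {G : Type*} [Group G] {X : Type*} [MetricSpace X] [MulAction G X]

/-- Quasi-geodesics of `X` with endpoints near the orbit of a Morse geodesic of the Cayley graph
stay near that orbit. -/
theorem OrbitQI.exists_near_of_isMorse {S : FinGenSet G} {x₀ : X} {Λ R : ℝ}
    (hQ : OrbitQI S x₀ Λ R) {M : ℝ → ℝ → ℝ} {C R' : ℝ} (hC : 1 ≤ C)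
    (hR' : R ≤ R') :
    ∃ B : ℝ, ∀ (n : ℕ) (w : ℕ → G) (c : ℝ → CayleyGraph S),
      (∀ i : ℕ, c i = CayleyGraph.vertex S (w i)) → IsGeodesic c (Icc 0 n) →
      IsMorse M (c '' Icc 0 n) → ∀ (lam : ℝ → X) (a b : ℝ), a ≤ b →
      (∀ s ∈ Icc a b, ∀ t ∈ Icc a b,
        |t - s| / C - C ≤ dist (lam s) (lam t) ∧ dist (lam s) (lam t) ≤ C * |t - s| + C) →
      ∀ i ≤ n, ∀ j ≤ n, dist (lam a) (w i • x₀) ≤ R' → dist (lam b) (w j • x₀) ≤ R' →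
        ∀ t ∈ Icc a b, ∃ k ≤ n, dist (lam t) (w k • x₀) ≤ B := by
  obtain ⟨C', hC', h⟩ := hQ.exists_quasiGeodesic hC hR'
  have hΛ := hQ.one_le
  -- One unit is for nearly realizing the distance to the geodesic, another for rounding to a
  -- vertex.
  refine ⟨C' + Λ * (M C' C' + 2), ?_⟩
  intro n w c hc hg hM lam a b hab hlam i hi j hj hia hjb t ht
  obtain ⟨q, L, hL, hq, hq0, hqL, htr⟩ := h lam a b hab hlam (w i) (w j) hia hjb
  obtain ⟨s, hs, k, hk, hd⟩ := htr t ht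
  have hmem : ∀ m : ℕ, m ≤ n → CayleyGraph.vertex S (w m) ∈ c '' Icc (0 : ℝ) n := fun m hm =>
    ⟨m, ⟨m.cast_nonneg, by exact_mod_cast hm⟩, hc m⟩
  have h1 := hM C' hC' q 0 L hL hq (by rw [hq0]; exact hmem i hi) (by rw [hqL]; exact hmem j hj) s hs
  obtain ⟨_, ⟨u, hu, rfl⟩, hdu⟩ := (Metric.infDist_lt_iff ⟨_, hmem i hi⟩).1
    (lt_of_le_of_lt h1 (lt_add_one _))
  have h2 := Nat.floor_le hu.1
  have h3 := Nat.lt_floor_add_one u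
  have hfl : ⌊u⌋₊ ≤ n := Nat.floor_le_of_le hu.2
  refine ⟨⌊u⌋₊, hfl, ?_⟩
  have e1 := hg.lipschitz u hu ⌊u⌋₊ ⟨Nat.cast_nonneg _, by exact_mod_cast hfl⟩
  rw [abs_of_nonneg (by linarith)] at e1
  have e2 := dist_triangle (q s) (c u) (c ⌊u⌋₊)
  have e3 := hQ.upper k (w ⌊u⌋₊)
  rw [← CayleyGraph.dist_vertex, ← hk, ← hc] at e3
  have e4 : Λ * dist (q s) (c ⌊u⌋₊) ≤ Λ * (M C' C' + 2) :=
    mul_le_mul_of_nonneg_left (by linarith) (by linarith)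
  linarith [dist_triangle (lam t) (k • x₀) (w ⌊u⌋₊ • x₀)]

/-- Geodesics of `X` between points of an orbit of a stable subgroup are uniformly Morse. -/
theorem OrbitQI.exists_morseGauge {S : FinGenSet G} {x₀ : X} {Λ R : ℝ} (hQ : OrbitQI S x₀ Λ R)
    {H : Subgroup G} {M : ℝ → ℝ → ℝ}
    (hM : ∀ h ∈ H, ∀ k ∈ H, ∀ (γ : ℝ → CayleyGraph S) (L : ℝ), 0 ≤ L → IsGeodesic γ (Icc 0 L) →
      γ 0 = CayleyGraph.vertex S h → γ L = CayleyGraph.vertex S k → IsMorse M (γ '' Icc 0 L)) :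
    ∃ M' : ℝ → ℝ → ℝ, IsMorseGauge M' ∧ ∀ h ∈ H, ∀ k ∈ H, ∀ (γ : ℝ → X) (L : ℝ), 0 ≤ L →
      IsGeodesic γ (Icc 0 L) → γ 0 = h • x₀ → γ L = k • x₀ → IsMorse M' (γ '' Icc 0 L) := by
  have hΛ := hQ.one_le
  obtain ⟨B₁, hB₁⟩ := hQ.exists_near_of_isMorse (M := M) le_rfl le_rfl
  set R₁ := max B₁ R with hR₁
  set B₂ := B₁ + Λ * (Λ * (2 * B₁ + 1)) with hB₂
  have key : ∀ C : ℝ, 1 ≤ C → ∃ B : ℝ, 0 ≤ B ∧ ∀ h ∈ H, ∀ k ∈ H, ∀ (γ : ℝ → X) (L : ℝ), 0 ≤ L →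
      IsGeodesic γ (Icc 0 L) → γ 0 = h • x₀ → γ L = k • x₀ →
      ∀ (lam : ℝ → X) (a b : ℝ), a ≤ b → IsQuasiGeodesic C lam (Icc a b) →
      lam a ∈ γ '' Icc 0 L → lam b ∈ γ '' Icc 0 L →
      ∀ t ∈ Icc a b, Metric.infDist (lam t) (γ '' Icc 0 L) ≤ B := by
    intro C hC
    obtain ⟨B₃, hB₃⟩ := hQ.exists_near_of_isMorse (M := M) hC (le_max_right B₁ R)
    refine ⟨max 0 (B₃ + B₂), le_max_left _ _, ?_⟩
    intro h hh k hk γ L hL hγ h0 h1 lam a b hab hlam ha hb t ht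
    obtain ⟨n, w, c, hw0, hwn, hc, hg, -⟩ := CayleyGraph.exists_geodesic S h k
    have hMc : IsMorse M (c '' Icc 0 n) := hM h hh k hk c n n.cast_nonneg hg
      (by rw [← hw0, ← hc]; simp) (by rw [hc, hwn])
    have hγw : ∀ t ∈ Icc 0 L, ∃ i ≤ n, dist (γ t) (w i • x₀) ≤ B₁ :=
      hB₁ n w c hc hg hMc γ 0 L hL (fun s hs t ht => by
        rw [hγ.dist_eq s hs t ht, abs_sub_comm]
        constructor <;> linarith) 0 n.zero_le n le_rfl
        (by rw [h0, hw0, dist_self]; exact hQ.nonneg) (by rw [h1, hwn, dist_self]; exact hQ.nonneg)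
    have hB₁0 : 0 ≤ B₁ := by
      obtain ⟨i, -, hi⟩ := hγw 0 ⟨le_rfl, hL⟩
      exact dist_nonneg.trans hi
    have hww : ∀ i ≤ n, ∀ j ≤ n, dist (WordSpace.mk (w i) : WordSpace S) (WordSpace.mk (w j)) =
        |(i : ℝ) - j| := by
      intro i hi j hj
      rw [← CayleyGraph.dist_vertex, ← hc, ← hc]
      exact hg.dist_eq _ ⟨i.cast_nonneg, by exact_mod_cast hi⟩ _
        ⟨j.cast_nonneg, by exact_mod_cast hj⟩
    -- The converse closeness. By connectedness of `[0, L]`, some point of `γ` is near orbit points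
    -- with indices both at most and at least `j`. These indices are boundedly close, hence both
    -- close to `j`.
    have hwγ : ∀ j ≤ n, ∃ t ∈ Icc 0 L, dist (w j • x₀) (γ t) ≤ B₂ := by
      intro j hj
      have hclosed : ∀ I : Set ℕ, I.Finite →
          IsClosed {t | t ∈ Icc 0 L ∧ ∃ i ∈ I, dist (γ t) (w i • x₀) ≤ B₁} := by
        intro I hI
        have : {t | t ∈ Icc 0 L ∧ ∃ i ∈ I, dist (γ t) (w i • x₀) ≤ B₁} =
            ⋃ i ∈ I, Icc 0 L ∩ (fun t => dist (γ t) (w i • x₀)) ⁻¹' Iic B₁ := by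
          ext t
          simp only [mem_ofPred_eq, mem_iUnion, mem_inter_iff, mem_preimage, mem_Iic]
          tauto
        rw [this]
        refine hI.isClosed_biUnion fun i _ => ?_
        have hcont := hγ.continuousOn
        have : ContinuousOn (fun t => dist (γ t) (w i • x₀)) (Icc 0 L) := by fun_prop
        exact this.preimage_isClosed_of_isClosed isClosed_Icc isClosed_Iic
      obtain ⟨t, ht, ⟨-, i₁, hi₁, hd₁⟩, ⟨-, i₂, hi₂, hd₂⟩⟩ :=
        (isPreconnected_closed_iff.1 (isPreconnected_Icc (a := (0 : ℝ)) (b := L))) _ _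
          (hclosed (Icc 0 j) (finite_Icc _ _)) (hclosed (Icc j n) (finite_Icc _ _))
          (by
            intro t ht
            obtain ⟨i, hi, hd⟩ := hγw t ht
            rcases le_total i j with hij | hij
            · exact Or.inl ⟨ht, i, ⟨i.zero_le, hij⟩, hd⟩
            · exact Or.inr ⟨ht, i, ⟨hij, hi⟩, hd⟩)
          ⟨0, ⟨le_rfl, hL⟩, ⟨le_rfl, hL⟩, 0, ⟨le_rfl, j.zero_le⟩, by rwa [h0, hw0, dist_self]⟩
          ⟨L, ⟨hL, le_rfl⟩, ⟨hL, le_rfl⟩, n, ⟨hj, le_rfl⟩, by rwa [h1, hwn, dist_self]⟩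
      refine ⟨t, ht, ?_⟩
      have hi₁n := hi₁.2.trans hj
      have hc₁ : (i₁ : ℝ) ≤ j := by exact_mod_cast hi₁.2
      have hc₂ : (j : ℝ) ≤ i₂ := by exact_mod_cast hi₂.1
      have e1 := hQ.lower (w i₁) (w i₂)
      rw [hww _ hi₁n _ hi₂.2, abs_of_nonpos (by linarith)] at e1
      have e2 := dist_triangle_left (w i₁ • x₀) (w i₂ • x₀) (γ t)
      have e3 : Λ * (dist (w i₁ • x₀) (w i₂ • x₀) + 1) ≤ Λ * (2 * B₁ + 1) :=
        mul_le_mul_of_nonneg_left (by linarith) (by linarith)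
      have e4 := hQ.upper (w j) (w i₁)
      rw [hww _ hj _ hi₁n, abs_of_nonneg (by linarith)] at e4
      have e5 : Λ * ((j : ℝ) - i₁) ≤ Λ * (Λ * (2 * B₁ + 1)) :=
        mul_le_mul_of_nonneg_left (by linarith) (by linarith)
      have e6 := dist_triangle_right (w j • x₀) (γ t) (w i₁ • x₀)
      linarith
    obtain ⟨ta, hta, hlama⟩ := ha
    obtain ⟨tb, htb, hlamb⟩ := hb
    obtain ⟨i, hi, hid⟩ := hγw ta hta
    obtain ⟨j, hj, hjd⟩ := hγw tb htb
    obtain ⟨m, hm, hmd⟩ := hB₃ n w c hc hg hMc lam a b hab hlam.2 i hi j hj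
      (by rw [← hlama]; exact hid.trans (le_max_left _ _))
      (by rw [← hlamb]; exact hjd.trans (le_max_left _ _)) t ht
    obtain ⟨t', ht', hd'⟩ := hwγ m hm
    refine (Metric.infDist_le_dist_of_mem (mem_image_of_mem γ ht')).trans (le_trans ?_ (le_max_right _ _))
    linarith [dist_triangle (lam t) (w m • x₀) (γ t')]
  choose! B hB0 hB using key
  -- Morseness only evaluates the gauge on the diagonal, so it can be constant in the second
  -- variable.
  refine ⟨fun C _ => B C, ⟨fun K hK _ _ => hB0 K hK, fun K _ => monotoneOn_const,
    fun K _ => continuousOn_const⟩, ?_⟩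
  intro h hh k hk γ L hL hγ h0 h1 C hC lam a b hab hlam ha hb t ht
  exact hB C hC h hh k hk γ L hL hγ h0 h1 lam a b hab hlam ha hb t ht

end Stable

/-! ### Orbit maps of stable subgroups and acylindricity. -/

section Recognizing

variable {G : Type*} [Group G] {X : Type*} [MetricSpace X] [MulAction G X] [IsIsometricSMul G X]

/-- In a Morse-dichotomous space, geodesics between points of an orbit of a stable subgroup are
uniformly contracting. -/
theorem exists_contractsAlong (hG : IsGeometricAction G X) (hX : IsMorseDichotomous X)
    {H : Subgroup G} (hH : IsStable H) (x₀ : X) :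
    ∃ D : ℝ, 1 ≤ D ∧ ∀ h ∈ H, ∀ k ∈ H, ∀ (γ : ℝ → X) (L : ℝ), 0 ≤ L →
      IsGeodesic γ (Icc 0 L) → γ 0 = h • x₀ → γ L = k • x₀ → ContractsAlong D γ 0 L := by
  obtain ⟨S, T, -, M, -, hM⟩ := hH
  obtain ⟨Λ, R, hQ⟩ := exists_orbitQI hG hX.1 S x₀
  obtain ⟨M', hM', hmorse⟩ := hQ.exists_morseGauge hM
  obtain ⟨C, -, hC⟩ := hX.2 M' hM'
  refine ⟨max 1 C, le_max_left _ _, fun h hh k hk γ L hL hγ h0 h1 => ?_⟩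
  refine IsContracting.contractsAlong ?_ (le_max_left _ _) hγ
  intro x y hy z hz p hp q hq
  exact (hC γ _ hγ (hmorse h hh k hk γ L hL hγ h0 h1) x y hy z hz p hp q hq).trans
    (le_max_right _ _)

/-- The inclusion of `X` into its contraction space. -/
def toContractionSpace (x : X) : ContractionSpace X := Attach.incl _ x

theorem dist_toContractionSpace (x y : X) :
    dist (toContractionSpace x) (toContractionSpace y) = cdist x y := rfl

theorem smul_toContractionSpace (g : G) (x : X) :
    g • toContractionSpace x = toContractionSpace (g • x) := rfl

theorem cdist_smul (g : G) (x y : X) : cdist (g • x) (g • y) = cdist x y := by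
  rw [← dist_toContractionSpace, ← smul_toContractionSpace, ← smul_toContractionSpace, dist_smul,
    dist_toContractionSpace]

theorem dist_smul_toContractionSpace (g h : G) (x : X) :
    dist (g • toContractionSpace x) (h • toContractionSpace x) = cdist (g • x) (h • x) := rfl

theorem exists_dist_toContractionSpace_le (p : ContractionSpace X) :
    ∃ x : X, dist p (toContractionSpace x) ≤ 1 / 2 := Attach.exists_dist_incl_le p

theorem isRecognizingSpaceFor (hG : IsGeometricAction G X) (hX : IsMorseDichotomous X)
    {H : Subgroup G} (hH : IsStable H) : IsRecognizingSpaceFor G (ContractionSpace X) H := by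
  intro T' p
  obtain ⟨x₀, hx₀⟩ := exists_dist_toContractionSpace_le p
  obtain ⟨D, hD, hcontr⟩ := exists_contractsAlong hG hX hH x₀
  obtain ⟨S, T, ⟨Q, hQ1, hQ⟩, -⟩ := hH
  obtain ⟨Λ, R, hO⟩ := exists_orbitQI hG hX.1 S x₀
  obtain ⟨Λ₁, hΛ₁, hT'⟩ := exists_dist_wordSpace_le T T'
  have : IsIsometricSMul H (ContractionSpace X) := ⟨fun h => isometry_smul _ (h : G)⟩
  obtain ⟨Λ₂, hΛ₂, hup⟩ := exists_dist_smul_le T' p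
  have hΛ := hO.one_le
  set K := 1002 * D with hK
  set A := Λ₁ * Q * Λ * K with hA
  have hA1 : 1 ≤ A := one_le_mul_of_one_le_of_one_le (one_le_mul_of_one_le_of_one_le
    (one_le_mul_of_one_le_of_one_le hΛ₁ hQ1) hΛ) (by linarith)
  set E := A * 2 + Λ₁ * Q * Λ + Λ₁ * Q * Q with hE
  have hE0 : 0 ≤ E := by positivity
  refine ⟨A + E + Λ₂, by linarith, fun x y => ⟨?_, ?_⟩⟩
  · obtain ⟨σ, hσ⟩ := hX.1 ((x.val : G) • x₀) ((y.val : G) • x₀)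
    obtain ⟨γ, hγ, h0, h1, -⟩ := hσ.exists_geodesic
    set L := dist ((x.val : G) • x₀) ((y.val : G) • x₀) with hL
    have hc := hcontr _ x.val.2 _ y.val.2 γ L dist_nonneg hγ h0 h1
    -- The essential lower bound: distance along a contracting geodesic is controlled by `cdist` of
    -- its ends. The rest compares word metrics and base points.
    have e1 := hc.abs_sub_le_cdist_self hX.1 (s := L) (t := 0) ⟨dist_nonneg, le_rfl⟩
      ⟨le_rfl, dist_nonneg⟩
    rw [sub_zero, abs_of_nonneg dist_nonneg, h0, h1, cdist_comm, ← dist_smul_toContractionSpace] at e1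
    have e2 := dist_triangle4 ((x.val : G) • toContractionSpace x₀)
      ((x.val : G) • p) ((y.val : G) • p) ((y.val : G) • toContractionSpace x₀)
    rw [dist_smul, dist_smul, dist_comm (toContractionSpace x₀) p] at e2
    set d := dist ((x.val : G) • p) ((y.val : G) • p) with hd
    have hd0 : 0 ≤ d := dist_nonneg
    have e3 := hO.lower (x.val : G) (y.val : G)
    have e4 := (hQ (WordSpace.mk x.val) (WordSpace.mk y.val)).1
    rw [sub_le_iff_le_add, div_le_iff₀ (by linarith)] at e4
    have e5 := hT' x.val y.val
    have f1 : L ≤ K * (d + 2) := e1.trans (mul_le_mul_of_nonneg_left (by linarith) (by linarith))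
    have f2 : dist (WordSpace.mk (x.val : G) : WordSpace S) (WordSpace.mk (y.val : G)) ≤
        Λ * (K * (d + 2) + 1) := e3.trans (mul_le_mul_of_nonneg_left (by linarith) (by linarith))
    have f3 : dist (WordSpace.mk x.val : WordSpace T) (WordSpace.mk y.val) ≤
        (Λ * (K * (d + 2) + 1) + Q) * Q :=
      e4.trans (mul_le_mul_of_nonneg_right (by linarith) (by linarith))
    have f4 : dist x y ≤ Λ₁ * ((Λ * (K * (d + 2) + 1) + Q) * Q) :=
      e5.trans (mul_le_mul_of_nonneg_left f3 (by linarith))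
    have f5 : Λ₁ * ((Λ * (K * (d + 2) + 1) + Q) * Q) = A * d + E := by rw [hE, hA]; ring
    rw [sub_le_iff_le_add, div_le_iff₀ (by linarith)]
    have f6 : A * d ≤ (A + E + Λ₂) * d := mul_le_mul_of_nonneg_right (by linarith) hd0
    have f7 : (A + E + Λ₂) * 1 ≤ (A + E + Λ₂) * (A + E + Λ₂) :=
      mul_le_mul_of_nonneg_left (by linarith) (by linarith)
    change dist x y ≤ (d + _) * _
    linarith
  · have e1 := hup x.val y.val
    have e2 : Λ₂ * dist x y ≤ (A + E + Λ₂) * dist x y :=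
      mul_le_mul_of_nonneg_right (by linarith) dist_nonneg
    have e3 : dist ((x.val : G) • p) ((y.val : G) • p) ≤ Λ₂ * dist x y := e1
    linarith

theorem actsAcylindricallyAlong_orbit (hG : IsGeometricAction G X) (hX : IsMorseDichotomous X)
    {H : Subgroup G} (hH : IsStable H) (p : ContractionSpace X) :
    ActsAcylindricallyAlong G {q : ContractionSpace X | ∃ h ∈ H, q = h • p} := by
  intro R hR
  obtain ⟨x₀, hx₀⟩ := exists_dist_toContractionSpace_le p
  obtain ⟨D, hD, hcontr⟩ := exists_contractsAlong hG hX hH x₀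
  set K := 1002 * D with hK
  -- `R₁` bounds how far the projection of a translated endpoint moves; `R₃` will bound the
  -- displacement of `h • x₀` in `X`.
  set R₁ := K * (R + 2) with hR₁
  have hR₁0 : 0 ≤ R₁ := mul_nonneg (by linarith) (by linarith)
  set R₃ := R₁ + 17 * D + K * (R + 1 + R₁ + 17 * D + 1) with hR₃
  have hfin := hG.proper x₀ R₃
  refine ⟨hfin.toFinset.card + 1, 2 * R₁ + 5 * D + 1, by linarith, ?_⟩
  rintro _ ⟨h, hh, rfl⟩ _ ⟨k, hk, rfl⟩ hdist
  set q₀ := toContractionSpace x₀ with hq₀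
  obtain ⟨σ, hσ⟩ := hX.1 (h • x₀) (k • x₀)
  obtain ⟨γ, hγ, h0, h1, -⟩ := hσ.exists_geodesic
  set L := dist (h • x₀) (k • x₀) with hL
  have hL0 : 0 ≤ L := dist_nonneg
  have hc := hcontr h hh k hk γ L hL0 hγ h0 h1
  have hmove : ∀ g g' : G, dist (g • q₀) (g' • q₀) ≤ dist (g • p) (g' • p) + 1 ∧
      dist (g • p) (g' • p) ≤ dist (g • q₀) (g' • q₀) + 1 := by
    intro g g'
    have e1 := dist_triangle4 (g • q₀) (g • p) (g' • p) (g' • q₀)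
    have e2 := dist_triangle4 (g • p) (g • q₀) (g' • q₀) (g' • p)
    rw [dist_smul, dist_smul, dist_comm q₀ p] at e1
    rw [dist_smul, dist_smul, dist_comm q₀ p] at e2
    constructor <;> linarith
  have hLbig : 2 * R₁ + 5 * D < L := by
    have e1 := (hmove h k).2
    have e2 : dist (h • q₀) (k • q₀) ≤ L := cdist_le_dist _ _
    linarith
  -- Conjugation by `h` carries displacement at `h • x₀` to displacement at `x₀`, so one finite set
  -- serves every pair of orbit points.
  have hsub : {g : G | dist (h • p) (g • h • p) < R ∧ dist (k • p) (g • k • p) < R} ⊆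
      (fun g => h * g * h⁻¹) '' {g : G | dist x₀ (g • x₀) ≤ R₃} := by
    rintro g ⟨hgh, hgk⟩
    refine ⟨h⁻¹ * g * h, ?_, by group⟩
    suffices hs : dist (h • x₀) (g • h • x₀) ≤ R₃ by
      rw [mem_ofPred_eq, ← dist_smul h]
      simpa only [smul_smul, ← mul_assoc, mul_inv_cancel, one_mul] using hs
    rw [smul_smul] at hgh hgk
    have hch : cdist (h • x₀) (g • h • x₀) ≤ R + 1 := by
      have := (hmove h (g * h)).1
      rw [hq₀, dist_smul_toContractionSpace, mul_smul] at this
      linarith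
    have hck : cdist (k • x₀) (g • k • x₀) ≤ R + 1 := by
      have := (hmove k (g * k)).1
      rw [hq₀, dist_smul_toContractionSpace, mul_smul] at this
      linarith
    have hm0 : (0 : ℝ) ∈ Icc 0 L := ⟨le_rfl, hL0⟩
    have hmL : L ∈ Icc 0 L := ⟨hL0, le_rfl⟩
    obtain ⟨u, hu⟩ := exists_projAt hγ (g • h • x₀)
    obtain ⟨v, hv⟩ := exists_projAt hγ (g • k • x₀)
    have p0 : ProjAt γ 0 L (h • x₀) 0 := h0 ▸ ProjAt.self hm0
    have pL : ProjAt γ 0 L (k • x₀) L := h1 ▸ ProjAt.self hmL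
    have e1 : |0 - u| ≤ R₁ := (hc.abs_sub_le_cdist hX.1 p0 hu).trans
      (mul_le_mul_of_nonneg_left (by linarith) (by linarith))
    have e2 : |L - v| ≤ R₁ := (hc.abs_sub_le_cdist hX.1 pL hv).trans
      (mul_le_mul_of_nonneg_left (by linarith) (by linarith))
    rw [abs_le] at e1 e2
    -- The translated geodesic projects across `[R₁, L - R₁]`, longer than `5 * D`, so it passes
    -- near `γ R₁`. Its passing time `τ` is bounded because all `cdist` lengths back to the start
    -- are.
    obtain ⟨τ, hτ, hd⟩ := hc.exists_dist_le (p := R₁) (hγ.smul g) (s := 0) (t := L)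
      (by rwa [h0]) (by rwa [h1]) (by rw [uIcc_of_le (by linarith)]; exact ⟨by linarith, by linarith⟩)
      (by rw [abs_of_nonpos (by linarith)]; linarith)
    have hRm : R₁ ∈ Icc 0 L := ⟨hR₁0, by linarith⟩
    have f1 : dist (h • x₀) (γ R₁) = R₁ := by
      rw [← h0, hγ.dist_eq 0 hm0 R₁ hRm, zero_sub, abs_neg, abs_of_nonneg hR₁0]
    have f2 : dist (g • h • x₀) (g • γ τ) = τ := by
      rw [dist_smul, ← h0, hγ.dist_eq 0 hm0 τ hτ, zero_sub, abs_neg, abs_of_nonneg hτ.1]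
    have f3 := hc.abs_sub_le_cdist_self hX.1 hτ hm0
    rw [sub_zero, abs_of_nonneg hτ.1, h0, cdist_comm] at f3
    have f4 := cdist_smul g (h • x₀) (γ τ)
    have f5 := cdist_triangle (g • h • x₀) (h • x₀) (g • γ τ)
    have f6 := cdist_triangle (h • x₀) (γ R₁) (g • γ τ)
    have f7 := cdist_le_dist (h • x₀) (γ R₁)
    have f8 := cdist_le_dist (γ R₁) (g • γ τ)
    rw [dist_comm] at f8
    rw [cdist_comm (g • h • x₀) (h • x₀)] at f5
    have f9 : τ ≤ K * (R + 1 + R₁ + 17 * D + 1) :=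
      f3.trans (mul_le_mul_of_nonneg_left (by linarith) (by linarith))
    have f10 := dist_triangle4 (h • x₀) (γ R₁) (g • γ τ) (g • h • x₀)
    rw [dist_comm (g • γ τ) (g • h • x₀), dist_comm (γ R₁)] at f10
    linarith
  refine lt_of_le_of_lt ((encard_le_encard hsub).trans (encard_image_le _ _)) ?_
  rw [hfin.encard_eq_coe_toFinset_card]
  exact_mod_cast Nat.lt_succ_self _

end Recognizing

end Contraction

theorem mainTheorem7 {G : Type*} [Group G] [Group.FG G] {X : Type*} [MetricSpace X]
    [MulAction G X] [IsIsometricSMul G X] (hG : IsGeometricAction G X)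
    (hX : IsMorseDichotomous X) :
    IsUniversalRecognizingSpace G (ContractionSpace X) ∧
      ∀ H : Subgroup G, IsStable H → ∀ p : ContractionSpace X,
        ActsAcylindricallyAlong G {q : ContractionSpace X | ∃ h ∈ H, q = h • p} :=
  ⟨⟨isHyperbolicSpace_contractionSpace hX.1, inferInstance, fun _ hH =>
    isRecognizingSpaceFor hG hX hH⟩, fun _ hH p => actsAcylindricallyAlong_orbit hG hX hH p⟩
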